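/- Let $V$ be a complex locally convex space with a continuous Hermitian (positive definite) scalar product $\langle\cdot,\cdot\rangle$, antilinear in the first and linear in the second argument. Smoothness over $\mathbb{R}$ or $\mathbb{C}$ is understood in the sense of Michal--Bastiani. Give $\mathbb{P}(V)$ the quotient topology and, for unit vectors $\psi$, the charts $\kappa_\psi([\chi]) = \langle\psi,\chi\rangle^{-1}\chi-\psi$ from $\{[\chi] : \langle\psi,\chi\rangle\neq 0\}$ onto $T_{[\psi]} = \{v\in V : \langle\psi,v\rangle=0\}$, and identify $T_{[\psi]}\mathbb{P}(V)$ with $T_{[\psi]}$ by the differential of $\kappa_\psi$ at $[\psi]$. Give the sphere $\mathbb{S}(V)=\{\psi\in V : \langle\psi,\psi\rangle=1\}$ the charts $\chi\mapsto(\mathrm{Re}\langle\psi,\chi\rangle)^{-1}\chi-\psi$ from $\{\chi : \mathrm{Re}\langle\psi,\chi\rangle>0\}$ onto $T_\psi=\{v : \mathrm{Re}\langle\psi,v\rangle=0\}\cong T_\psi\mathbb{S}(V)$. 1. $\mathbb{P}(V)$ is a (Hausdorff) complex manifold modelled on locally convex spaces. The forms $H_{[\psi]}(v,w)=2\langle v,w\rangle$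 on $T_{[\psi]}$ do not depend on the unit vector $\psi$ representing $[\psi]$, and $(\mathbb{P}(V),H)$ is a locally convex Kähler manifold: $H$ is a smooth field of positive definite Hermitian forms, and $\Omega=\mathrm{Im}\,H$, i.e. $\Omega_{[\psi]}(v,w)=2\,\mathrm{Im}\langle v,w\rangle$, is a symplectic form (smooth, closed, and weakly nondegenerate: $\Omega(v,\cdot)=0$ implies $v=0$). 2. $\mathbb{S}(V)$ is a smooth locally convex manifold, the projection $\pi:\mathbb{S}(V)\to\mathbb{P}(V)$ is a smooth principal $\mathrm{U}(1)$-bundle, and $\alpha_\psi(v)=-i\langle\psi,v\rangle$ ($v\in T_\psi$) is a real-valued principal connection $1$-form on it (smooth, $\mathrm{U}(1)$-invariant, with value $1$ on the generator $\psi\mapsto i\psi$ of the action), with curvature $\Omega$: $d\alpha=\pi^*\Omega$. 3. The tautological bundle $\mathbb{L}(V)=\{(p,l) : p\in\mathbb{P}(V),\ l\in p\}\to\mathbb{P}(V)$, with the topology induced from $\mathbb{P}(V)\times V$ and the charts with inverse $(v,z)\mapsto([\psi+v],z(\psi+v))$, $v\in T_{[\psi]}$, $z\in\mathbb{C}$,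 is a holomorphic line bundle, and $(\psi,c)\mapsto([\psi],c\psi)$ identifies it, as a smooth complex line bundle, with $\mathbb{S}(V)\times_{\mathrm{U}(1)}\mathbb{C}$. Let $\nabla$ be the connection on $\mathbb{L}(V)$ inherited from $\alpha$: if $s([\chi])=f(\chi)\chi$ for $\chi\in\mathbb{S}(V)$ and $Y\in T_\psi$ is $\alpha$-horizontal, then $(\nabla_{\pi_*Y}s)([\psi])=df_\psi(Y)\,\psi$. Then $\mathbb{L}(V)$ with $\nabla$, and with the Hermitian metric $\langle\cdot,\cdot\rangle$ on its fibres, is a prequantum line bundle for $\Omega$: $\nabla$ is a metric connection with curvature $\Omega$. Here the Lie algebra of $\mathrm{U}(1)$ is identified with $\mathbb{R}$, so that curvature $\Omega$ means: if $\nabla e=\theta e$ for a local frame $e$, then $d\theta=i\,\Omega$. -/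

import Mathlib

open Set Filter Topology
open scoped LinearAlgebra.Projectivization

universe u

noncomputable section

/-! ### Differential calculus in locally convex spaces (Michal--Bastiani, Keller's `C^∞_c`) -/

section Calculus

variable (𝕜 : Type*) [NontriviallyNormedField 𝕜]
  {E : Type*} [AddCommGroup E] [Module 𝕜 E]
  {F : Type*} [AddCommGroup F] [Module 𝕜 F] [TopologicalSpace F]

/-- The directional derivative of `f` at `x` in the direction `v` exists and equals `w`. -/
def HasDirDeriv (f : E → F) (x v : E) (w : F) : Prop :=
  Tendsto (fun t : 𝕜 => t⁻¹ • (f (x + t • v) - f x)) (𝓝[≠] 0) (𝓝 w)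

/-- The directional derivative of `f` at `x` in the direction `v`. -/
def dirDeriv (f : E → F) (x v : E) : F :=
  limUnder (𝓝[≠] (0 : 𝕜)) fun t : 𝕜 => t⁻¹ • (f (x + t • v) - f x)

end Calculus

/-- `f` is of class `C^n` over `𝕜` on the open set `U` in the sense of Michal--Bastiani:
`f` is continuous on `U`, all its directional derivatives `df (x, v)` with `x ∈ U` exist,
and `df : U × E → F` is of class `C^(n-1)`. -/
def MBContDiffOn (𝕜 : Type*) [NontriviallyNormedField 𝕜]
    {F : Type*} [AddCommGroup F] [Module 𝕜 F] [TopologicalSpace F] :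
    ℕ → ∀ {E : Type u} [AddCommGroup E] [Module 𝕜 E] [TopologicalSpace E],
      (E → F) → Set E → Prop
  | 0, _, _, _, _, f, U => ContinuousOn f U
  | n + 1, E, _, _, _, f, U => ContinuousOn f U ∧ ∃ df : E × E → F,
      (∀ x ∈ U, ∀ v, HasDirDeriv 𝕜 f x v (df (x, v))) ∧ MBContDiffOn 𝕜 n df (U ×ˢ univ)

/-- `f` is smooth over `𝕜` on the open set `U`; for `𝕜 = ℂ`, `f` is holomorphic on `U`. -/
def MBSmoothOn (𝕜 : Type*) [NontriviallyNormedField 𝕜]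
    {E : Type u} [AddCommGroup E] [Module 𝕜 E] [TopologicalSpace E]
    {F : Type*} [AddCommGroup F] [Module 𝕜 F] [TopologicalSpace F]
    (f : E → F) (U : Set E) : Prop :=
  ∀ n, MBContDiffOn 𝕜 n f U

/-- `E` is a Hausdorff locally convex space over `𝕜`. -/
structure IsLCModel (𝕜 : Type*) [NontriviallyNormedField 𝕜] (E : Type*) [AddCommGroup E]
    [Module 𝕜 E] [Module ℝ E] [TopologicalSpace E] : Prop where
  addGroup : IsTopologicalAddGroup E
  smul : ContinuousSMul 𝕜 E
  convex : LocallyConvexSpace ℝ E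
  t2 : T2Space E

/-! ### Locally convex manifolds -/

/-- The data of a family of charts `κ_i : source i → target i ⊆ E i` on `M`, where the model
space may depend on the chart, together with a chart `at p` around each point `p`. The values
of `toFun i` and `invFun i` outside `source i` and `target i` are irrelevant.
The axioms of a manifold are in `IsLCManifold`. -/
structure ChartFamily (M : Type*) {ι : Type*} (E : ι → Type*) where
  source : ι → Set M
  target : ∀ i, Set (E i)
  toFun : ∀ i, M → E i
  invFun : ∀ i, E i → M
  chartIx : M → ι

/-- `M` with the charts `A` is a manifold (smooth for `𝕜 = ℝ`, complex for `𝕜 = ℂ`) modelled on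
locally convex spaces. -/
structure IsLCManifold (𝕜 : Type*) [NontriviallyNormedField 𝕜] {M : Type*} [TopologicalSpace M]
    {ι : Type*} {E : ι → Type*} [∀ i, AddCommGroup (E i)] [∀ i, Module 𝕜 (E i)]
    [∀ i, Module ℝ (E i)] [∀ i, TopologicalSpace (E i)] (A : ChartFamily M E) : Prop where
  model : ∀ i, IsLCModel 𝕜 (E i)
  t2 : T2Space M
  mem_source_at : ∀ p, p ∈ A.source (A.chartIx p)
  isOpen_source : ∀ i, IsOpen (A.source i)
  isOpen_target : ∀ i, IsOpen (A.target i)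
  mapsTo : ∀ i, MapsTo (A.toFun i) (A.source i) (A.target i)
  mapsTo_inv : ∀ i, MapsTo (A.invFun i) (A.target i) (A.source i)
  left_inv : ∀ i, LeftInvOn (A.invFun i) (A.toFun i) (A.source i)
  right_inv : ∀ i, RightInvOn (A.invFun i) (A.toFun i) (A.target i)
  continuousOn : ∀ i, ContinuousOn (A.toFun i) (A.source i)
  continuousOn_inv : ∀ i, ContinuousOn (A.invFun i) (A.target i)
  smooth_transition : ∀ i j, MBSmoothOn 𝕜 (fun x => A.toFun j (A.invFun i x))
    (A.target i ∩ A.invFun i ⁻¹' A.source j)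

namespace ChartFamily

/-- The product of two families of charts. -/
def prod {M ι N κ : Type*} {E : ι → Type*} {F : κ → Type*} (A : ChartFamily M E)
    (B : ChartFamily N F) : ChartFamily (M × N) (fun k : ι × κ => E k.1 × F k.2) where
  source k := A.source k.1 ×ˢ B.source k.2
  target k := A.target k.1 ×ˢ B.target k.2
  toFun k p := (A.toFun k.1 p.1, B.toFun k.2 p.2)
  invFun k x := (A.invFun k.1 x.1, B.invFun k.2 x.2)
  chartIx p := (A.chartIx p.1, B.chartIx p.2)

/-- The tangent space at `p`, identified with the model space of the chart at `p`. -/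
abbrev Tan {M ι : Type*} {E : ι → Type*} (A : ChartFamily M E) (p : M) : Type _ := E (A.chartIx p)

section

variable {M ι : Type*} {E : ι → Type*} [∀ i, AddCommGroup (E i)] [∀ i, Module ℝ (E i)]
  [∀ i, TopologicalSpace (E i)]
  {N κ : Type*} {F : κ → Type*} [∀ i, AddCommGroup (F i)] [∀ i, Module ℝ (F i)]
  [∀ i, TopologicalSpace (F i)]
  {R : Type*} [AddCommGroup R] [Module ℝ R] [TopologicalSpace R]

/-- `f : M → N` is a smooth map on the open set `U ⊆ M`. -/
def SmoothMapOn [TopologicalSpace M] [TopologicalSpace N] (A : ChartFamily M E)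
    (B : ChartFamily N F) (f : M → N) (U : Set M) : Prop :=
  ContinuousOn f U ∧ ∀ i j, MBSmoothOn ℝ (fun x => B.toFun j (f (A.invFun i x)))
    (A.target i ∩ {x | A.invFun i x ∈ U ∧ f (A.invFun i x) ∈ B.source j})

/-- The function `g : M → R` with values in a locally convex space is smooth on the open set
`U ⊆ M`. -/
def SmoothFunOn (A : ChartFamily M E) (g : M → R) (U : Set M) : Prop :=
  ∀ i, MBSmoothOn ℝ (fun x => g (A.invFun i x)) (A.target i ∩ A.invFun i ⁻¹' U)

/-- The tangent vector at the point with coordinate `x` in the chart `i` whose coordinate in the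
chart `i` is `v`. -/
def toTan (A : ChartFamily M E) (i : ι) (x v : E i) : A.Tan (A.invFun i x) :=
  dirDeriv ℝ (fun y => A.toFun (A.chartIx (A.invFun i x)) (A.invFun i y)) x v

/-- The tangent map of `f : M → N` at `p`. -/
def tangentMap (A : ChartFamily M E) (B : ChartFamily N F) (f : M → N) (p : M) (v : A.Tan p) :
    B.Tan (f p) :=
  dirDeriv ℝ (fun y => B.toFun (B.chartIx (f p)) (f (A.invFun (A.chartIx p) y)))
    (A.toFun (A.chartIx p) p) v

/-- The differential at `p` of a function `g : M → R` with values in a locally convex space. -/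
def dFun (A : ChartFamily M E) (g : M → R) (p : M) (v : A.Tan p) : R :=
  dirDeriv ℝ (fun y => g (A.invFun (A.chartIx p) y)) (A.toFun (A.chartIx p) p) v

/-! #### Differential forms -/

/-- The representation of the 1-form `θ` in the chart `i`. -/
def rep₁ (A : ChartFamily M E) (θ : ∀ p, A.Tan p → R) (i : ι) (x v : E i) : R :=
  θ (A.invFun i x) (A.toTan i x v)

/-- The representation of the 2-tensor `ω` in the chart `i`. -/
def rep₂ (A : ChartFamily M E) (ω : ∀ p, A.Tan p → A.Tan p → R) (i : ι) (x v w : E i) : R :=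
  ω (A.invFun i x) (A.toTan i x v) (A.toTan i x w)

/-- `θ` is a smooth 1-form on `M`. -/
structure IsSmoothOneForm (A : ChartFamily M E) (θ : ∀ p, A.Tan p → R) : Prop where
  linear : ∀ p, IsLinearMap ℝ (θ p)
  smooth : ∀ i, MBSmoothOn ℝ (fun x : E i × E i => A.rep₁ θ i x.1 x.2) (A.target i ×ˢ univ)

/-- `ω` is a smooth (covariant, real bilinear) 2-tensor field on `M`. -/
structure IsSmoothTwoTensor (A : ChartFamily M E) (ω : ∀ p, A.Tan p → A.Tan p → R) : Prop where
  linear_left : ∀ p w, IsLinearMap ℝ (fun v => ω p v w)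
  linear_right : ∀ p v, IsLinearMap ℝ (ω p v)
  smooth : ∀ i, MBSmoothOn ℝ (fun x : E i × E i × E i => A.rep₂ ω i x.1 x.2.1 x.2.2)
    (A.target i ×ˢ univ)

/-- The pullback of the 2-tensor `ω` on `N` along `f : M → N`. -/
def pullback₂ (A : ChartFamily M E) (B : ChartFamily N F) (f : M → N)
    (ω : ∀ p, B.Tan p → B.Tan p → R) : ∀ p, A.Tan p → A.Tan p → R :=
  fun p v w => ω (f p) (tangentMap A B f p v) (tangentMap A B f p w)

end

end ChartFamily

section ExteriorDerivative

variable {E : Type*} [AddCommGroup E] [Module ℝ E]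
  {R : Type*} [AddCommGroup R] [Module ℝ R] [TopologicalSpace R]

/-- The exterior derivative at `x` of a 1-form on an open subset of `E`, on the constant vector
fields `u` and `v`. -/
def extDeriv₁ (θ : E → E → R) (x u v : E) : R :=
  dirDeriv ℝ (fun y => θ y v) x u - dirDeriv ℝ (fun y => θ y u) x v

/-- The exterior derivative at `x` of a 2-form on an open subset of `E`, on the constant vector
fields `u`, `v` and `w`. -/
def extDeriv₂ (ω : E → E → E → R) (x u v w : E) : R :=
  dirDeriv ℝ (fun y => ω y v w) x u + dirDeriv ℝ (fun y => ω y w u) x v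
    + dirDeriv ℝ (fun y => ω y u v) x w

end ExteriorDerivative

namespace ChartFamily

/-! #### Symplectic and Kähler manifolds -/

/-- `ω` is a symplectic form on the smooth locally convex manifold `M`: a smooth, closed 2-form
that is nondegenerate in the weak sense. -/
structure IsSymplectic {M : Type*} [TopologicalSpace M] {ι : Type*} {E : ι → Type*}
    [∀ i, AddCommGroup (E i)] [∀ i, Module ℝ (E i)] [∀ i, TopologicalSpace (E i)]
    (A : ChartFamily M E) (ω : ∀ p, A.Tan p → A.Tan p → ℝ) : Prop where
  manifold : IsLCManifold ℝ A
  tensor : A.IsSmoothTwoTensor ω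
  alternating : ∀ p v, ω p v v = 0
  closed : ∀ i, ∀ x ∈ A.target i, ∀ u v w, extDeriv₂ (A.rep₂ ω i) x u v w = 0
  nondegenerate : ∀ p v, (∀ w, ω p v w = 0) → v = 0

/-- The imaginary part of a Hermitian form. -/
def imForm {M ι : Type*} {E : ι → Type*} (A : ChartFamily M E)
    (H : ∀ p, A.Tan p → A.Tan p → ℂ) : ∀ p, A.Tan p → A.Tan p → ℝ :=
  fun p v w => (H p v w).im

/-- `M` with the Hermitian form `H` (antilinear in the first argument) is a locally convex
Hermitian manifold. The complex structure on the tangent spaces is multiplication by `i`; as the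
transition functions are holomorphic, it does not depend on charts, and its compatibility with
`H` is the sesquilinearity of `H`. -/
structure IsHermitian {M : Type*} [TopologicalSpace M] {ι : Type*} {E : ι → Type*}
    [∀ i, AddCommGroup (E i)] [∀ i, Module ℂ (E i)] [∀ i, TopologicalSpace (E i)]
    (A : ChartFamily M E) (H : ∀ p, A.Tan p → A.Tan p → ℂ) : Prop where
  manifold : IsLCManifold ℂ A
  tensor : A.IsSmoothTwoTensor H
  linear : ∀ p v, IsLinearMap ℂ (H p v)
  conj_symm : ∀ p v w, H p w v = star (H p v w)
  posDef : ∀ p v, v ≠ 0 → 0 < (H p v v).re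

/-- `M` with the Hermitian form `H` is a locally convex Kähler manifold: it is a Hermitian
manifold, and the 2-form `Im H` is symplectic. -/
structure IsKaehler {M : Type*} [TopologicalSpace M] {ι : Type*} {E : ι → Type*}
    [∀ i, AddCommGroup (E i)] [∀ i, Module ℂ (E i)] [∀ i, TopologicalSpace (E i)]
    (A : ChartFamily M E) (H : ∀ p, A.Tan p → A.Tan p → ℂ) : Prop where
  hermitian : A.IsHermitian H
  symplectic : A.IsSymplectic (A.imForm H)

end ChartFamily

/-! ### Principal circle bundles -/

/-- The circle `U(1)` with the angle charts `w ↦ arg (w / z)`, `z ∈ U(1)`. -/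
def circleCharts : ChartFamily Circle (fun _ : Circle => ℝ) where
  source z := {w | ((w / z : Circle) : ℂ) ∈ Complex.slitPlane}
  target _ := Ioo (-Real.pi) Real.pi
  toFun z w := Complex.arg ((w / z : Circle) : ℂ)
  invFun z t := z * Circle.exp t
  chartIx z := z

section Principal

variable {S ι M κ : Type*} [TopologicalSpace S] [TopologicalSpace M] [MulAction Circle S]
  {E : ι → Type*} [∀ i, AddCommGroup (E i)] [∀ i, Module ℝ (E i)] [∀ i, TopologicalSpace (E i)]
  {F : κ → Type*} [∀ i, AddCommGroup (F i)] [∀ i, Module ℝ (F i)] [∀ i, TopologicalSpace (F i)]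

/-- `π : S → M` is a smooth principal `U(1)`-bundle of locally convex manifolds. Every point of
`M` has an open neighbourhood `U` with an equivariant diffeomorphism `τ : U × U(1) → π⁻¹(U)` over
`U`, with inverse `s ↦ (π s, ζ s)`. (As `U(1)` is abelian, we do not distinguish between left and
right actions.) -/
structure IsPrincipalCircleBundle (B : ChartFamily S E) (A : ChartFamily M F) (π : S → M) :
    Prop where
  total : IsLCManifold ℝ B
  base : IsLCManifold ℝ A
  smooth_action : (circleCharts.prod B).SmoothMapOn B (fun q => q.1 • q.2) univ
  smooth_proj : B.SmoothMapOn A π univ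
  locally_trivial : ∀ p : M, ∃ U : Set M, IsOpen U ∧ p ∈ U ∧
    ∃ (τ : M × Circle → S) (ζ : S → Circle),
      (∀ q ∈ U, ∀ z, π (τ (q, z)) = q) ∧
      (∀ q ∈ U, ∀ z w, τ (q, z * w) = z • τ (q, w)) ∧
      (∀ q ∈ U, ∀ z, ζ (τ (q, z)) = z) ∧
      (∀ s, π s ∈ U → τ (π s, ζ s) = s) ∧
      (A.prod circleCharts).SmoothMapOn B τ (U ×ˢ univ) ∧
      B.SmoothMapOn circleCharts ζ (π ⁻¹' U)

/-- The vector field on `S` generated by the `U(1)`-action,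
`X₁(s) = d/dt|₀ (exp(it) • s)`. -/
def circleField (B : ChartFamily S E) (s : S) : B.Tan s :=
  dirDeriv ℝ (fun t : ℝ => B.toFun (B.chartIx s) (Circle.exp t • s)) 0 1

/-- The (real-valued) 1-form `α` on `S` is a principal connection 1-form, where the Lie algebra of
`U(1)` is identified with `ℝ`. -/
structure IsPrincipalConnection (B : ChartFamily S E) (α : ∀ s, B.Tan s → ℝ) : Prop where
  form : B.IsSmoothOneForm α
  invariant : ∀ (z : Circle) (s : S) (v : B.Tan s),
    α (z • s) (ChartFamily.tangentMap B B (fun s' => z • s') s v) = α s v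
  generator : ∀ s, α s (circleField B s) = 1

/-- The connection 1-form `α` has curvature `ω`, i.e. `dα = π^* ω`. -/
def PrincipalCurvature (B : ChartFamily S E) (A : ChartFamily M F) (π : S → M)
    (α : ∀ s, B.Tan s → ℝ) (ω : ∀ p, A.Tan p → A.Tan p → ℝ) : Prop :=
  ∀ i, ∀ x ∈ B.target i, ∀ u v,
    extDeriv₁ (B.rep₁ α i) x u v = B.rep₂ (ChartFamily.pullback₂ B A π ω) i x u v

end Principal

/-! ### Complex line bundles with connection -/

/-- The data of local frames `frame i p ∈ Fib p`, `p ∈ source i`, for a family of complex lines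
`Fib p`, with the coordinate `coord i p` on `Fib p` with respect to `frame i p`. -/
structure LineFrames {M : Type*} (ι : Type*) (Fib : M → Type*) where
  frame : ι → ∀ p, Fib p
  coord : ι → ∀ p, Fib p → ℂ

section LineBundle

variable {M ι : Type*} {E : ι → Type*} {Fib : M → Type*}
  [∀ p, AddCommGroup (Fib p)] [∀ p, Module ℂ (Fib p)]

/-- The charts of the total space of a line bundle defined by local frames. Their inverses are
`(x, z) ↦ z • frame i (κ_i⁻¹ x)`. -/
def LineFrames.charts (D : LineFrames ι Fib) (A : ChartFamily M E) :
    ChartFamily (Bundle.TotalSpace ℂ Fib) (fun i => E i × ℂ) where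
  source i := Bundle.TotalSpace.proj ⁻¹' A.source i
  target i := A.target i ×ˢ univ
  toFun i l := (A.toFun i l.proj, D.coord i l.proj l.snd)
  invFun i x := ⟨A.invFun i x.1, x.2 • D.frame i (A.invFun i x.1)⟩
  chartIx l := A.chartIx l.proj

/-- The total space of the lines `Fib p` is a complex line bundle over the locally convex manifold
`M`: a smooth one for `𝕜 = ℝ`, a holomorphic one for `𝕜 = ℂ`. -/
structure IsLineBundle (𝕜 : Type*) [NontriviallyNormedField 𝕜] [Module 𝕜 ℂ]
    [∀ i, AddCommGroup (E i)] [∀ i, Module 𝕜 (E i)]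
    [∀ i, Module ℝ (E i)] [∀ i, TopologicalSpace (E i)] [TopologicalSpace M]
    [TopologicalSpace (Bundle.TotalSpace ℂ Fib)] (A : ChartFamily M E) (D : LineFrames ι Fib) :
    Prop where
  base : IsLCManifold 𝕜 A
  total : IsLCManifold 𝕜 (D.charts A)
  linear : ∀ i, ∀ p ∈ A.source i, IsLinearMap ℂ (D.coord i p)

variable [∀ i, AddCommGroup (E i)] [∀ i, Module ℝ (E i)] [∀ i, TopologicalSpace (E i)]
  [TopologicalSpace M]

/-- The section `s` is smooth on the open set `U`. -/
def SmoothSectionOn (A : ChartFamily M E) (D : LineFrames ι Fib) (s : ∀ p, Fib p) (U : Set M) :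
    Prop :=
  ∀ i, MBSmoothOn ℝ (fun x => D.coord i (A.invFun i x) (s (A.invFun i x)))
    (A.target i ∩ A.invFun i ⁻¹' U)

/-- `D` is a linear connection (covariant derivative) on a line bundle. Here `D p X s ∈ Fib p` is
the derivative `∇_X s` at `p` of a section `s` that is smooth in a neighbourhood of `p`; its values
on other sections are irrelevant. -/
structure IsConnection (A : ChartFamily M E) (D : LineFrames ι Fib)
    (nabla : ∀ p, A.Tan p → (∀ q, Fib q) → Fib p) : Prop where
  linear : ∀ (U : Set M) (s : ∀ q, Fib q), IsOpen U → SmoothSectionOn A D s U →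
    ∀ p ∈ U, IsLinearMap ℝ (fun X => nabla p X s)
  local_eq : ∀ (U : Set M) (s s' : ∀ q, Fib q), IsOpen U → SmoothSectionOn A D s U →
    (∀ q ∈ U, s q = s' q) → ∀ p ∈ U, ∀ X, nabla p X s = nabla p X s'
  add : ∀ (U : Set M) (s s' : ∀ q, Fib q), IsOpen U → SmoothSectionOn A D s U →
    SmoothSectionOn A D s' U →
    ∀ p ∈ U, ∀ X, nabla p X (fun q => s q + s' q) = nabla p X s + nabla p X s'
  leibniz : ∀ (U : Set M) (g : M → ℂ) (s : ∀ q, Fib q), IsOpen U → A.SmoothFunOn g U →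
    SmoothSectionOn A D s U →
    ∀ p ∈ U, ∀ X, nabla p X (fun q => g q • s q) = A.dFun g p X • s p + g p • nabla p X s
  smooth : ∀ (U : Set M) (s : ∀ q, Fib q), IsOpen U → SmoothSectionOn A D s U →
    ∀ i, MBSmoothOn ℝ
      (fun x : E i × E i =>
        D.coord i (A.invFun i x.1) (nabla (A.invFun i x.1) (A.toTan i x.1 x.2) s))
      ((A.target i ∩ A.invFun i ⁻¹' U) ×ˢ univ)

/-- The local connection 1-form `θ_i` of `∇` in the chart `i`: `∇ e_i = θ_i e_i` for
`e_i = frame i`. -/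
def connectionForm (A : ChartFamily M E) (D : LineFrames ι Fib)
    (nabla : ∀ p, A.Tan p → (∀ q, Fib q) → Fib p) (i : ι) (x v : E i) : ℂ :=
  D.coord i (A.invFun i x) (nabla (A.invFun i x) (A.toTan i x v) (D.frame i))

/-- The line bundle connection `∇` has curvature `ω`. The curvature of a line bundle connection is
the closed 2-form given locally by `dθ_i`; under the identification of the Lie algebra of `U(1)`
with `ℝ`, the curvature is `ω` if this 2-form is `i ω`. -/
def LineBundleCurvature (A : ChartFamily M E) (D : LineFrames ι Fib)
    (nabla : ∀ p, A.Tan p → (∀ q, Fib q) → Fib p) (ω : ∀ p, A.Tan p → A.Tan p → ℝ) : Prop :=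
  ∀ i, ∀ x ∈ A.target i, ∀ u v,
    extDeriv₁ (connectionForm A D nabla i) x u v = Complex.I * ((A.rep₂ ω i x u v : ℝ) : ℂ)

/-- `h` is a smooth Hermitian metric on a line bundle. -/
structure IsHermitianMetric (A : ChartFamily M E) (D : LineFrames ι Fib)
    (h : ∀ p, Fib p → Fib p → ℂ) : Prop where
  linear : ∀ p l, IsLinearMap ℂ (h p l)
  conj_symm : ∀ p l m, h p m l = star (h p l m)
  posDef : ∀ p l, l ≠ 0 → 0 < (h p l l).re
  smooth : ∀ i, A.SmoothFunOn (fun p => h p (D.frame i p) (D.frame i p)) (A.source i)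

/-- The connection `∇` preserves the Hermitian metric `h`. -/
def IsMetricConnection (A : ChartFamily M E) (D : LineFrames ι Fib)
    (h : ∀ p, Fib p → Fib p → ℂ) (nabla : ∀ p, A.Tan p → (∀ q, Fib q) → Fib p) : Prop :=
  ∀ (U : Set M) (s s' : ∀ q, Fib q), IsOpen U → SmoothSectionOn A D s U →
    SmoothSectionOn A D s' U → ∀ p ∈ U, ∀ X,
    A.dFun (fun q => h q (s q) (s' q)) p X = h p (nabla p X s) (s' p) + h p (s p) (nabla p X s')

/-- A prequantum line bundle over the symplectic manifold `(M, ω)`: a Hermitian line bundle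
with a metric connection whose curvature is `ω`. -/
structure IsPrequantum [TopologicalSpace (Bundle.TotalSpace ℂ Fib)] (A : ChartFamily M E)
    (D : LineFrames ι Fib) (h : ∀ p, Fib p → Fib p → ℂ)
    (nabla : ∀ p, A.Tan p → (∀ q, Fib q) → Fib p) (ω : ∀ p, A.Tan p → A.Tan p → ℝ) : Prop where
  symplectic : A.IsSymplectic ω
  bundle : IsLineBundle ℝ A D
  metric : IsHermitianMetric A D h
  connection : IsConnection A D nabla
  metric_connection : IsMetricConnection A D h nabla
  curvature : LineBundleCurvature A D nabla ω

section Associated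

variable {S κ : Type*} [TopologicalSpace S] [MulAction Circle S] {F : κ → Type*}
  [∀ i, AddCommGroup (F i)] [∀ i, Module ℝ (F i)] [∀ i, TopologicalSpace (F i)]

/-- The map `S × ℂ → L, (s, c) ↦ c φ(s)` identifies the line bundle `L → M` with the bundle
`S ×_{U(1)} ℂ` associated to the principal bundle `π : S → M`: the map `φ` is smooth,
equivariant, and `φ(s)` spans the fibre of `L` over `π(s)`. -/
structure IsAssociatedBundle [TopologicalSpace (Bundle.TotalSpace ℂ Fib)] (B : ChartFamily S F)
    (A : ChartFamily M E) (D : LineFrames ι Fib) (π : S → M) (φ : ∀ s, Fib (π s)) : Prop where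
  smooth : B.SmoothMapOn (D.charts A)
    (fun s => (⟨π s, φ s⟩ : Bundle.TotalSpace ℂ Fib)) univ
  equivariant : ∀ (z : Circle) (s : S),
    (⟨π (z • s), φ (z • s)⟩ : Bundle.TotalSpace ℂ Fib) = ⟨π s, (z : ℂ) • φ s⟩
  basis : ∀ s, ∀ l : Fib (π s), ∃! c : ℂ, l = c • φ s

/-- `∇` is the connection on the line bundle `L = S ×_{U(1)} ℂ` inherited from the principal
connection `α`. A section of `L` corresponds to an (equivariant) function `f` on `S`, and `∇_X`
corresponds to the derivative of `f` along the horizontal lift `Y` of `X`. -/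
def IsAssociatedConnection (B : ChartFamily S F) (A : ChartFamily M E)
    (D : LineFrames ι Fib) (π : S → M) (φ : ∀ s, Fib (π s)) (α : ∀ s, B.Tan s → ℝ)
    (nabla : ∀ p, A.Tan p → (∀ q, Fib q) → Fib p) : Prop :=
  ∀ (U : Set M) (σ : ∀ q, Fib q) (f : S → ℂ), IsOpen U → SmoothSectionOn A D σ U →
    (∀ s, σ (π s) = f s • φ s) →
    ∀ s, π s ∈ U → ∀ Y : B.Tan s, α s Y = 0 →
      nabla (π s) (ChartFamily.tangentMap B A π s Y) σ = B.dFun f s Y • φ s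

end Associated

end LineBundle

/-! ### Projective space, the sphere and the tautological bundle -/

section ProjectiveSpace

variable {V : Type*} [AddCommGroup V] [Module ℂ V] [c : InnerProductSpace.Core ℂ V]

/-- The scalar product of `V`, antilinear in the first and linear in the second argument. -/
abbrev ip (x y : V) : ℂ := c.inner x y

theorem ip_add_right (x y z : V) : ip x (y + z) = ip x y + ip x z :=
  InnerProductSpace.Core.inner_add_right x y z

theorem ip_smul_right (x y : V) (r : ℂ) : ip x (r • y) = r * ip x y :=
  InnerProductSpace.Core.inner_smul_right x y

theorem ip_smul_left (x y : V) (r : ℂ) : ip (r • x) y = star r * ip x y :=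
  c.smul_left x y r

theorem ip_zero_right (x : V) : ip x 0 = 0 := InnerProductSpace.Core.inner_zero_right x

theorem ip_sub_right (x y z : V) : ip x (y - z) = ip x y - ip x z :=
  InnerProductSpace.Core.inner_sub_right x y z

theorem ip_self_eq (x : V) : ip x x = ((ip x x).re : ℂ) :=
  Complex.ext (by simp) (by simpa using InnerProductSpace.Core.inner_self_im (𝕜 := ℂ) x)

theorem ip_self_pos {x : V} (hx : x ≠ 0) : 0 < (ip x x).re := by
  refine lt_of_le_of_ne (c.re_inner_nonneg x) fun h => hx (c.definite x ?_)
  have h1 := ip_self_eq x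
  rw [← h] at h1
  simpa using h1

/-- The norm `‖v‖ = ⟨v, v⟩^{1/2}`. -/
def ipNorm (v : V) : ℝ := √(ip v v).re

variable (V) in
/-- The unit sphere `S(V)`. -/
abbrev UnitSphere : Type _ := {ψ : V // ip ψ ψ = 1}

theorem ip_unitVec {v : V} (hv : v ≠ 0) :
    ip (((ipNorm v)⁻¹ : ℂ) • v) (((ipNorm v)⁻¹ : ℂ) • v) = 1 := by
  have h := ip_self_pos hv
  have h2 : ((ipNorm v : ℝ) : ℂ) * (ipNorm v : ℝ) = ip v v := by
    rw [ip_self_eq v, ← Complex.ofReal_mul, ipNorm, Real.mul_self_sqrt h.le]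
  have h3 : ((ipNorm v : ℝ) : ℂ) ≠ 0 := by
    exact_mod_cast (Real.sqrt_pos.2 h).ne'
  rw [ip_smul_left, ip_smul_right, ← h2]
  simp only [star_inv₀, Complex.star_def, Complex.conj_ofReal]
  field_simp

/-- The unit vector `v / ‖v‖`. -/
def unitVec (v : V) (hv : v ≠ 0) : UnitSphere V := ⟨((ipNorm v)⁻¹ : ℂ) • v, ip_unitVec hv⟩

/-- The action of `U(1)` on `S(V)` by scalar multiplication. -/
instance : MulAction Circle (UnitSphere V) where
  smul z ψ := ⟨(z : ℂ) • (ψ : V), by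
    rw [ip_smul_left, ip_smul_right, ψ.2, mul_one, Complex.star_def, mul_comm, Complex.mul_conj,
      Circle.normSq_coe, Complex.ofReal_one]⟩
  one_smul ψ := Subtype.ext (one_smul ℂ (ψ : V))
  mul_smul z w ψ := Subtype.ext (by
    change ((z * w : Circle) : ℂ) • (ψ : V) = (z : ℂ) • (w : ℂ) • (ψ : V)
    rw [Circle.coe_mul, mul_smul])

/-- The complex hyperplane `{v | ⟨ψ, v⟩ = 0}`, the model of `P(V)` around `[ψ]`. -/
def hyperplane (ψ : UnitSphere V) : Submodule ℂ V where
  carrier := {v | ip (ψ : V) v = 0}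
  add_mem' {a b} ha hb := by
    change ip (ψ : V) (a + b) = 0
    rw [ip_add_right, show ip (ψ : V) a = 0 from ha, show ip (ψ : V) b = 0 from hb, add_zero]
  zero_mem' := ip_zero_right (ψ : V)
  smul_mem' r a ha := by
    change ip (ψ : V) (r • a) = 0
    rw [ip_smul_right, show ip (ψ : V) a = 0 from ha, mul_zero]

/-- The real hyperplane `{v | Re ⟨ψ, v⟩ = 0}`, the model of `S(V)` around `ψ`. -/
def realHyperplane (ψ : UnitSphere V) : Submodule ℝ V where
  carrier := {v | (ip (ψ : V) v).re = 0}
  add_mem' {a b} ha hb := by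
    change (ip (ψ : V) (a + b)).re = 0
    rw [ip_add_right, Complex.add_re, show (ip (ψ : V) a).re = 0 from ha,
      show (ip (ψ : V) b).re = 0 from hb, add_zero]
  zero_mem' := by
    change (ip (ψ : V) 0).re = 0
    rw [ip_zero_right, Complex.zero_re]
  smul_mem' r a ha := by
    change (ip (ψ : V) ((r : ℂ) • a)).re = 0
    rw [ip_smul_right, Complex.re_ofReal_mul, show (ip (ψ : V) a).re = 0 from ha, mul_zero]

theorem add_ne_zero_of_re (ψ : UnitSphere V) {v : V} (hv : (ip (ψ : V) v).re = 0) :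
    (ψ : V) + v ≠ 0 := by
  intro h
  have h1 : ip (ψ : V) ((ψ : V) + v) = 0 := by rw [h, ip_zero_right]
  rw [ip_add_right, ψ.2] at h1
  have h2 := congrArg Complex.re h1
  simp [hv] at h2

theorem add_ne_zero_of_mem (ψ : UnitSphere V) (v : hyperplane ψ) : (ψ : V) + v ≠ 0 :=
  add_ne_zero_of_re ψ (by rw [show ip (ψ : V) v = 0 from v.2, Complex.zero_re])

/-- The inclusion `{v | ⟨ψ, v⟩ = 0} ⊆ {v | Re ⟨ψ, v⟩ = 0}`. -/
def hyperplaneIncl (ψ : UnitSphere V) (v : hyperplane ψ) : realHyperplane ψ :=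
  ⟨(v : V), by
    change (ip (ψ : V) (v : V)).re = 0
    rw [show ip (ψ : V) v = 0 from v.2, Complex.zero_re]⟩

/-- `w ↦ w - ⟨ψ, w⟩ ψ`. -/
def toHyperplane (ψ : UnitSphere V) (w : V) : hyperplane ψ :=
  ⟨w - ip (ψ : V) w • (ψ : V), by
    change ip (ψ : V) _ = 0
    rw [ip_sub_right, ip_smul_right, ψ.2, mul_one, sub_self]⟩

/-- `w ↦ w - Re ⟨ψ, w⟩ ψ`. -/
def toRealHyperplane (ψ : UnitSphere V) (w : V) : realHyperplane ψ :=
  ⟨w - ((ip (ψ : V) w).re : ℂ) • (ψ : V), by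
    change (ip (ψ : V) _).re = 0
    rw [ip_sub_right, ip_smul_right, ψ.2, mul_one, Complex.sub_re, Complex.ofReal_re, sub_self]⟩

/-- The charts `κ_ψ([χ]) = ⟨ψ, χ⟩⁻¹ χ - ψ` of `P(V)` for unit vectors `ψ`, defined on
`{[χ] | ⟨ψ, χ⟩ ≠ 0}`, with inverse `v ↦ [ψ + v]`. (On this set `w = ⟨ψ, χ⟩⁻¹ χ` satisfies
`⟨ψ, w⟩ = 1`, so `toHyperplane ψ w = w - ψ`.) The chart around `p` is `κ_ψ` for a unit vector `ψ`
in `p`. -/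
def projCharts : ChartFamily (ℙ ℂ V) (fun ψ : UnitSphere V => hyperplane ψ) where
  source ψ := {p | ip (ψ : V) p.rep ≠ 0}
  target _ := univ
  toFun ψ p := toHyperplane ψ ((ip (ψ : V) p.rep)⁻¹ • p.rep)
  invFun ψ v := Projectivization.mk ℂ ((ψ : V) + v) (add_ne_zero_of_mem ψ v)
  chartIx p := unitVec p.rep p.rep_nonzero

/-- The charts `κ_ψ(χ) = (Re ⟨ψ, χ⟩)⁻¹ χ - ψ` of `S(V)`, defined on `{χ | Re ⟨ψ, χ⟩ > 0}`,
with inverse `v ↦ (ψ + v) / ‖ψ + v‖`. -/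
def sphereCharts : ChartFamily (UnitSphere V) (fun ψ : UnitSphere V => realHyperplane ψ) where
  source ψ := {χ | 0 < (ip (ψ : V) χ).re}
  target _ := univ
  toFun ψ χ := toRealHyperplane ψ ((((ip (ψ : V) χ).re)⁻¹ : ℂ) • (χ : V))
  invFun ψ v := unitVec ((ψ : V) + v) (add_ne_zero_of_re ψ v.2)
  chartIx ψ := ψ

theorem UnitSphere.ne_zero (ψ : UnitSphere V) : (ψ : V) ≠ 0 := by
  intro h
  have h1 := ψ.2
  rw [h, ip_zero_right] at h1
  exact zero_ne_one h1

/-- The projection `S(V) → P(V)`. -/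
def sphereProj (ψ : UnitSphere V) : ℙ ℂ V := Projectivization.mk ℂ (ψ : V) ψ.ne_zero

/-- The Hermitian form `H_{[ψ]}(v, w) = 2 ⟨v, w⟩` on `T_{[ψ]} P(V) = {v | ⟨ψ, v⟩ = 0}`. -/
def fubiniStudyH (p : ℙ ℂ V) (v w : (projCharts (V := V)).Tan p) : ℂ := 2 * ip (v : V) (w : V)

/-- The 2-form `Ω_{[ψ]}(v, w) = 2 Im ⟨v, w⟩` on `T_{[ψ]} P(V) = {v | ⟨ψ, v⟩ = 0}`. -/
def fubiniStudyΩ (p : ℙ ℂ V) (v w : (projCharts (V := V)).Tan p) : ℝ := 2 * (ip (v : V) (w : V)).im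

/-- The 1-form `α_ψ(v) = -i ⟨ψ, v⟩` on `T_ψ S(V) = {v | Re ⟨ψ, v⟩ = 0}`; this number is real, see
`ofReal_sphereα`. -/
def sphereα (ψ : UnitSphere V) (v : (sphereCharts (V := V)).Tan ψ) : ℝ :=
  (-Complex.I * ip (ψ : V) (v : V)).re

theorem ofReal_sphereα (ψ : UnitSphere V) (v : (sphereCharts (V := V)).Tan ψ) :
    (sphereα ψ v : ℂ) = -Complex.I * ip (ψ : V) (v : V) := by
  have h : (ip (ψ : V) (v : V)).re = 0 := v.2
  apply Complex.ext <;> simp [sphereα, h]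

variable (V) in
/-- The fibres of the tautological bundle `L(V)`: the fibre over the line `p` is `p`. -/
abbrev TautFib : ℙ ℂ V → Type _ := fun p => p.submodule

/-- The frames `[χ] ↦ ⟨ψ, χ⟩⁻¹ χ` (that is, `[ψ + v] ↦ ψ + v`) of the tautological bundle on
`{[χ] | ⟨ψ, χ⟩ ≠ 0}`. They define the charts with inverse `(v, z) ↦ z (ψ + v)`. -/
def tautFrames : LineFrames (UnitSphere V) (TautFib V) where
  frame ψ p := ⟨(ip (ψ : V) p.rep)⁻¹ • p.rep, by
    rw [p.submodule_eq]
    exact Submodule.smul_mem _ _ (Submodule.mem_span_singleton_self _)⟩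
  coord ψ _ l := ip (ψ : V) (l : V)

/-- The unit vector `ψ` as an element of the fibre of the tautological bundle over `[ψ]`. -/
def tautVec (ψ : UnitSphere V) : TautFib V (sphereProj ψ) :=
  ⟨(ψ : V), by
    rw [sphereProj, Projectivization.submodule_mk]
    exact Submodule.mem_span_singleton_self _⟩

/-- The Hermitian metric on the tautological bundle. -/
def tautMetric (p : ℙ ℂ V) (l m : TautFib V p) : ℂ := ip (l : V) (m : V)

/-- The connection on the tautological bundle: if the section `s` corresponds to the function
`f(χ) = ⟨χ, s([χ])⟩` on `S(V)`, i.e. `s([χ]) = f(χ) χ`, then `(∇_X s)([ψ]) = df_ψ(X) ψ`, where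
`ψ` is a unit vector and `X ∈ T_{[ψ]} P(V) = {X | ⟨ψ, X⟩ = 0} ⊆ T_ψ S(V)` is its own
horizontal lift. -/
def tautConnection [TopologicalSpace V] (p : ℙ ℂ V) (X : (projCharts (V := V)).Tan p)
    (s : ∀ q, TautFib V q) : TautFib V p :=
  ⟨(sphereCharts (V := V)).dFun (fun χ => ip (χ : V) (s (sphereProj χ) : V))
      (unitVec p.rep p.rep_nonzero) (hyperplaneIncl _ X) • (unitVec p.rep p.rep_nonzero : V), by
    rw [p.submodule_eq]
    exact Submodule.smul_mem _ _
      (Submodule.smul_mem _ _ (Submodule.mem_span_singleton_self _))⟩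

variable [TopologicalSpace V]

/-- The quotient topology on `P(V)`. -/
instance : TopologicalSpace (ℙ ℂ V) :=
  TopologicalSpace.coinduced (Projectivization.mk' ℂ) inferInstance

/-- The topology of `L(V)` as a subspace of `P(V) × V`. -/
instance : TopologicalSpace (Bundle.TotalSpace ℂ (TautFib V)) :=
  TopologicalSpace.induced (fun l => (l.proj, (l.snd : V))) inferInstance

end ProjectiveSpace

end

/-!
All objects are pulled back to the cone `V \ {0}`, where they are explicit. In the chart at `[ψ]`
a point `v ∈ {v | ⟨ψ, v⟩ = 0}` stands for the point `w = ψ + v` of an affine slice, and the chart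
`κ_φ` becomes `w ↦ ⟨φ, w⟩⁻¹ w - φ`; the form `H` becomes
`2 (⟨u, v⟩ ⟨w, w⟩ - ⟨u, w⟩ ⟨w, v⟩) / ⟨w, w⟩²`, which is invariant under rescaling of `(w, u, v)` and
therefore independent of all choices. The connection on `L(V)` is the orthogonal projection of the
flat derivative of `V`-valued functions onto the lines, so that its connection form in the frame
`w` is `θ = ⟨w, dw⟩ / ⟨w, w⟩`. Its imaginary part is the pullback of `α`, and `dθ = i Ω` by direct
computation. For the closedness of `Ω`, the cyclic sum of the derivatives of the pulled back `H` is
seen to be real.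

That the transition maps, tangent maps and forms transform as they should rests on the chain rule,
which for Michal–Bastiani maps needs the mean value theorem, hence a locally convex range.
-/

universe u'

noncomputable section

/-! ### Directional derivatives -/

section DirDeriv

variable {𝕜 : Type*} [NontriviallyNormedField 𝕜]
  {E : Type*} [AddCommGroup E] [Module 𝕜 E]
  {F : Type*} [AddCommGroup F] [Module 𝕜 F] [TopologicalSpace F]
  {G : Type*} [AddCommGroup G] [Module 𝕜 G] [TopologicalSpace G]

theorem HasDirDeriv.dirDeriv_eq [T2Space F] {f : E → F} {x v : E} {w : F}
    (h : HasDirDeriv 𝕜 f x v w) : dirDeriv 𝕜 f x v = w :=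
  h.limUnder_eq

theorem HasDirDeriv.congr_line {E' : Type*} [AddCommGroup E'] [Module 𝕜 E'] {f : E → F} {x v : E}
    {g : E' → F} {y u : E'} {w : F} (h : HasDirDeriv 𝕜 f x v w) (hx : f x = g y)
    (hfg : ∀ᶠ t in 𝓝[≠] (0 : 𝕜), f (x + t • v) = g (y + t • u)) :
    HasDirDeriv 𝕜 g y u w :=
  Tendsto.congr' (hfg.mono fun t ht => by rw [hx, ht]) h

theorem eventually_add_smul_mem [TopologicalSpace E] [ContinuousAdd E] [ContinuousSMul 𝕜 E]
    {U : Set E} (hU : IsOpen U) {x : E} (hx : x ∈ U) (v : E) :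
    ∀ᶠ t in 𝓝 (0 : 𝕜), x + t • v ∈ U :=
  (hU.preimage (by fun_prop : Continuous fun t : 𝕜 => x + t • v)).mem_nhds (by simpa using hx)

theorem HasDirDeriv.congr_of_eqOn [TopologicalSpace E] [ContinuousAdd E] [ContinuousSMul 𝕜 E]
    {f g : E → F} {U : Set E} (hU : IsOpen U) {x v : E} {w : F} (h : HasDirDeriv 𝕜 f x v w)
    (hx : x ∈ U) (hfg : EqOn f g U) : HasDirDeriv 𝕜 g x v w :=
  h.congr_line (hfg hx)
    (eventually_nhdsWithin_of_eventually_nhds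
      ((eventually_add_smul_mem hU hx v).mono fun _ ht => hfg ht))

theorem hasDirDeriv_const (x v : E) (a : F) : HasDirDeriv 𝕜 (fun _ : E => a) x v 0 := by
  simpa [HasDirDeriv] using tendsto_const_nhds

theorem hasDirDeriv_clm [TopologicalSpace E] (L : E →L[𝕜] F) (x v : E) :
    HasDirDeriv 𝕜 L x v (L v) := by
  refine tendsto_const_nhds.congr' ?_
  filter_upwards [self_mem_nhdsWithin] with t ht
  rw [map_add, map_smul, add_sub_cancel_left, inv_smul_smul₀ ht]

theorem HasDirDeriv.clm_comp {f : E → F} {x v : E} {w : F} (h : HasDirDeriv 𝕜 f x v w)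
    (L : F →L[𝕜] G) : HasDirDeriv 𝕜 (fun y => L (f y)) x v (L w) :=
  ((L.continuous.tendsto w).comp h).congr fun t => by
    rw [Function.comp_apply, map_smul, map_sub]

theorem HasDirDeriv.prodMk {f : E → F} {g : E → G} {x v : E} {w : F} {w' : G}
    (hf : HasDirDeriv 𝕜 f x v w) (hg : HasDirDeriv 𝕜 g x v w') :
    HasDirDeriv 𝕜 (fun y => (f y, g y)) x v (w, w') :=
  (Filter.Tendsto.prodMk_nhds hf hg).congr fun t => by simp

theorem HasDirDeriv.add [ContinuousAdd F] {f g : E → F} {x v : E} {w w' : F}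
    (hf : HasDirDeriv 𝕜 f x v w) (hg : HasDirDeriv 𝕜 g x v w') :
    HasDirDeriv 𝕜 (fun y => f y + g y) x v (w + w') :=
  (hf.prodMk hg).clm_comp (ContinuousLinearMap.fst 𝕜 F F + ContinuousLinearMap.snd 𝕜 F F)

theorem HasDirDeriv.sub [ContinuousSub F] {f g : E → F} {x v : E} {w w' : F}
    (hf : HasDirDeriv 𝕜 f x v w) (hg : HasDirDeriv 𝕜 g x v w') :
    HasDirDeriv 𝕜 (fun y => f y - g y) x v (w - w') :=
  Tendsto.congr (fun t => by rw [← smul_sub, sub_sub_sub_comm]) (Filter.Tendsto.sub hf hg)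

theorem HasDirDeriv.smul_dir [ContinuousSMul 𝕜 F] {f : E → F} {x v : E} {w : F}
    (h : HasDirDeriv 𝕜 f x v w) (a : 𝕜) : HasDirDeriv 𝕜 f x (a • v) (a • w) := by
  rcases eq_or_ne a 0 with rfl | ha
  · simpa [HasDirDeriv] using tendsto_const_nhds
  · have hmul : Tendsto (fun t : 𝕜 => t * a) (𝓝[≠] 0) (𝓝[≠] 0) :=
      tendsto_nhdsWithin_iff.2 ⟨((continuous_mul_const a).tendsto' 0 0 (zero_mul a)).mono_left
        nhdsWithin_le_nhds, eventually_mem_nhdsWithin.mono fun t ht => mul_ne_zero ht ha⟩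
    refine ((h.comp hmul).const_smul a).congr fun t => ?_
    rw [Function.comp_apply, smul_smul, smul_smul, mul_inv_rev, mul_inv_cancel_left₀ ha]

theorem HasDirDeriv.tendsto [ContinuousAdd F] [ContinuousSMul 𝕜 F] {f : E → F} {x v : E} {w : F}
    (h : HasDirDeriv 𝕜 f x v w) :
    Tendsto (fun t : 𝕜 => f (x + t • v)) (𝓝[≠] 0) (𝓝 (f x)) := by
  have hlim : Tendsto (fun t : 𝕜 => f x + t • t⁻¹ • (f (x + t • v) - f x)) (𝓝[≠] 0)
      (𝓝 (f x + (0 : 𝕜) • w)) :=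
    tendsto_const_nhds.add ((tendsto_id.mono_left nhdsWithin_le_nhds).smul h)
  rw [zero_smul, add_zero] at hlim
  refine hlim.congr' (eventually_mem_nhdsWithin.mono fun t ht => ?_)
  rw [smul_inv_smul₀ ht, add_sub_cancel]

theorem HasDirDeriv.bilin {H : Type*} [AddCommGroup H] [Module 𝕜 H] [TopologicalSpace H]
    [ContinuousAdd H] [ContinuousAdd G] [ContinuousSMul 𝕜 G] (B : F →ₗ[𝕜] G →ₗ[𝕜] H)
    (hB : Continuous fun p : F × G => B p.1 p.2) {f : E → F} {g : E → G} {x v : E} {w : F} {w' : G}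
    (hf : HasDirDeriv 𝕜 f x v w) (hg : HasDirDeriv 𝕜 g x v w') :
    HasDirDeriv 𝕜 (fun y => B (f y) (g y)) x v (B w (g x) + B (f x) w') := by
  have hleft := (hB.tendsto (w, g x)).comp (Filter.Tendsto.prodMk_nhds hf hg.tendsto)
  have hright := (hB.tendsto (f x, w')).comp
    (Filter.Tendsto.prodMk_nhds (tendsto_const_nhds (x := f x)) hg)
  refine (hleft.add hright).congr fun t => ?_
  simp only [Function.comp_apply, map_smul, map_sub, LinearMap.smul_apply, LinearMap.sub_apply,
    ← smul_add, sub_add_sub_cancel]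

theorem HasDirDeriv.smul {A : Type*} [Ring A] [Algebra 𝕜 A] [TopologicalSpace A] [Module A F]
    [IsScalarTower 𝕜 A F] [ContinuousAdd F] [ContinuousSMul 𝕜 F] [ContinuousSMul A F] {a : E → A}
    {f : E → F} {x v : E} {a' : A} {w : F} (ha : HasDirDeriv 𝕜 a x v a')
    (hf : HasDirDeriv 𝕜 f x v w) :
    HasDirDeriv 𝕜 (fun y => a y • f y) x v (a' • f x + a x • w) :=
  ha.bilin (Algebra.lsmul 𝕜 𝕜 F).toLinearMap continuous_smul hf

theorem HasDirDeriv.mul {A : Type*} [Ring A] [Algebra 𝕜 A] [TopologicalSpace A]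
    [IsTopologicalRing A] [ContinuousSMul 𝕜 A] {a b : E → A} {x v : E} {a' b' : A}
    (ha : HasDirDeriv 𝕜 a x v a') (hb : HasDirDeriv 𝕜 b x v b') :
    HasDirDeriv 𝕜 (fun y => a y * b y) x v (a' * b x + a x * b') :=
  ha.bilin (LinearMap.mul 𝕜 A) continuous_mul hb

theorem hasDirDeriv_iff_hasDerivAt {F : Type*} [NormedAddCommGroup F] [NormedSpace 𝕜 F] {f : E → F}
    {x v : E} {w : F} :
    HasDirDeriv 𝕜 f x v w ↔ HasDerivAt (fun t : 𝕜 => f (x + t • v)) w 0 := by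
  simp [HasDirDeriv, hasDerivAt_iff_tendsto_slope_zero]

theorem HasDirDeriv.comp_hasFDerivAt {F G : Type*} [NormedAddCommGroup F] [NormedSpace 𝕜 F]
    [NormedAddCommGroup G] [NormedSpace 𝕜 G] {φ : F → G} {φ' : F →L[𝕜] G} {f : E → F} {x v : E}
    {w : F} (hφ : HasFDerivAt φ φ' (f x)) (h : HasDirDeriv 𝕜 f x v w) :
    HasDirDeriv 𝕜 (fun y => φ (f y)) x v (φ' w) := by
  rw [hasDirDeriv_iff_hasDerivAt] at h ⊢
  exact HasFDerivAt.comp_hasDerivAt 0 (by simpa using hφ) h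

theorem HasDirDeriv.inv {A : Type*} [NontriviallyNormedField A] [NormedAlgebra 𝕜 A] {f : E → A}
    {x v : E} {a : A} (h : HasDirDeriv 𝕜 f x v a) (hx : f x ≠ 0) :
    HasDirDeriv 𝕜 (fun y => (f y)⁻¹) x v (-a / f x ^ 2) := by
  rw [hasDirDeriv_iff_hasDerivAt] at h ⊢
  simpa using h.fun_inv (by simpa using hx)

theorem HasDirDeriv.div {A : Type*} [NontriviallyNormedField A] [NormedAlgebra 𝕜 A] {f g : E → A}
    {x v : E} {a b : A} (hf : HasDirDeriv 𝕜 f x v a) (hg : HasDirDeriv 𝕜 g x v b) (hx : g x ≠ 0) :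
    HasDirDeriv 𝕜 (fun y => f y / g y) x v ((a * g x - f x * b) / g x ^ 2) := by
  rw [hasDirDeriv_iff_hasDerivAt] at hf hg ⊢
  simpa using hf.fun_div hg (by simpa using hx)

section AffineSlice

variable {D : Type*} [AddCommGroup D] [Module 𝕜 D]

theorem HasDirDeriv.comp_add_linearMap {f : E → F} (L : D →ₗ[𝕜] E) {a : E} {x v : D} {w : F}
    (h : HasDirDeriv 𝕜 f (a + L x) (L v) w) : HasDirDeriv 𝕜 (fun y => f (a + L y)) x v w :=
  h.congr_line rfl (Eventually.of_forall fun t => by rw [map_add, map_smul, add_assoc])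

theorem dirDeriv_comp_add_linearMap (f : E → F) (L : D →ₗ[𝕜] E) (a : E) (x v : D) :
    dirDeriv 𝕜 (fun y => f (a + L y)) x v = dirDeriv 𝕜 f (a + L x) (L v) := by
  simp only [dirDeriv, map_add, map_smul, add_assoc]

end AffineSlice

theorem extDeriv₁_comp_add_linearMap {D E F : Type*} [AddCommGroup D] [Module ℝ D]
    [AddCommGroup E] [Module ℝ E] [AddCommGroup F] [Module ℝ F] [TopologicalSpace F]
    (θ : E → E → F) (L : D →ₗ[ℝ] E) (a : E) (x u v : D) :
    extDeriv₁ (fun y w => θ (a + L y) (L w)) x u v = extDeriv₁ θ (a + L x) (L u) (L v) :=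
  congrArg₂ (· - ·) (dirDeriv_comp_add_linearMap (fun w => θ w (L v)) L a x u)
    (dirDeriv_comp_add_linearMap (fun w => θ w (L u)) L a x v)

theorem extDeriv₂_comp_add_linearMap {D E F : Type*} [AddCommGroup D] [Module ℝ D]
    [AddCommGroup E] [Module ℝ E] [AddCommGroup F] [Module ℝ F] [TopologicalSpace F]
    (ω : E → E → E → F) (L : D →ₗ[ℝ] E) (a : E) (x u v w : D) :
    extDeriv₂ (fun y v w => ω (a + L y) (L v) (L w)) x u v w =
      extDeriv₂ ω (a + L x) (L u) (L v) (L w) := by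
  simp only [extDeriv₂, ← dirDeriv_comp_add_linearMap]

end DirDeriv

/-! ### Maps of class `C^n` -/

section ContDiff

variable {𝕜 : Type*} [NontriviallyNormedField 𝕜]
  {E : Type u} [AddCommGroup E] [Module 𝕜 E] [TopologicalSpace E]
  {F : Type*} [AddCommGroup F] [Module 𝕜 F] [TopologicalSpace F]
  {G : Type*} [AddCommGroup G] [Module 𝕜 G] [TopologicalSpace G]
  {n : ℕ} {f : E → F} {U : Set E}

theorem MBContDiffOn.continuousOn (h : MBContDiffOn 𝕜 n f U) : ContinuousOn f U := by
  cases n with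
  | zero => exact h
  | succ n => exact h.1

theorem MBContDiffOn.of_succ (h : MBContDiffOn 𝕜 (n + 1) f U) : MBContDiffOn 𝕜 n f U := by
  induction n generalizing E with
  | zero => exact h.1
  | succ n ih =>
    obtain ⟨hc, df, hd, hs⟩ := h
    exact ⟨hc, df, hd, ih hs⟩

theorem MBContDiffOn.congr [ContinuousAdd E] [ContinuousSMul 𝕜 E] {g : E → F}
    (h : MBContDiffOn 𝕜 n f U) (hU : IsOpen U) (hfg : EqOn f g U) : MBContDiffOn 𝕜 n g U := by
  cases n with
  | zero => exact ContinuousOn.congr h hfg.symm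
  | succ n =>
    obtain ⟨hc, df, hd, hs⟩ := h
    exact ⟨hc.congr hfg.symm, df, fun x hx v => (hd x hx v).congr_of_eqOn hU hx hfg, hs⟩

theorem mbContDiffOn_const (n : ℕ) (a : F) (U : Set E) :
    MBContDiffOn 𝕜 n (fun _ : E => a) U := by
  induction n generalizing E a with
  | zero => exact continuousOn_const
  | succ n ih => exact ⟨continuousOn_const, _, fun x _ v => hasDirDeriv_const x v a, ih 0 _⟩

theorem mbContDiffOn_clm (n : ℕ) (L : E →L[𝕜] F) (U : Set E) : MBContDiffOn 𝕜 n L U := by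
  induction n generalizing E with
  | zero => exact L.continuous.continuousOn
  | succ n ih =>
    exact ⟨L.continuous.continuousOn, _, fun x _ v => hasDirDeriv_clm L x v,
      ih (L.comp (ContinuousLinearMap.snd 𝕜 E E)) _⟩

theorem MBContDiffOn.comp_clm {E' : Type u} [AddCommGroup E'] [Module 𝕜 E'] [TopologicalSpace E']
    (h : MBContDiffOn 𝕜 n f U) (L : E' →L[𝕜] E) {U' : Set E'} (hL : MapsTo L U' U) :
    MBContDiffOn 𝕜 n (fun x => f (L x)) U' := by
  induction n generalizing E E' with
  | zero => exact ContinuousOn.comp h L.continuous.continuousOn hL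
  | succ n ih =>
    obtain ⟨hc, df, hd, hs⟩ := h
    refine ⟨hc.comp L.continuous.continuousOn hL, fun p => df (L p.1, L p.2), fun x hx v => ?_,
      ih hs (L.prodMap L) fun p hp => ⟨hL hp.1, mem_univ _⟩⟩
    exact (hd (L x) (hL hx) (L v)).congr_line rfl (.of_forall fun t => by rw [map_add, map_smul])

theorem MBContDiffOn.comp_fst (h : MBContDiffOn 𝕜 n f U) :
    MBContDiffOn 𝕜 n (fun p : E × E => f p.1) (U ×ˢ univ) :=
  h.comp_clm (ContinuousLinearMap.fst 𝕜 E E) fun _ hp => hp.1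

theorem MBContDiffOn.clm_comp (h : MBContDiffOn 𝕜 n f U) (L : F →L[𝕜] G) :
    MBContDiffOn 𝕜 n (fun x => L (f x)) U := by
  induction n generalizing E with
  | zero => exact L.continuous.comp_continuousOn h
  | succ n ih =>
    obtain ⟨hc, df, hd, hs⟩ := h
    exact ⟨L.continuous.comp_continuousOn hc, _, fun x hx v => (hd x hx v).clm_comp L, ih hs⟩

theorem MBContDiffOn.prodMk {g : E → G} (hf : MBContDiffOn 𝕜 n f U) (hg : MBContDiffOn 𝕜 n g U) :
    MBContDiffOn 𝕜 n (fun x => (f x, g x)) U := by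
  induction n generalizing E with
  | zero => exact ContinuousOn.prodMk hf hg
  | succ n ih =>
    obtain ⟨hc, df, hd, hs⟩ := hf
    obtain ⟨hc', dg, hd', hs'⟩ := hg
    exact ⟨hc.prodMk hc', _, fun x hx v => (hd x hx v).prodMk (hd' x hx v), ih hs hs'⟩

theorem MBContDiffOn.add [ContinuousAdd F] {g : E → F} (hf : MBContDiffOn 𝕜 n f U)
    (hg : MBContDiffOn 𝕜 n g U) : MBContDiffOn 𝕜 n (fun x => f x + g x) U :=
  (hf.prodMk hg).clm_comp (ContinuousLinearMap.fst 𝕜 F F + ContinuousLinearMap.snd 𝕜 F F)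

theorem MBContDiffOn.bilin {H : Type*} [AddCommGroup H] [Module 𝕜 H] [TopologicalSpace H]
    [ContinuousAdd H] [ContinuousAdd G] [ContinuousSMul 𝕜 G] (B : F →ₗ[𝕜] G →ₗ[𝕜] H)
    (hB : Continuous fun p : F × G => B p.1 p.2) {g : E → G}
    (hf : MBContDiffOn 𝕜 n f U) (hg : MBContDiffOn 𝕜 n g U) :
    MBContDiffOn 𝕜 n (fun x => B (f x) (g x)) U := by
  induction n generalizing E with
  | zero => exact hB.comp_continuousOn (ContinuousOn.prodMk hf hg)
  | succ n ih =>
    have hf₁ := hf.of_succ.comp_fst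
    have hg₁ := hg.of_succ.comp_fst
    obtain ⟨hc, df, hd, hs⟩ := hf
    obtain ⟨hc', dg, hd', hs'⟩ := hg
    exact ⟨hB.comp_continuousOn (hc.prodMk hc'), fun p => B (df p) (g p.1) + B (f p.1) (dg p),
      fun x hx v => (hd x hx v).bilin B hB (hd' x hx v), (ih hs hg₁).add (ih hf₁ hs')⟩

theorem mbContDiffOn_of_contDiffOn {E : Type u} {F : Type*} [NormedAddCommGroup E]
    [NormedSpace 𝕜 E] [NormedAddCommGroup F] [NormedSpace 𝕜 F] {n : ℕ} {f : E → F} {U : Set E}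
    (h : ContDiffOn 𝕜 n f U) (hU : IsOpen U) : MBContDiffOn 𝕜 n f U := by
  induction n generalizing E with
  | zero => exact h.continuousOn
  | succ n ih =>
    obtain ⟨hdiff, -, hfderiv⟩ := (contDiffOn_succ_iff_fderiv_of_isOpen (n := n) hU).1
      (by exact_mod_cast h)
    refine ⟨h.continuousOn, fun p => fderiv 𝕜 f p.1 p.2, fun x hx v => ?_,
      ih ?_ (hU.prod isOpen_univ)⟩
    · exact (hasDirDeriv_clm (ContinuousLinearMap.id 𝕜 E) x v).comp_hasFDerivAt
        (hdiff.differentiableAt (hU.mem_nhds hx)).hasFDerivAt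
    · exact (hfderiv.comp contDiffOn_fst fun p hp => hp.1).clm_apply contDiffOn_snd

end ContDiff

/-! ### The chain rule in locally convex spaces -/

section Slope

theorem tendsto_ofReal_nhdsNE_zero {𝕜 : Type*} [RCLike 𝕜] :
    Tendsto (fun t : ℝ => (t : 𝕜)) (𝓝[≠] 0) (𝓝[≠] 0) :=
  tendsto_nhdsWithin_iff.2
    ⟨(RCLike.continuous_ofReal.tendsto' 0 0 RCLike.ofReal_zero).mono_left nhdsWithin_le_nhds,
      eventually_mem_nhdsWithin.mono fun _ ht => RCLike.ofReal_ne_zero.2 ht⟩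

section RestrictScalars

variable {𝕜 : Type*} [RCLike 𝕜]
  {F : Type*} [AddCommGroup F] [Module 𝕜 F] [Module ℝ F] [IsScalarTower ℝ 𝕜 F] [TopologicalSpace F]

theorem HasDirDeriv.restrictScalars {E : Type*} [AddCommGroup E] [Module 𝕜 E] [Module ℝ E]
    [IsScalarTower ℝ 𝕜 E] {f : E → F} {x v : E} {w : F}
    (h : HasDirDeriv 𝕜 f x v w) : HasDirDeriv ℝ f x v w := by
  refine (Tendsto.comp h tendsto_ofReal_nhdsNE_zero).congr fun t => ?_
  simp only [Function.comp_apply, ← RCLike.algebraMap_eq_ofReal, algebraMap_smul, ← map_inv₀]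

theorem MBContDiffOn.restrictScalars {E : Type u} [AddCommGroup E] [Module 𝕜 E] [Module ℝ E]
    [IsScalarTower ℝ 𝕜 E] [TopologicalSpace E] {n : ℕ} {f : E → F} {U : Set E}
    (h : MBContDiffOn 𝕜 n f U) : MBContDiffOn ℝ n f U := by
  induction n generalizing E with
  | zero => exact h
  | succ n ih =>
    obtain ⟨hc, df, hd, hs⟩ := h
    exact ⟨hc, df, fun x hx v => (hd x hx v).restrictScalars, ih hs⟩

end RestrictScalars

section MeanValue

variable {F : Type*} [AddCommGroup F] [Module ℝ F] [TopologicalSpace F] [IsTopologicalAddGroup F]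
  [ContinuousSMul ℝ F] [LocallyConvexSpace ℝ F]

theorem sub_mem_of_hasDirDeriv_mem {c c' : ℝ → F} {C : Set F} (hconv : Convex ℝ C)
    (hclosed : IsClosed C) (hc : ∀ s ∈ Icc (0 : ℝ) 1, HasDirDeriv ℝ c s 1 (c' s))
    (hC : ∀ s ∈ Icc (0 : ℝ) 1, c' s ∈ C) : c 1 - c 0 ∈ C := by
  by_contra hnot
  obtain ⟨ℓ, r, hℓC, hℓ⟩ := geometric_hahn_banach_closed_point hconv hclosed hnot
  have hder : ∀ s ∈ Icc (0 : ℝ) 1, HasDerivAt (fun s => ℓ (c s)) (ℓ (c' s)) s := fun s hs => by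
    have h := hasDirDeriv_iff_hasDerivAt.1 ((hc s hs).clm_comp ℓ)
    rw [← sub_self s] at h
    simpa using h.comp_sub_const s s
  obtain ⟨s, hs, hslope⟩ := exists_hasDerivAt_eq_slope (fun s => ℓ (c s)) (fun s => ℓ (c' s))
    zero_lt_one (fun s hs => (hder s hs).continuousAt.continuousWithinAt)
    fun s hs => hder s (Ioo_subset_Icc_self hs)
  rw [sub_zero, div_one, ← map_sub] at hslope
  exact lt_asymm hℓ (hslope ▸ hℓC _ (hC s (Ioo_subset_Icc_self hs)))

end MeanValue

variable {𝕜 : Type*} [RCLike 𝕜]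
  {E : Type*} [AddCommGroup E] [Module 𝕜 E]
  {F : Type*} [AddCommGroup F] [Module 𝕜 F] [Module ℝ F] [IsScalarTower ℝ 𝕜 F] [TopologicalSpace F]

theorem HasDirDeriv.comp_segment {f : E → F} {y u : E} {t : 𝕜} {s : ℝ}
    {w : F} (ht : t ≠ 0) (h : HasDirDeriv 𝕜 f (y + ((s : 𝕜) * t) • u) u w) :
    HasDirDeriv ℝ (fun s : ℝ => t⁻¹ • f (y + ((s : 𝕜) * t) • u)) s 1 w := by
  have hmul : Tendsto (fun r : ℝ => (r : 𝕜) * t) (𝓝[≠] 0) (𝓝[≠] 0) :=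
    tendsto_nhdsWithin_iff.2 ⟨((continuous_mul_const t).tendsto' 0 0 (zero_mul t)).comp
      (tendsto_ofReal_nhdsNE_zero.mono_right nhdsWithin_le_nhds),
      eventually_mem_nhdsWithin.mono fun r hr => mul_ne_zero (RCLike.ofReal_ne_zero.2 hr) ht⟩
  refine (Tendsto.comp h hmul).congr fun r => ?_
  rw [Function.comp_apply, ← smul_sub, ← algebraMap_smul 𝕜 r⁻¹, smul_smul, map_inv₀,
    RCLike.algebraMap_eq_ofReal, mul_inv, smul_eq_mul, mul_one, RCLike.ofReal_add, add_mul,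
    add_smul, add_assoc]

variable [TopologicalSpace E] [ContinuousAdd E] [ContinuousSMul 𝕜 E]
  [IsTopologicalAddGroup F] [ContinuousSMul 𝕜 F] [LocallyConvexSpace ℝ F]

/-- By the mean value theorem, a difference quotient lies in every closed convex set containing the
derivatives along the segment. -/
theorem tendsto_slope_of_continuousAt {f : E → F} {df : E × E → F} {x v : E}
    (hd : ∀ᶠ y in 𝓝 x, ∀ u, HasDirDeriv 𝕜 f y u (df (y, u))) (hdf : ContinuousAt df (x, v))
    {α : Type*} {l : Filter α} {y u : α → E} {t : α → 𝕜} (hy : Tendsto y l (𝓝 x))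
    (hu : Tendsto u l (𝓝 v)) (ht : Tendsto t l (𝓝[≠] 0)) :
    Tendsto (fun a => (t a)⁻¹ • (f (y a + t a • u a) - f (y a))) l (𝓝 (df (x, v))) := by
  have : ContinuousSMul ℝ F := IsScalarTower.continuousSMul 𝕜
  obtain ⟨ht0, ht_ne⟩ := tendsto_nhdsWithin_iff.1 ht
  refine (closed_nhds_basis (df (x, v))).tendsto_right_iff.2 fun K hK => ?_
  obtain ⟨C₀, ⟨hC₀, hconv⟩, hC₀K⟩ :=
    (LocallyConvexSpace.convex_basis (𝕜 := ℝ) (df (x, v))).mem_iff.1 hK.1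
  have hseg : ∀ᶠ q : E × E × 𝕜 in 𝓝 (x, v, 0), ∀ s ∈ Icc (0 : ℝ) 1,
      HasDirDeriv 𝕜 f (q.1 + ((s : 𝕜) * q.2.2) • q.2.1) q.2.1
        (df (q.1 + ((s : 𝕜) * q.2.2) • q.2.1, q.2.1)) ∧
      df (q.1 + ((s : 𝕜) * q.2.2) • q.2.1, q.2.1) ∈ closure C₀ := by
    refine isCompact_Icc.eventually_forall_of_forall_eventually fun s _ => ?_
    have hpt : Tendsto (fun z : (E × E × 𝕜) × ℝ => z.1.1 + ((z.2 : 𝕜) * z.1.2.2) • z.1.2.1)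
        (𝓝 ((x, v, 0), s)) (𝓝 x) :=
      Continuous.tendsto' (by fun_prop) _ _ (by simp)
    have hdir : Tendsto (fun z : (E × E × 𝕜) × ℝ => z.1.2.1) (𝓝 ((x, v, 0), s)) (𝓝 v) :=
      Continuous.tendsto' (by fun_prop) _ _ rfl
    exact ((hpt.eventually hd).mono fun z hz => hz _).and
      ((hdf.tendsto.comp (hpt.prodMk_nhds hdir)).eventually
        (mem_of_superset hC₀ subset_closure))
  filter_upwards [(hy.prodMk_nhds (hu.prodMk_nhds ht0)).eventually hseg, ht_ne] with a ha hta
  have hmem := sub_mem_of_hasDirDeriv_mem hconv.closure isClosed_closure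
    (fun s hs => (ha s hs).1.comp_segment hta) fun s hs => (ha s hs).2
  refine hK.2.closure_subset_iff.2 hC₀K ?_
  simpa [smul_sub] using hmem

theorem HasDirDeriv.comp {E₀ : Type*} [AddCommGroup E₀] [Module 𝕜 E₀] {g : E → F} {dg : E × E → F}
    {f : E₀ → E} {x v : E₀} {w : E} (hd : ∀ᶠ y in 𝓝 (f x), ∀ u, HasDirDeriv 𝕜 g y u (dg (y, u)))
    (hdg : ContinuousAt dg (f x, w)) (hf : HasDirDeriv 𝕜 f x v w) :
    HasDirDeriv 𝕜 (fun y => g (f y)) x v (dg (f x, w)) := by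
  refine (tendsto_slope_of_continuousAt hd hdg (y := fun _ => f x) tendsto_const_nhds hf
    tendsto_id).congr' (eventually_mem_nhdsWithin.mono fun t ht => ?_)
  rw [id, smul_inv_smul₀ ht, add_sub_cancel]

theorem HasDirDeriv.add_dir {f : E → F} {df : E × E → F} {x v v' : E} {w : F}
    (hd : ∀ᶠ y in 𝓝 x, ∀ u, HasDirDeriv 𝕜 f y u (df (y, u))) (hdf : ContinuousAt df (x, v'))
    (hw : HasDirDeriv 𝕜 f x v w) :
    HasDirDeriv 𝕜 f x (v + v') (w + df (x, v')) := by
  have hline : Tendsto (fun t : 𝕜 => x + t • v) (𝓝[≠] 0) (𝓝 x) :=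
    (Continuous.tendsto' (by fun_prop) _ _ (by simp)).mono_left nhdsWithin_le_nhds
  refine (Tendsto.add hw (tendsto_slope_of_continuousAt hd hdf hline tendsto_const_nhds
    tendsto_id)).congr fun t => ?_
  rw [id, ← smul_add, smul_add t v, ← add_assoc, sub_add_sub_cancel']

end Slope

section ChainRule

variable {𝕜 : Type*} [RCLike 𝕜]
  {D : Type u} [AddCommGroup D] [Module 𝕜 D] [TopologicalSpace D]
  {E : Type u'} [AddCommGroup E] [Module 𝕜 E] [TopologicalSpace E] [ContinuousAdd E]
  [ContinuousSMul 𝕜 E]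
  {F : Type*} [AddCommGroup F] [Module 𝕜 F] [Module ℝ F] [IsScalarTower ℝ 𝕜 F] [TopologicalSpace F]
  [IsTopologicalAddGroup F] [ContinuousSMul 𝕜 F] [LocallyConvexSpace ℝ F]

theorem MBContDiffOn.comp {n : ℕ} {g : E → F} {f : D → E} {U : Set D} {O : Set E}
    (hg : MBContDiffOn 𝕜 n g O) (hO : IsOpen O) (hf : MBContDiffOn 𝕜 n f U) (hm : MapsTo f U O) :
    MBContDiffOn 𝕜 n (fun x => g (f x)) U := by
  induction n generalizing D E with
  | zero => exact ContinuousOn.comp hg hf hm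
  | succ n ih =>
    have hf₁ := hf.of_succ.comp_fst
    obtain ⟨hfc, df, hfd, hdf⟩ := hf
    obtain ⟨hgc, dg, hgd, hdg⟩ := hg
    refine ⟨hgc.comp hfc hm, fun p => dg (f p.1, df p), fun x hx v => ?_,
      ih hdg (hO.prod isOpen_univ) (hf₁.prodMk hdf) fun p hp => ⟨hm hp.1, mem_univ _⟩⟩
    have hO_nhds : O ×ˢ univ ∈ 𝓝 (f x, df (x, v)) :=
      (hO.prod isOpen_univ).mem_nhds ⟨hm hx, mem_univ _⟩
    exact HasDirDeriv.comp (mem_of_superset (hO.mem_nhds (hm hx)) hgd)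
      (hdg.continuousOn.continuousAt hO_nhds) (hfd x hx v)

end ChainRule

/-! ### Smooth maps -/

section Smooth

variable {𝕜 : Type*} [NontriviallyNormedField 𝕜]
  {E : Type u} [AddCommGroup E] [Module 𝕜 E] [TopologicalSpace E]
  {F : Type*} [AddCommGroup F] [Module 𝕜 F] [TopologicalSpace F]
  {G : Type*} [AddCommGroup G] [Module 𝕜 G] [TopologicalSpace G]
  {f : E → F} {U : Set E}

theorem MBSmoothOn.continuousOn (h : MBSmoothOn 𝕜 f U) : ContinuousOn f U :=
  (h 0).continuousOn

theorem MBSmoothOn.congr [ContinuousAdd E] [ContinuousSMul 𝕜 E] {g : E → F}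
    (h : MBSmoothOn 𝕜 f U) (hU : IsOpen U) (hfg : EqOn f g U) : MBSmoothOn 𝕜 g U :=
  fun n => (h n).congr hU hfg

theorem mbSmoothOn_const (a : F) (U : Set E) : MBSmoothOn 𝕜 (fun _ : E => a) U :=
  fun n => mbContDiffOn_const n a U

theorem mbSmoothOn_clm (L : E →L[𝕜] F) (U : Set E) : MBSmoothOn 𝕜 L U :=
  fun n => mbContDiffOn_clm n L U

theorem MBSmoothOn.comp_clm {E' : Type u} [AddCommGroup E'] [Module 𝕜 E'] [TopologicalSpace E']
    (h : MBSmoothOn 𝕜 f U) (L : E' →L[𝕜] E) {U' : Set E'} (hL : MapsTo L U' U) :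
    MBSmoothOn 𝕜 (fun x => f (L x)) U' :=
  fun n => (h n).comp_clm L hL

theorem MBSmoothOn.clm_comp (h : MBSmoothOn 𝕜 f U) (L : F →L[𝕜] G) :
    MBSmoothOn 𝕜 (fun x => L (f x)) U :=
  fun n => (h n).clm_comp L

theorem MBSmoothOn.prodMk {g : E → G} (hf : MBSmoothOn 𝕜 f U) (hg : MBSmoothOn 𝕜 g U) :
    MBSmoothOn 𝕜 (fun x => (f x, g x)) U :=
  fun n => (hf n).prodMk (hg n)

theorem MBSmoothOn.add [ContinuousAdd F] {g : E → F} (hf : MBSmoothOn 𝕜 f U)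
    (hg : MBSmoothOn 𝕜 g U) : MBSmoothOn 𝕜 (fun x => f x + g x) U :=
  fun n => (hf n).add (hg n)

theorem MBSmoothOn.sub [IsTopologicalAddGroup F] {g : E → F} (hf : MBSmoothOn 𝕜 f U)
    (hg : MBSmoothOn 𝕜 g U) : MBSmoothOn 𝕜 (fun x => f x - g x) U :=
  (hf.prodMk hg).clm_comp (ContinuousLinearMap.fst 𝕜 F F - ContinuousLinearMap.snd 𝕜 F F)

theorem MBSmoothOn.bilin {H : Type*} [AddCommGroup H] [Module 𝕜 H] [TopologicalSpace H]
    [ContinuousAdd H] [ContinuousAdd G] [ContinuousSMul 𝕜 G] (B : F →ₗ[𝕜] G →ₗ[𝕜] H)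
    (hB : Continuous fun p : F × G => B p.1 p.2) {g : E → G} (hf : MBSmoothOn 𝕜 f U)
    (hg : MBSmoothOn 𝕜 g U) : MBSmoothOn 𝕜 (fun x => B (f x) (g x)) U :=
  fun n => (hf n).bilin B hB (hg n)

theorem MBSmoothOn.smul {A : Type*} [Ring A] [Algebra 𝕜 A] [TopologicalSpace A] [Module A F]
    [IsScalarTower 𝕜 A F] [ContinuousAdd F] [ContinuousSMul 𝕜 F] [ContinuousSMul A F] {a : E → A}
    (ha : MBSmoothOn 𝕜 a U) (hf : MBSmoothOn 𝕜 f U) : MBSmoothOn 𝕜 (fun x => a x • f x) U :=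
  ha.bilin (Algebra.lsmul 𝕜 𝕜 F).toLinearMap continuous_smul hf

theorem MBSmoothOn.mul {A : Type*} [Ring A] [Algebra 𝕜 A] [TopologicalSpace A]
    [IsTopologicalRing A] [ContinuousSMul 𝕜 A] {a b : E → A} (ha : MBSmoothOn 𝕜 a U)
    (hb : MBSmoothOn 𝕜 b U) : MBSmoothOn 𝕜 (fun x => a x * b x) U :=
  ha.bilin (LinearMap.mul 𝕜 A) continuous_mul hb

theorem mbSmoothOn_of_contDiffOn {E : Type u} {F : Type*} [NormedAddCommGroup E]
    [NormedSpace 𝕜 E] [NormedAddCommGroup F] [NormedSpace 𝕜 F] {f : E → F} {U : Set E}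
    (h : ContDiffOn 𝕜 (⊤ : ℕ∞) f U) (hU : IsOpen U) : MBSmoothOn 𝕜 f U :=
  fun _ => mbContDiffOn_of_contDiffOn (h.of_le (mod_cast le_top)) hU

section DirDeriv

variable [T2Space F]

theorem MBSmoothOn.hasDirDeriv (h : MBSmoothOn 𝕜 f U) {x : E} (hx : x ∈ U) (v : E) :
    HasDirDeriv 𝕜 f x v (dirDeriv 𝕜 f x v) := by
  obtain ⟨-, df, hd, -⟩ := h 1
  rw [(hd x hx v).dirDeriv_eq]
  exact hd x hx v

theorem MBSmoothOn.dirDeriv_prod [ContinuousAdd E] [ContinuousSMul 𝕜 E] (h : MBSmoothOn 𝕜 f U)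
    (hU : IsOpen U) : MBSmoothOn 𝕜 (fun p : E × E => dirDeriv 𝕜 f p.1 p.2) (U ×ˢ univ) := by
  intro n
  obtain ⟨-, df, hd, hs⟩ := h (n + 1)
  exact hs.congr (hU.prod isOpen_univ) fun p hp => (hd p.1 hp.1 p.2).dirDeriv_eq.symm

end DirDeriv

theorem MBSmoothOn.restrictScalars {𝕜 : Type*} [RCLike 𝕜] {E : Type u} [AddCommGroup E]
    [Module 𝕜 E] [Module ℝ E] [IsScalarTower ℝ 𝕜 E] [TopologicalSpace E] {F : Type*}
    [AddCommGroup F] [Module 𝕜 F] [Module ℝ F] [IsScalarTower ℝ 𝕜 F] [TopologicalSpace F]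
    {f : E → F} {U : Set E} (h : MBSmoothOn 𝕜 f U) : MBSmoothOn ℝ f U :=
  fun n => (h n).restrictScalars

end Smooth

section SmoothChainRule

variable {𝕜 : Type*} [RCLike 𝕜]
  {D : Type u} [AddCommGroup D] [Module 𝕜 D] [TopologicalSpace D]
  {E : Type u'} [AddCommGroup E] [Module 𝕜 E] [TopologicalSpace E] [ContinuousAdd E]
  [ContinuousSMul 𝕜 E]
  {F : Type*} [AddCommGroup F] [Module 𝕜 F] [Module ℝ F] [IsScalarTower ℝ 𝕜 F] [TopologicalSpace F]
  [IsTopologicalAddGroup F] [ContinuousSMul 𝕜 F] [LocallyConvexSpace ℝ F]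

theorem MBSmoothOn.comp {g : E → F} {f : D → E} {U : Set D} {O : Set E}
    (hg : MBSmoothOn 𝕜 g O) (hO : IsOpen O) (hf : MBSmoothOn 𝕜 f U) (hm : MapsTo f U O) :
    MBSmoothOn 𝕜 (fun x => g (f x)) U :=
  fun n => (hg n).comp hO (hf n) hm

theorem MBSmoothOn.inv {A : Type*} [NormedField A] [NormedAlgebra 𝕜 A] [NormedSpace ℝ A]
    [IsScalarTower ℝ 𝕜 A] {a : D → A} {U : Set D} (ha : MBSmoothOn 𝕜 a U)
    (h0 : ∀ x ∈ U, a x ≠ 0) : MBSmoothOn 𝕜 (fun x => (a x)⁻¹) U :=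
  MBSmoothOn.comp (mbSmoothOn_of_contDiffOn
    (fun _ hx => (contDiffAt_inv 𝕜 hx).contDiffWithinAt) isOpen_compl_singleton)
    isOpen_compl_singleton ha h0

theorem MBSmoothOn.div {A : Type*} [NormedField A] [NormedAlgebra 𝕜 A] [NormedSpace ℝ A]
    [IsScalarTower ℝ 𝕜 A] {a b : D → A} {U : Set D} (ha : MBSmoothOn 𝕜 a U)
    (hb : MBSmoothOn 𝕜 b U) (h0 : ∀ x ∈ U, b x ≠ 0) : MBSmoothOn 𝕜 (fun x => a x / b x) U := by
  simpa only [div_eq_mul_inv] using ha.mul (hb.inv h0)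

variable [T2Space F]

theorem MBSmoothOn.hasDirDeriv_comp {g : E → F} {O : Set E} (hg : MBSmoothOn 𝕜 g O) (hO : IsOpen O)
    {D : Type*} [AddCommGroup D] [Module 𝕜 D] {f : D → E} {x v : D} {w : E} (hx : f x ∈ O)
    (hf : HasDirDeriv 𝕜 f x v w) :
    HasDirDeriv 𝕜 (fun y => g (f y)) x v (dirDeriv 𝕜 g (f x) w) :=
  HasDirDeriv.comp (dg := fun p => dirDeriv 𝕜 g p.1 p.2)
    (mem_of_superset (hO.mem_nhds hx) fun _ hy u => hg.hasDirDeriv hy u)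
    ((hg.dirDeriv_prod hO).continuousOn.continuousAt
      ((hO.prod isOpen_univ).mem_nhds ⟨hx, mem_univ _⟩)) hf

theorem MBSmoothOn.isLinearMap_dirDeriv {f : E → F} {U : Set E} (hf : MBSmoothOn 𝕜 f U)
    (hU : IsOpen U) {x : E} (hx : x ∈ U) : IsLinearMap 𝕜 (dirDeriv 𝕜 f x) where
  map_add v _ := (HasDirDeriv.add_dir (df := fun p => dirDeriv 𝕜 f p.1 p.2)
    (mem_of_superset (hU.mem_nhds hx) fun _ hy u => hf.hasDirDeriv hy u)
    ((hf.dirDeriv_prod hU).continuousOn.continuousAt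
      ((hU.prod isOpen_univ).mem_nhds ⟨hx, mem_univ _⟩)) (hf.hasDirDeriv hx v)).dirDeriv_eq
  map_smul a v := ((hf.hasDirDeriv hx v).smul_dir a).dirDeriv_eq

end SmoothChainRule

/-! ### The scalar product -/

/-- The phase `a / ‖a‖` of a nonzero complex number. The phase of `0` is `1`. -/
def phase (a : ℂ) : Circle := Circle.exp a.arg

theorem norm_mul_phase (a : ℂ) : (‖a‖ : ℂ) * phase a = a := by
  rw [phase, Circle.coe_exp, Complex.norm_mul_exp_arg_mul_I]

theorem phase_coe_circle (z : Circle) : phase z = z := Circle.exp_arg z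

theorem phase_ofReal {r : ℝ} (hr : 0 < r) : phase r = 1 := by
  rw [phase, Complex.arg_ofReal_of_nonneg hr.le, Circle.exp_zero]

theorem phase_mul {a b : ℂ} (ha : a ≠ 0) (hb : b ≠ 0) : phase (a * b) = phase a * phase b := by
  refine Circle.ext (mul_left_cancel₀ (a := (‖a * b‖ : ℂ)) (by simp [ha, hb]) ?_)
  rw [norm_mul_phase, Circle.coe_mul, norm_mul, Complex.ofReal_mul, mul_mul_mul_comm,
    norm_mul_phase, norm_mul_phase]

theorem mk_eq_mk_of_smul {V : Type*} [AddCommGroup V] [Module ℂ V] {v w : V} (hv : v ≠ 0)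
    (hw : w ≠ 0) {a : ℂ} (h : v = a • w) :
    Projectivization.mk ℂ v hv = Projectivization.mk ℂ w hw :=
  (Projectivization.mk_eq_mk_iff' ℂ v w hv hw).2 ⟨a, h.symm⟩

theorem mem_submodule_mk {V : Type*} [AddCommGroup V] [Module ℂ V] {w : V} (hw : w ≠ 0) :
    w ∈ (Projectivization.mk ℂ w hw).submodule := by
  rw [Projectivization.submodule_mk]
  exact Submodule.mem_span_singleton_self w

section Algebra

variable {V : Type*} [AddCommGroup V] [Module ℂ V] [InnerProductSpace.Core ℂ V]

theorem star_ip (x y : V) : star (ip x y) = ip y x := InnerProductSpace.Core.inner_conj_symm y x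

theorem ip_add_left (x y z : V) : ip (x + y) z = ip x z + ip y z :=
  InnerProductSpace.Core.inner_add_left x y z

theorem ip_sub_left (x y z : V) : ip (x - y) z = ip x z - ip y z :=
  InnerProductSpace.Core.inner_sub_left x y z

theorem ip_real_smul_right (x y : V) (r : ℝ) : ip x (r • y) = r * ip x y :=
  ip_smul_right x y (r : ℂ)

theorem ip_real_smul_left (x y : V) (r : ℝ) : ip (r • x) y = r * ip x y := by
  simpa using ip_smul_left x y (r : ℂ)

variable (V) in
/-- The scalar product as a real bilinear map, to which the rules for the derivatives of bilinear
expressions apply. -/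
def ipBilin : V →ₗ[ℝ] V →ₗ[ℝ] ℂ :=
  LinearMap.mk₂ ℝ ip ip_add_left (fun a x y => ip_real_smul_left x y a)
    ip_add_right (fun a x y => ip_real_smul_right x y a)

theorem ip_self_ne_zero {x : V} (hx : x ≠ 0) : ip x x ≠ 0 := fun h =>
  (ip_self_pos hx).ne' (congrArg Complex.re h)

theorem ipNorm_pos {x : V} (hx : x ≠ 0) : 0 < ipNorm x := Real.sqrt_pos.2 (ip_self_pos hx)

theorem ofReal_ipNorm_ne_zero {x : V} (hx : x ≠ 0) : (ipNorm x : ℂ) ≠ 0 :=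
  Complex.ofReal_ne_zero.2 (ipNorm_pos hx).ne'

theorem ipNorm_smul (a : ℂ) (x : V) : ipNorm (a • x) = ‖a‖ * ipNorm x := by
  rw [ipNorm, ip_smul_left, ip_smul_right, ← mul_assoc, Complex.star_def,
    ← Complex.normSq_eq_conj_mul_self, Complex.re_ofReal_mul, Complex.normSq_eq_norm_sq,
    Real.sqrt_mul (sq_nonneg _), Real.sqrt_sq (norm_nonneg _), ipNorm]

theorem UnitSphere.ip_self (ψ : UnitSphere V) : ip (ψ : V) (ψ : V) = 1 := ψ.2

theorem UnitSphere.ipNorm (ψ : UnitSphere V) : ipNorm (ψ : V) = 1 := by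
  rw [_root_.ipNorm, ψ.ip_self, Complex.one_re, Real.sqrt_one]

theorem coe_unitVec {w : V} (hw : w ≠ 0) : (unitVec w hw : V) = ((ipNorm w)⁻¹ : ℂ) • w := rfl

theorem unitVec_coe (ψ : UnitSphere V) : unitVec (ψ : V) ψ.ne_zero = ψ :=
  Subtype.ext (by rw [coe_unitVec, ψ.ipNorm, Complex.ofReal_one, inv_one, one_smul])

theorem coe_circle_smul (z : Circle) (ψ : UnitSphere V) :
    ((z • ψ : UnitSphere V) : V) = (z : ℂ) • (ψ : V) := rfl

theorem unitVec_smul {a : ℂ} {w : V} (hw : w ≠ 0) (h : a • w ≠ 0) :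
    unitVec (a • w) h = phase a • unitVec w hw := by
  have ha : (‖a‖ : ℂ) ≠ 0 := by
    simpa using (smul_ne_zero_iff.1 h).1
  apply Subtype.ext
  rw [coe_circle_smul, coe_unitVec, coe_unitVec, ipNorm_smul, smul_smul, smul_smul,
    Complex.ofReal_mul, mul_inv_rev]
  nth_rw 2 [← norm_mul_phase a]
  rw [mul_assoc, inv_mul_cancel_left₀ ha, mul_comm]

theorem unitVec_eq_of_eq_smul {w : V} (hw : w ≠ 0) {r : ℝ} (hr : 0 < r) {χ : UnitSphere V}
    (h : w = (r : ℂ) • (χ : V)) : unitVec w hw = χ := by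
  subst h
  rw [unitVec_smul χ.ne_zero, phase_ofReal hr, one_smul, unitVec_coe]

/-! ### Lines and their unit vectors -/

theorem mk_eq_mk_iff_ip {v w : V} (hv : v ≠ 0) (hw : w ≠ 0) :
    Projectivization.mk ℂ v hv = Projectivization.mk ℂ w hw ↔ ip w w • v = ip w v • w := by
  refine ⟨fun h => ?_, fun h => mk_eq_mk_of_smul hv hw (a := (ip w w)⁻¹ * ip w v) ?_⟩
  · obtain ⟨a, rfl⟩ := (Projectivization.mk_eq_mk_iff' ℂ v w hv hw).1 h
    rw [ip_smul_right, smul_smul, mul_comm]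
  · rw [mul_smul, ← h, inv_smul_smul₀ (ip_self_ne_zero hw)]

theorem sphereProj_unitVec {w : V} (hw : w ≠ 0) :
    sphereProj (unitVec w hw) = Projectivization.mk ℂ w hw :=
  mk_eq_mk_of_smul _ _ rfl

theorem sphereProj_smul (z : Circle) (ψ : UnitSphere V) : sphereProj (z • ψ) = sphereProj ψ :=
  mk_eq_mk_of_smul _ _ rfl

theorem sphereProj_chartIx (p : ℙ ℂ V) : sphereProj (projCharts.chartIx p) = p :=
  (sphereProj_unitVec p.rep_nonzero).trans p.mk_rep

theorem ip_smul_eq_of_mem_submodule {φ : UnitSphere V} {p : ℙ ℂ V} (hφ : sphereProj φ = p) {w : V}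
    (hw : w ∈ p.submodule) : ip (φ : V) w • (φ : V) = w := by
  rw [← hφ, sphereProj, Projectivization.submodule_mk] at hw
  obtain ⟨a, rfl⟩ := Submodule.mem_span_singleton.1 hw
  rw [ip_smul_right, φ.ip_self, mul_one]

/-! ### The charts of projective space and of the sphere, lifted to `V` -/

theorem ip_hyperplane {ψ : UnitSphere V} (v : hyperplane ψ) : ip (ψ : V) (v : V) = 0 := v.2

theorem re_ip_realHyperplane {ψ : UnitSphere V} (v : realHyperplane ψ) :
    (ip (ψ : V) (v : V)).re = 0 := v.2

theorem coe_toHyperplane (ψ : UnitSphere V) (w : V) :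
    (toHyperplane ψ w : V) = w - ip (ψ : V) w • (ψ : V) := rfl

theorem coe_toRealHyperplane (ψ : UnitSphere V) (w : V) :
    (toRealHyperplane ψ w : V) = w - ((ip (ψ : V) w).re : ℂ) • (ψ : V) := rfl

theorem toHyperplane_coe (ψ : UnitSphere V) (v : hyperplane ψ) : toHyperplane ψ (v : V) = v :=
  Subtype.ext (by rw [coe_toHyperplane, ip_hyperplane, zero_smul, sub_zero])

theorem ip_add_coe (ψ : UnitSphere V) (v : hyperplane ψ) : ip (ψ : V) ((ψ : V) + v) = 1 := by
  rw [ip_add_right, ψ.ip_self, ip_hyperplane, add_zero]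

theorem re_ip_add_coe (ψ : UnitSphere V) (v : realHyperplane ψ) :
    (ip (ψ : V) ((ψ : V) + v)).re = 1 := by
  rw [ip_add_right, ψ.ip_self, Complex.add_re, re_ip_realHyperplane, add_zero, Complex.one_re]

theorem ip_toHyperplane (ψ : UnitSphere V) (v w : V) :
    ip (toHyperplane ψ v : V) (toHyperplane ψ w : V) = ip v w - ip v ψ * ip (ψ : V) w := by
  have h : ip (ψ : V) (toHyperplane ψ w : V) = 0 := ip_hyperplane _
  rw [coe_toHyperplane ψ v, ip_sub_left, ip_smul_left, h, mul_zero, sub_zero, coe_toHyperplane,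
    ip_sub_right, ip_smul_right, mul_comm]

theorem coe_toHyperplane_of_ip_eq_one {ψ : UnitSphere V} {w : V} (hw : ip (ψ : V) w = 1) :
    (toHyperplane ψ w : V) = w - ψ := by
  rw [coe_toHyperplane, hw, one_smul]

theorem coe_toRealHyperplane_of_re_ip_eq_one {ψ : UnitSphere V} {w : V}
    (hw : (ip (ψ : V) w).re = 1) : (toRealHyperplane ψ w : V) = w - ψ := by
  rw [coe_toRealHyperplane, hw, Complex.ofReal_one, one_smul]

/-- The chart `κ_ψ` of `P(V)` as a function `w ↦ ⟨ψ, w⟩⁻¹ w - ψ` on `{w ∈ V | ⟨ψ, w⟩ ≠ 0}`. -/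
def projCoord (ψ : UnitSphere V) (w : V) : hyperplane ψ := toHyperplane ψ ((ip (ψ : V) w)⁻¹ • w)

/-- The chart of `S(V)` at `ψ`, extended to the positively homogeneous function
`w ↦ (Re ⟨ψ, w⟩)⁻¹ w - ψ` on `{w ∈ V | Re ⟨ψ, w⟩ > 0}`. -/
def sphereCoord (ψ : UnitSphere V) (w : V) : realHyperplane ψ :=
  toRealHyperplane ψ ((((ip (ψ : V) w).re)⁻¹ : ℂ) • w)

theorem add_projCoord {ψ : UnitSphere V} {w : V} (hw : ip (ψ : V) w ≠ 0) :
    (ψ : V) + projCoord ψ w = (ip (ψ : V) w)⁻¹ • w := by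
  rw [projCoord, coe_toHyperplane_of_ip_eq_one (by rw [ip_smul_right, inv_mul_cancel₀ hw]),
    add_sub_cancel]

theorem add_sphereCoord {ψ : UnitSphere V} {w : V} (hw : (ip (ψ : V) w).re ≠ 0) :
    (ψ : V) + sphereCoord ψ w = (((ip (ψ : V) w).re)⁻¹ : ℂ) • w := by
  rw [sphereCoord, coe_toRealHyperplane_of_re_ip_eq_one, add_sub_cancel]
  rw [ip_smul_right, ← Complex.ofReal_inv, Complex.re_ofReal_mul, inv_mul_cancel₀ hw]

theorem projCoord_add_coe (ψ : UnitSphere V) (v : hyperplane ψ) :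
    projCoord ψ ((ψ : V) + v) = v :=
  Subtype.ext (by
    rw [projCoord, ip_add_coe, inv_one, one_smul, coe_toHyperplane_of_ip_eq_one (ip_add_coe ψ v),
      add_sub_cancel_left])

theorem sphereCoord_add_coe (ψ : UnitSphere V) (v : realHyperplane ψ) :
    sphereCoord ψ ((ψ : V) + v) = v :=
  Subtype.ext (by
    rw [sphereCoord, re_ip_add_coe, Complex.ofReal_one, inv_one, one_smul,
      coe_toRealHyperplane_of_re_ip_eq_one (re_ip_add_coe ψ v), add_sub_cancel_left])

theorem inv_ip_smul_smul (x w : V) {a : ℂ} (ha : a ≠ 0) :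
    (ip x (a • w))⁻¹ • a • w = (ip x w)⁻¹ • w := by
  rw [ip_smul_right, smul_smul, mul_inv, mul_right_comm, inv_mul_cancel₀ ha, one_mul]

theorem inv_ip_smul_rep (x : V) {w : V} (hw : w ≠ 0) :
    (ip x (Projectivization.mk ℂ w hw).rep)⁻¹ • (Projectivization.mk ℂ w hw).rep =
      (ip x w)⁻¹ • w := by
  obtain ⟨a, ha⟩ := Projectivization.exists_smul_eq_mk_rep ℂ w hw
  rw [← ha, Units.smul_def, inv_ip_smul_smul x w a.ne_zero]

theorem projCharts_toFun_mk (ψ : UnitSphere V) {w : V} (hw : w ≠ 0) :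
    projCharts.toFun ψ (Projectivization.mk ℂ w hw) = projCoord ψ w :=
  congrArg (toHyperplane ψ) (inv_ip_smul_rep (ψ : V) hw)

theorem coe_tautFrames_frame_mk (ψ : UnitSphere V) {w : V} (hw : w ≠ 0) :
    (tautFrames.frame ψ (Projectivization.mk ℂ w hw) : V) = (ip (ψ : V) w)⁻¹ • w :=
  inv_ip_smul_rep (ψ : V) hw

theorem mk_mem_projCharts_source {ψ : UnitSphere V} {w : V} (hw : w ≠ 0) :
    Projectivization.mk ℂ w hw ∈ projCharts.source ψ ↔ ip (ψ : V) w ≠ 0 := by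
  obtain ⟨a, ha⟩ := Projectivization.exists_smul_eq_mk_rep ℂ w hw
  change ip (ψ : V) (Projectivization.mk ℂ w hw).rep ≠ 0 ↔ _
  rw [← ha, Units.smul_def, ip_smul_right]
  exact mul_ne_zero_iff_left a.ne_zero

theorem sphereProj_mem_projCharts_source (φ : UnitSphere V) :
    sphereProj φ ∈ projCharts.source φ := by
  rw [sphereProj, mk_mem_projCharts_source, φ.ip_self]
  exact one_ne_zero

theorem mem_projCharts_source_chartIx (p : ℙ ℂ V) :
    p ∈ projCharts.source (projCharts.chartIx p) := by
  have h := sphereProj_mem_projCharts_source (projCharts.chartIx p)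
  rwa [sphereProj_chartIx] at h

theorem projCharts_invFun_mem_source {ψ φ : UnitSphere V} {v : hyperplane ψ} :
    projCharts.invFun ψ v ∈ projCharts.source φ ↔ ip (φ : V) ((ψ : V) + v) ≠ 0 :=
  mk_mem_projCharts_source _

theorem projCharts_invFun_mem_source_self (ψ : UnitSphere V) (v : hyperplane ψ) :
    projCharts.invFun ψ v ∈ projCharts.source ψ := by
  rw [projCharts_invFun_mem_source, ip_add_coe]
  exact one_ne_zero

theorem projCharts_toFun_invFun (ψ φ : UnitSphere V) (v : hyperplane ψ) :
    projCharts.toFun φ (projCharts.invFun ψ v) = projCoord φ ((ψ : V) + v) :=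
  projCharts_toFun_mk φ _

theorem coe_tautFrames_frame_invFun (ψ φ : UnitSphere V) (v : hyperplane ψ) :
    (tautFrames.frame φ (projCharts.invFun ψ v) : V) =
      (ip (φ : V) ((ψ : V) + v))⁻¹ • ((ψ : V) + v) :=
  coe_tautFrames_frame_mk φ _

theorem projCharts_right_inv (ψ : UnitSphere V) (v : hyperplane ψ) :
    projCharts.toFun ψ (projCharts.invFun ψ v) = v := by
  rw [projCharts_toFun_invFun, projCoord_add_coe]

theorem projCharts_left_inv {ψ : UnitSphere V} {p : ℙ ℂ V} (hp : p ∈ projCharts.source ψ) :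
    projCharts.invFun ψ (projCharts.toFun ψ p) = p := by
  induction p with
  | h w hw =>
    rw [mk_mem_projCharts_source] at hp
    refine mk_eq_mk_of_smul _ _ (a := (ip (ψ : V) w)⁻¹) ?_
    rw [projCharts_toFun_mk, add_projCoord hp]

theorem projCoord_self (ψ : UnitSphere V) : projCoord ψ ψ = 0 := by
  simpa using projCoord_add_coe ψ 0

theorem projCharts_toFun_chartIx (p : ℙ ℂ V) :
    projCharts.toFun (projCharts.chartIx p) p = 0 := by
  have h := projCharts_toFun_mk (projCharts.chartIx p) (projCharts.chartIx p).ne_zero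
  rwa [← sphereProj, sphereProj_chartIx, projCoord_self] at h

theorem sphereCharts_toFun (ψ χ : UnitSphere V) :
    sphereCharts.toFun ψ χ = sphereCoord ψ χ := rfl

theorem sphereCoord_real_smul (ψ : UnitSphere V) {r : ℝ} (hr : r ≠ 0) (w : V) :
    sphereCoord ψ ((r : ℂ) • w) = sphereCoord ψ w := by
  have hr' : (r : ℂ) ≠ 0 := Complex.ofReal_ne_zero.2 hr
  rw [sphereCoord, sphereCoord, ip_smul_right, Complex.re_ofReal_mul, smul_smul,
    Complex.ofReal_mul, mul_inv, mul_right_comm, inv_mul_cancel₀ hr', one_mul]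

theorem sphereCharts_toFun_unitVec (ψ : UnitSphere V) {w : V} (hw : w ≠ 0) :
    sphereCharts.toFun ψ (unitVec w hw) = sphereCoord ψ w := by
  rw [sphereCharts_toFun, coe_unitVec, ← Complex.ofReal_inv,
    sphereCoord_real_smul ψ (inv_pos.2 (ipNorm_pos hw)).ne']

theorem unitVec_mem_sphereCharts_source {ψ : UnitSphere V} {w : V} (hw : w ≠ 0) :
    unitVec w hw ∈ sphereCharts.source ψ ↔ 0 < (ip (ψ : V) w).re := by
  change 0 < (ip (ψ : V) (unitVec w hw : V)).re ↔ _
  rw [coe_unitVec, ip_smul_right, ← Complex.ofReal_inv, Complex.re_ofReal_mul]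
  exact mul_pos_iff_of_pos_left (inv_pos.2 (ipNorm_pos hw))

theorem mem_sphereCharts_source_self (ψ : UnitSphere V) : ψ ∈ sphereCharts.source ψ := by
  rw [← unitVec_coe ψ, unitVec_mem_sphereCharts_source, unitVec_coe, ψ.ip_self]
  exact one_pos

theorem sphereCharts_right_inv (ψ : UnitSphere V) (v : realHyperplane ψ) :
    sphereCharts.toFun ψ (sphereCharts.invFun ψ v) = v :=
  (sphereCharts_toFun_unitVec ψ (add_ne_zero_of_re ψ v.2)).trans (sphereCoord_add_coe ψ v)

theorem sphereCharts_left_inv {ψ χ : UnitSphere V} (hχ : χ ∈ sphereCharts.source ψ) :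
    sphereCharts.invFun ψ (sphereCharts.toFun ψ χ) = χ := by
  have h : 0 < (ip (ψ : V) χ).re := hχ
  refine unitVec_eq_of_eq_smul (add_ne_zero_of_re ψ (sphereCharts.toFun ψ χ).2)
    (inv_pos.2 h) ?_
  rw [sphereCharts_toFun, add_sphereCoord h.ne', Complex.ofReal_inv]

theorem sphereCoord_self (ψ : UnitSphere V) : sphereCoord ψ ψ = 0 := by
  simpa using sphereCoord_add_coe ψ 0

end Algebra

/-! ### Continuity and the topology of projective space -/

/-- The scalar product of `V` is continuous. -/
class ContinuousIp (V : Type*) [AddCommGroup V] [Module ℂ V] [InnerProductSpace.Core ℂ V]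
    [TopologicalSpace V] : Prop where
  continuous_ip : Continuous fun x : V × V => ip x.1 x.2

section Continuity

variable {V : Type*} [AddCommGroup V] [Module ℂ V] [TopologicalSpace V]

instance [ContinuousSMul ℂ V] : ContinuousSMul ℝ V := IsScalarTower.continuousSMul ℂ

section Ip

variable [InnerProductSpace.Core ℂ V] [ContinuousIp V]

theorem continuous_ip {X : Type*} [TopologicalSpace X] {f g : X → V} (hf : Continuous f)
    (hg : Continuous g) : Continuous fun x => ip (f x) (g x) :=
  ContinuousIp.continuous_ip.comp (hf.prodMk hg)

/-- The functional `⟨x, ·⟩`. -/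
def ipCLM (x : V) : V →L[ℂ] ℂ where
  toFun := ip x
  map_add' := ip_add_right x
  map_smul' a y := ip_smul_right x y a
  cont := continuous_ip continuous_const continuous_id

theorem isOpen_projCharts_source (ψ : UnitSphere V) : IsOpen (projCharts.source ψ) := by
  refine isOpen_coinduced.2 ?_
  have h : Projectivization.mk' ℂ ⁻¹' (projCharts.source ψ) =
      {w : {v : V // v ≠ 0} | ip (ψ : V) w ≠ 0} :=
    Set.ext fun w => mk_mem_projCharts_source w.2
  rw [h]
  exact isOpen_ne_fun (continuous_ip continuous_const continuous_subtype_val) continuous_const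

theorem isOpen_sphereCharts_source (ψ : UnitSphere V) : IsOpen (sphereCharts.source ψ) :=
  isOpen_lt continuous_const
    (Complex.continuous_re.comp (continuous_ip continuous_const continuous_subtype_val))

variable [IsTopologicalAddGroup V]

instance t2Space_of_continuousIp : T2Space V := by
  refine IsTopologicalAddGroup.t2Space_of_zero_sep fun x hx => ?_
  have hc : Continuous fun y : V => ip y y := continuous_ip continuous_id continuous_id
  refine ⟨{y | ip y y ≠ ip x x}, (isOpen_ne_fun hc continuous_const).mem_nhds ?_, fun h => h rfl⟩
  rw [mem_ofPred_eq, ip_zero_right]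
  exact (ip_self_ne_zero hx).symm

variable [ContinuousSMul ℂ V]

/-- The projection `toHyperplane ψ` as a continuous linear map. -/
def toHyperplaneCLM (ψ : UnitSphere V) : V →L[ℂ] hyperplane ψ :=
  (ContinuousLinearMap.id ℂ V - (ipCLM (ψ : V)).smulRight (ψ : V)).codRestrict (hyperplane ψ)
    fun w => (toHyperplane ψ w).2

/-- The projection `toRealHyperplane ψ` as a continuous linear map. -/
def toRealHyperplaneCLM (ψ : UnitSphere V) : V →L[ℝ] realHyperplane ψ :=
  (ContinuousLinearMap.id ℝ V - ((Complex.ofRealCLM ∘L Complex.reCLM ∘L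
    (ipCLM (ψ : V)).restrictScalars ℝ).smulRight (ψ : V))).codRestrict (realHyperplane ψ)
    fun w => (toRealHyperplane ψ w).2

end Ip

section Projectivization

variable [ContinuousSMul ℂ V]

theorem isOpenQuotientMap_projectivization_mk :
    IsOpenQuotientMap (Projectivization.mk' ℂ : {v : V // v ≠ 0} → ℙ ℂ V) where
  surjective p := ⟨⟨p.rep, p.rep_nonzero⟩, p.mk_rep⟩
  continuous := continuous_coinduced_rng
  isOpenMap U hU := by
    refine isOpen_coinduced.2 ?_
    have h : Projectivization.mk' ℂ ⁻¹' (Projectivization.mk' ℂ '' U) =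
        ⋃ a : ℂˣ, (fun v : {v : V // v ≠ 0} =>
          (⟨(a : ℂ) • (v : V), smul_ne_zero a.ne_zero v.2⟩ : {v : V // v ≠ 0})) ⁻¹' U := by
      ext v
      simp only [mem_preimage, mem_image, mem_iUnion]
      constructor
      · rintro ⟨u, hu, huv⟩
        obtain ⟨a, ha⟩ := (Projectivization.mk_eq_mk_iff ℂ _ _ u.2 v.2).1 huv
        exact ⟨a, by convert hu; exact ha⟩
      · rintro ⟨a, ha⟩
        exact ⟨_, ha, mk_eq_mk_of_smul _ _ rfl⟩
    rw [h]
    exact isOpen_iUnion fun a => hU.preimage (Continuous.subtype_mk (by fun_prop) _)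

theorem continuous_projectivization_mk {X : Type*} [TopologicalSpace X] {f : X → V}
    (hf : Continuous f) (h0 : ∀ x, f x ≠ 0) :
    Continuous fun x => Projectivization.mk ℂ (f x) (h0 x) :=
  isOpenQuotientMap_projectivization_mk.continuous.comp (hf.subtype_mk h0)

variable [InnerProductSpace.Core ℂ V]

theorem continuous_sphereProj : Continuous (sphereProj (V := V)) :=
  continuous_projectivization_mk continuous_subtype_val UnitSphere.ne_zero

variable [IsTopologicalAddGroup V]

theorem continuous_projCharts_invFun (ψ : UnitSphere V) : Continuous (projCharts.invFun ψ) :=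
  continuous_projectivization_mk (continuous_const.add continuous_subtype_val)
    (add_ne_zero_of_mem ψ)

variable [ContinuousIp V]

theorem continuousOn_projCharts_toFun (ψ : UnitSphere V) :
    ContinuousOn (projCharts.toFun ψ) (projCharts.source ψ) := by
  intro p hp
  refine ContinuousAt.continuousWithinAt ?_
  induction p with
  | h w hw =>
    rw [mk_mem_projCharts_source] at hp
    refine (isOpenQuotientMap_projectivization_mk.continuousAt_comp_iff (x := ⟨w, hw⟩)).1 ?_
    have h : projCharts.toFun ψ ∘ Projectivization.mk' ℂ =
        fun w : {v : V // v ≠ 0} => projCoord ψ (w : V) :=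
      funext fun w => projCharts_toFun_mk ψ w.2
    rw [h]
    exact (toHyperplaneCLM ψ).continuous.continuousAt.comp
      (((continuous_ip continuous_const continuous_subtype_val).continuousAt.inv₀ hp).smul
        continuous_subtype_val.continuousAt)

instance t2Space_projectivization : T2Space (ℙ ℂ V) := by
  rw [t2Space_iff_of_isOpenQuotientMap isOpenQuotientMap_projectivization_mk]
  have h : {q : {v : V // v ≠ 0} × {v : V // v ≠ 0} |
      Projectivization.mk' ℂ q.1 = Projectivization.mk' ℂ q.2} =
      {q | ip (q.2 : V) q.2 • (q.1 : V) = ip (q.2 : V) q.1 • (q.2 : V)} :=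
    Set.ext fun q => mk_eq_mk_iff_ip q.1.2 q.2.2
  rw [h]
  have h₁ : Continuous fun q : {v : V // v ≠ 0} × {v : V // v ≠ 0} => (q.1 : V) := by fun_prop
  have h₂ : Continuous fun q : {v : V // v ≠ 0} × {v : V // v ≠ 0} => (q.2 : V) := by fun_prop
  exact isClosed_eq ((continuous_ip h₂ h₂).smul h₁) ((continuous_ip h₂ h₁).smul h₂)

end Projectivization

section Sphere

variable [InnerProductSpace.Core ℂ V] [ContinuousIp V] [ContinuousSMul ℂ V]

theorem continuous_unitVec {X : Type*} [TopologicalSpace X] {f : X → V} (hf : Continuous f)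
    (h0 : ∀ x, f x ≠ 0) : Continuous fun x => unitVec (f x) (h0 x) := by
  have h : Continuous fun x => ipNorm (f x) :=
    (Complex.continuous_re.comp (continuous_ip hf hf)).sqrt
  exact Continuous.subtype_mk (((Complex.continuous_ofReal.comp h).inv₀
    fun x => ofReal_ipNorm_ne_zero (h0 x)).smul hf) _

variable [IsTopologicalAddGroup V]

theorem continuous_sphereCharts_invFun (ψ : UnitSphere V) : Continuous (sphereCharts.invFun ψ) :=
  continuous_unitVec (continuous_const.add continuous_subtype_val) fun v =>
    add_ne_zero_of_re ψ v.2

theorem continuousOn_sphereCharts_toFun (ψ : UnitSphere V) :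
    ContinuousOn (sphereCharts.toFun ψ) (sphereCharts.source ψ) := by
  have h : Continuous fun χ : UnitSphere V => (((ip (ψ : V) χ).re : ℝ) : ℂ) :=
    Complex.continuous_ofReal.comp (Complex.continuous_re.comp
      (continuous_ip continuous_const continuous_subtype_val))
  exact (toRealHyperplaneCLM ψ).continuous.comp_continuousOn ((h.continuousOn.inv₀
    fun _ hχ => Complex.ofReal_ne_zero.2 (ne_of_gt hχ)).smul continuous_subtype_val.continuousOn)

end Sphere

end Continuity

/-! ### Functions on manifolds -/

theorem IsLCModel.restrictScalars {E : Type*} [AddCommGroup E] [Module ℂ E] [Module ℝ E]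
    [IsScalarTower ℝ ℂ E] [TopologicalSpace E] (h : IsLCModel ℂ E) : IsLCModel ℝ E where
  addGroup := h.addGroup
  smul := have := h.smul; IsScalarTower.continuousSMul ℂ
  convex := h.convex
  t2 := h.t2

theorem IsLCManifold.restrictScalars {M : Type*} [TopologicalSpace M] {ι : Type*} {E : ι → Type*}
    [∀ i, AddCommGroup (E i)] [∀ i, Module ℂ (E i)] [∀ i, Module ℝ (E i)]
    [∀ i, IsScalarTower ℝ ℂ (E i)] [∀ i, TopologicalSpace (E i)] {A : ChartFamily M E}
    (h : IsLCManifold ℂ A) : IsLCManifold ℝ A where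
  __ := h
  model i := (h.model i).restrictScalars
  smooth_transition i j := (h.smooth_transition i j).restrictScalars

section Functions

variable {M : Type*} [TopologicalSpace M] {ι : Type*} {E : ι → Type*} [∀ i, AddCommGroup (E i)]
  [∀ i, Module ℝ (E i)] [∀ i, TopologicalSpace (E i)] {A : ChartFamily M E}
  {R : Type*} [AddCommGroup R] [Module ℝ R] [TopologicalSpace R]
  {g : M → R} {U : Set M}

theorem IsLCManifold.isOpen_inter_preimage (hA : IsLCManifold ℝ A) (i : ι) (hU : IsOpen U) :
    IsOpen (A.target i ∩ A.invFun i ⁻¹' U) :=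
  (hA.continuousOn_inv i).isOpen_inter_preimage (hA.isOpen_target i) hU

theorem IsLCManifold.invFun_toFun_chartIx (hA : IsLCManifold ℝ A) (p : M) :
    A.invFun (A.chartIx p) (A.toFun (A.chartIx p) p) = p :=
  hA.left_inv _ (hA.mem_source_at p)

theorem IsLCManifold.toFun_chartIx_mem (hA : IsLCManifold ℝ A) {p : M} (hp : p ∈ U) :
    A.toFun (A.chartIx p) p ∈ A.target (A.chartIx p) ∩ A.invFun (A.chartIx p) ⁻¹' U :=
  ⟨hA.mapsTo _ (hA.mem_source_at p), by rwa [mem_preimage, hA.invFun_toFun_chartIx]⟩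

theorem IsLCManifold.eventually_invFun_mem (hA : IsLCManifold ℝ A) {i : ι} {x : E i}
    (hx : x ∈ A.target i) (hU : IsOpen U) (hxU : A.invFun i x ∈ U) (v : E i) :
    ∀ᶠ t in 𝓝 (0 : ℝ), A.invFun i (x + t • v) ∈ U :=
  have := (hA.model i).addGroup
  have := (hA.model i).smul
  (eventually_add_smul_mem (hA.isOpen_inter_preimage i hU) ⟨hx, hxU⟩ v).mono fun _ ht => ht.2

theorem ChartFamily.SmoothFunOn.congr {g' : M → R} (hA : IsLCManifold ℝ A) (hU : IsOpen U)
    (hg : A.SmoothFunOn g U) (h : EqOn g g' U) : A.SmoothFunOn g' U := fun i =>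
  have := (hA.model i).addGroup
  have := (hA.model i).smul
  (hg i).congr (hA.isOpen_inter_preimage i hU) fun _ hx => h hx.2

theorem ChartFamily.SmoothFunOn.hasDirDeriv [T2Space R] (hA : IsLCManifold ℝ A)
    (hg : A.SmoothFunOn g U) {p : M} (hp : p ∈ U) (v : A.Tan p) :
    HasDirDeriv ℝ (fun y => g (A.invFun (A.chartIx p) y)) (A.toFun (A.chartIx p) p) v
      (A.dFun g p v) :=
  (hg _).hasDirDeriv (hA.toFun_chartIx_mem hp) v

section TangentMap

variable [IsTopologicalAddGroup R] [ContinuousSMul ℝ R] [LocallyConvexSpace ℝ R] [T2Space R]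

theorem ChartFamily.SmoothFunOn.isLinearMap_dFun (hA : IsLCManifold ℝ A) (hU : IsOpen U)
    (hg : A.SmoothFunOn g U) {p : M} (hp : p ∈ U) : IsLinearMap ℝ (A.dFun g p) :=
  have := (hA.model (A.chartIx p)).addGroup
  have := (hA.model (A.chartIx p)).smul
  (hg _).isLinearMap_dirDeriv (hA.isOpen_inter_preimage _ hU) (hA.toFun_chartIx_mem hp)

theorem ChartFamily.SmoothFunOn.hasDirDeriv_comp {D : Type*} [AddCommGroup D] [Module ℝ D]
    (hA : IsLCManifold ℝ A) (hU : IsOpen U) (hg : A.SmoothFunOn g U) {p : M} (hp : p ∈ U)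
    {f : D → M} {x v : D} {w : A.Tan p} (hfx : f x = p)
    (hf : HasDirDeriv ℝ (fun y => A.toFun (A.chartIx p) (f y)) x v w)
    (hmem : ∀ᶠ t in 𝓝 (0 : ℝ), f (x + t • v) ∈ A.source (A.chartIx p)) :
    HasDirDeriv ℝ (fun y => g (f y)) x v (A.dFun g p w) := by
  have := (hA.model (A.chartIx p)).addGroup
  have := (hA.model (A.chartIx p)).smul
  have h := (hg (A.chartIx p)).hasDirDeriv_comp (hA.isOpen_inter_preimage _ hU)
    (by rw [hfx]; exact hA.toFun_chartIx_mem hp) hf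
  rw [hfx] at h
  refine h.congr_line ?_ ((hmem.filter_mono nhdsWithin_le_nhds).mono fun t ht => ?_)
  · rw [hfx, hA.invFun_toFun_chartIx]
  · rw [hA.left_inv _ ht]

theorem ChartFamily.SmoothFunOn.dFun_toTan (hA : IsLCManifold ℝ A) (hU : IsOpen U)
    (hg : A.SmoothFunOn g U) {i : ι} {x : E i} (hx : x ∈ A.target i) (hxU : A.invFun i x ∈ U)
    (v : E i) :
    A.dFun g (A.invFun i x) (A.toTan i x v) = dirDeriv ℝ (fun y => g (A.invFun i y)) x v := by
  have hmem := hA.mem_source_at (A.invFun i x)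
  have := (hA.model (A.chartIx (A.invFun i x))).t2
  exact (hg.hasDirDeriv_comp hA hU hxU rfl ((hA.smooth_transition i _).hasDirDeriv ⟨hx, hmem⟩ v)
    (hA.eventually_invFun_mem hx (hA.isOpen_source _) hmem v)).dirDeriv_eq.symm

theorem ChartFamily.SmoothFunOn.hasDirDeriv_tangentMap {N κ : Type*} [TopologicalSpace N]
    {F : κ → Type*} [∀ i, AddCommGroup (F i)] [∀ i, Module ℝ (F i)] [∀ i, TopologicalSpace (F i)]
    {B : ChartFamily N F} (hA : IsLCManifold ℝ A) (hB : IsLCManifold ℝ B) (hU : IsOpen U)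
    (hg : A.SmoothFunOn g U) {f : N → M} (hf : B.SmoothMapOn A f univ) {s : N} (hs : f s ∈ U)
    (v : B.Tan s) :
    HasDirDeriv ℝ (fun y => g (f (B.invFun (B.chartIx s) y))) (B.toFun (B.chartIx s) s) v
      (A.dFun g (f s) (ChartFamily.tangentMap B A f s v)) := by
  have hsource := hA.mem_source_at (f s)
  have := (hA.model (A.chartIx (f s))).t2
  have hinv := hB.invFun_toFun_chartIx s
  have hx := hB.mapsTo _ (hB.mem_source_at s)
  have hopen := (continuousOn_univ.1 hf.1).isOpen_preimage _ (hA.isOpen_source (A.chartIx (f s)))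
  refine hg.hasDirDeriv_comp hA hU hs (congrArg f hinv)
    ((hf.2 _ _).hasDirDeriv ⟨hx, mem_univ _, ?_⟩ v) ?_
  · rwa [hinv]
  · exact hB.eventually_invFun_mem hx hopen (by rwa [mem_preimage, hinv]) v

end TangentMap

end Functions

/-! ### The manifolds `P(V)`, `S(V)` and `L(V)` -/

section Charts

variable {V : Type*} [AddCommGroup V] [Module ℂ V] [TopologicalSpace V]
  [InnerProductSpace.Core ℂ V]

theorem isOpen_ip_ne_zero [ContinuousIp V] (x : V) : IsOpen {w : V | ip x w ≠ 0} :=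
  isOpen_ne_fun (ipCLM x).continuous continuous_const

theorem isOpen_re_ip_pos [ContinuousIp V] (x : V) : IsOpen {w : V | 0 < (ip x w).re} :=
  isOpen_lt continuous_const (Complex.continuous_re.comp (ipCLM x).continuous)

instance locallyConvexSpace_hyperplane [LocallyConvexSpace ℝ V] (ψ : UnitSphere V) :
    LocallyConvexSpace ℝ (hyperplane ψ) :=
  Topology.IsInducing.subtypeVal.locallyConvexSpace (𝕜 := ℝ)
    (f := (hyperplane ψ).subtype.restrictScalars ℝ)

variable [IsTopologicalAddGroup V]

theorem mbSmoothOn_add_hyperplane (ψ : UnitSphere V) (U : Set (hyperplane ψ)) :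
    MBSmoothOn ℂ (fun x : hyperplane ψ => (ψ : V) + x) U :=
  (mbSmoothOn_const (ψ : V) U).add (mbSmoothOn_clm (hyperplane ψ).subtypeL U)

theorem mbSmoothOn_add_realHyperplane (ψ : UnitSphere V) (U : Set (realHyperplane ψ)) :
    MBSmoothOn ℝ (fun x : realHyperplane ψ => (ψ : V) + x) U :=
  (mbSmoothOn_const (ψ : V) U).add (mbSmoothOn_clm (realHyperplane ψ).subtypeL U)

variable [ContinuousSMul ℂ V] [ContinuousIp V]

theorem mbSmoothOn_projCoord (ψ : UnitSphere V) :
    MBSmoothOn ℂ (projCoord ψ) {w | ip (ψ : V) w ≠ 0} :=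
  (((mbSmoothOn_clm (ipCLM (ψ : V)) _).inv fun _ hw => hw).smul
    (mbSmoothOn_clm (ContinuousLinearMap.id ℂ V) _)).clm_comp (toHyperplaneCLM ψ)

theorem mbSmoothOn_sphereCoord (ψ : UnitSphere V) :
    MBSmoothOn ℝ (sphereCoord ψ) {w | 0 < (ip (ψ : V) w).re} :=
  (((mbSmoothOn_clm (Complex.ofRealCLM ∘L Complex.reCLM ∘L (ipCLM (ψ : V)).restrictScalars ℝ)
    _).inv fun _ hw => Complex.ofReal_ne_zero.2 (ne_of_gt hw)).smul
    (mbSmoothOn_clm (ContinuousLinearMap.id ℝ V) _)).clm_comp (toRealHyperplaneCLM ψ)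

variable [LocallyConvexSpace ℝ V]

theorem isLCModel_hyperplane (ψ : UnitSphere V) : IsLCModel ℂ (hyperplane ψ) where
  addGroup := inferInstance
  smul := inferInstance
  convex := inferInstance
  t2 := inferInstance

theorem isLCManifold_projCharts : IsLCManifold ℂ (projCharts (V := V)) where
  model := isLCModel_hyperplane
  t2 := inferInstance
  mem_source_at := mem_projCharts_source_chartIx
  isOpen_source := isOpen_projCharts_source
  isOpen_target _ := isOpen_univ
  mapsTo _ _ _ := mem_univ _
  mapsTo_inv ψ v _ := projCharts_invFun_mem_source_self ψ v
  left_inv _ _ hp := projCharts_left_inv hp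
  right_inv ψ v _ := projCharts_right_inv ψ v
  continuousOn := continuousOn_projCharts_toFun
  continuousOn_inv ψ := (continuous_projCharts_invFun ψ).continuousOn
  smooth_transition ψ φ := by
    simp only [projCharts_toFun_invFun]
    exact (mbSmoothOn_projCoord φ).comp (isOpen_ip_ne_zero _) (mbSmoothOn_add_hyperplane ψ _)
      fun _ hx => projCharts_invFun_mem_source.1 hx.2

theorem isLCManifold_sphereCharts : IsLCManifold ℝ (sphereCharts (V := V)) where
  model ψ :=
    { addGroup := inferInstance
      smul := inferInstance
      convex := inferInstance
      t2 := inferInstance }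
  t2 := inferInstance
  mem_source_at := mem_sphereCharts_source_self
  isOpen_source := isOpen_sphereCharts_source
  isOpen_target _ := isOpen_univ
  mapsTo _ _ _ := mem_univ _
  mapsTo_inv ψ v _ := by
    refine (unitVec_mem_sphereCharts_source (add_ne_zero_of_re ψ v.2)).2 ?_
    rw [re_ip_add_coe]
    exact one_pos
  left_inv _ _ hχ := sphereCharts_left_inv hχ
  right_inv ψ v _ := sphereCharts_right_inv ψ v
  continuousOn := continuousOn_sphereCharts_toFun
  continuousOn_inv ψ := (continuous_sphereCharts_invFun ψ).continuousOn
  smooth_transition ψ φ := by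
    have h (x : realHyperplane ψ) : sphereCharts.toFun φ (sphereCharts.invFun ψ x) =
        sphereCoord φ ((ψ : V) + x) := sphereCharts_toFun_unitVec φ (add_ne_zero_of_re ψ x.2)
    simp only [h]
    exact (mbSmoothOn_sphereCoord φ).comp (isOpen_re_ip_pos _) (mbSmoothOn_add_realHyperplane ψ _)
      fun x hx => (unitVec_mem_sphereCharts_source (add_ne_zero_of_re ψ x.2)).1 hx.2

end Charts

section Tautological

variable {V : Type*} [AddCommGroup V] [Module ℂ V]

theorem tautTotalSpace_ext {l m : Bundle.TotalSpace ℂ (TautFib V)} (h : l.proj = m.proj)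
    (h' : (l.snd : V) = m.snd) : l = m := by
  obtain ⟨p, l⟩ := l
  obtain ⟨q, m⟩ := m
  obtain rfl : p = q := h
  exact congrArg (Bundle.TotalSpace.mk p) (Subtype.ext h')

theorem continuous_tautTotalSpace_proj_snd [TopologicalSpace V] :
    Continuous fun l : Bundle.TotalSpace ℂ (TautFib V) => (l.proj, (l.snd : V)) :=
  continuous_induced_dom

theorem continuous_tautTotalSpace_proj [TopologicalSpace V] :
    Continuous (Bundle.TotalSpace.proj : Bundle.TotalSpace ℂ (TautFib V) → ℙ ℂ V) :=
  continuous_tautTotalSpace_proj_snd.fst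

theorem continuous_tautTotalSpace_snd [TopologicalSpace V] :
    Continuous fun l : Bundle.TotalSpace ℂ (TautFib V) => (l.snd : V) :=
  continuous_tautTotalSpace_proj_snd.snd

variable [InnerProductSpace.Core ℂ V]

theorem coe_tautFrames_frame_invFun_self (ψ : UnitSphere V) (v : hyperplane ψ) :
    (tautFrames.frame ψ (projCharts.invFun ψ v) : V) = (ψ : V) + v := by
  rw [coe_tautFrames_frame_invFun, ip_add_coe, inv_one, one_smul]

theorem tautFrames_coord_smul_frame {ψ : UnitSphere V} {p : ℙ ℂ V} (hp : p ∈ projCharts.source ψ)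
    (l : TautFib V p) : tautFrames.coord ψ p l • tautFrames.frame ψ p = l := by
  induction p with
  | h w hw =>
    rw [mk_mem_projCharts_source] at hp
    obtain ⟨l, hl⟩ := l
    have hspan : l ∈ Submodule.span ℂ {w} := by rwa [← Projectivization.submodule_mk w hw]
    obtain ⟨a, rfl⟩ := Submodule.mem_span_singleton.1 hspan
    refine Subtype.ext (?_ : ip (ψ : V) (a • w) •
      (tautFrames.frame ψ (Projectivization.mk ℂ w hw) : V) = a • w)
    rw [coe_tautFrames_frame_mk, ip_smul_right, smul_smul, mul_inv_cancel_right₀ hp]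

theorem tautCharts_toFun_invFun (ψ φ : UnitSphere V) (x : hyperplane ψ × ℂ) :
    (tautFrames.charts projCharts).toFun φ ((tautFrames.charts projCharts).invFun ψ x) =
      (projCoord φ ((ψ : V) + x.1), ip (φ : V) (x.2 • ((ψ : V) + x.1))) := by
  rw [← projCharts_toFun_invFun, ← coe_tautFrames_frame_invFun_self]
  rfl

variable [TopologicalSpace V] [IsTopologicalAddGroup V] [ContinuousSMul ℂ V]

theorem continuous_tautCharts_invFun (ψ : UnitSphere V) :
    Continuous ((tautFrames.charts projCharts).invFun ψ) := by
  have h : Continuous fun x : hyperplane ψ × ℂ =>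
      x.2 • (tautFrames.frame ψ (projCharts.invFun ψ x.1) : V) := by
    simp only [coe_tautFrames_frame_invFun_self]
    fun_prop
  exact continuous_induced_rng.2 (((continuous_projCharts_invFun ψ).comp
    continuous_fst).prodMk h)

variable [ContinuousIp V]

instance t2Space_tautTotalSpace : T2Space (Bundle.TotalSpace ℂ (TautFib V)) :=
  .of_injective_continuous
    (fun _ _ h => tautTotalSpace_ext (congrArg Prod.fst h) (congrArg Prod.snd h))
    continuous_tautTotalSpace_proj_snd

variable [LocallyConvexSpace ℝ V]

theorem isLCManifold_tautCharts :
    IsLCManifold ℂ ((tautFrames (V := V)).charts projCharts) where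
  model ψ :=
    { addGroup := inferInstance
      smul := inferInstance
      convex := inferInstance
      t2 := inferInstance }
  t2 := t2Space_tautTotalSpace
  mem_source_at l := mem_projCharts_source_chartIx l.proj
  isOpen_source ψ := (isOpen_projCharts_source ψ).preimage continuous_tautTotalSpace_proj
  isOpen_target _ := isOpen_univ.prod isOpen_univ
  mapsTo _ _ _ := ⟨mem_univ _, mem_univ _⟩
  mapsTo_inv ψ x _ := projCharts_invFun_mem_source_self ψ x.1
  left_inv ψ l hl := by
    refine tautTotalSpace_ext (projCharts_left_inv hl) ?_
    change ip (ψ : V) (l.snd : V) •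
      (tautFrames.frame ψ (projCharts.invFun ψ (projCharts.toFun ψ l.proj)) : V) = l.snd
    rw [projCharts_left_inv hl]
    exact congrArg Subtype.val (tautFrames_coord_smul_frame hl l.snd)
  right_inv ψ x _ := by
    rw [tautCharts_toFun_invFun, projCoord_add_coe, ip_smul_right, ip_add_coe, mul_one]
  continuousOn ψ :=
    ((continuousOn_projCharts_toFun ψ).comp continuous_tautTotalSpace_proj.continuousOn
      fun _ hl => hl).prodMk (continuous_ip continuous_const
        continuous_tautTotalSpace_snd).continuousOn
  continuousOn_inv ψ := (continuous_tautCharts_invFun ψ).continuousOn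
  smooth_transition ψ φ := by
    simp only [tautCharts_toFun_invFun]
    have h := (mbSmoothOn_add_hyperplane ψ univ).comp_clm (ContinuousLinearMap.fst ℂ _ ℂ)
      (mapsTo_univ _ ((tautFrames.charts projCharts).target ψ ∩
        (tautFrames.charts projCharts).invFun ψ ⁻¹' (tautFrames.charts projCharts).source φ))
    exact ((mbSmoothOn_projCoord φ).comp (isOpen_ip_ne_zero _) h
      fun _ hx => projCharts_invFun_mem_source.1 hx.2).prodMk
      (((mbSmoothOn_clm (ContinuousLinearMap.snd ℂ _ ℂ) _).smul h).clm_comp (ipCLM (φ : V)))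

theorem isLineBundle_tautFrames : IsLineBundle ℂ (projCharts (V := V)) tautFrames where
  base := isLCManifold_projCharts
  total := isLCManifold_tautCharts
  linear ψ _ _ := ⟨fun l m => ip_add_right (ψ : V) l m, fun a l => ip_smul_right (ψ : V) l a⟩

end Tautological

/-! ### Tangent vectors -/

section TangentAlgebra

variable {V : Type*} [AddCommGroup V] [Module ℂ V] [InnerProductSpace.Core ℂ V]

theorem toHyperplane_smul_coe (φ : UnitSphere V) (a : ℂ) : toHyperplane φ (a • (φ : V)) = 0 :=
  Subtype.ext (by
    rw [coe_toHyperplane, ip_smul_right, φ.ip_self, mul_one, sub_self, Submodule.coe_zero])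

theorem toHyperplane_toRealHyperplane {φ s : UnitSphere V} {b : ℂ} (h : b • (φ : V) = s) (v : V) :
    toHyperplane φ (toRealHyperplane s v) = toHyperplane φ v := by
  refine Subtype.ext ?_
  rw [coe_toRealHyperplane, ← h, smul_smul, coe_toHyperplane, coe_toHyperplane, ip_sub_right,
    ip_smul_right, φ.ip_self, mul_one, sub_smul]
  abel

theorem toRealHyperplane_smul_coe (s : UnitSphere V) (a : ℂ) :
    toRealHyperplane s (a • (s : V)) = a.im • toRealHyperplane s (Complex.I • (s : V)) := by
  refine Subtype.ext ?_
  rw [Submodule.coe_smul, coe_toRealHyperplane, coe_toRealHyperplane, ip_smul_right, ip_smul_right,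
    s.ip_self, mul_one, mul_one, Complex.I_re, Complex.ofReal_zero, zero_smul, sub_zero, ← sub_smul,
    ← smul_assoc, Complex.real_smul]
  nth_rewrite 1 [← Complex.re_add_im a]
  rw [add_sub_cancel_left]

theorem toRealHyperplane_ofReal_smul_coe (s : UnitSphere V) (r : ℝ) :
    toRealHyperplane s ((r : ℂ) • (s : V)) = 0 := by
  rw [toRealHyperplane_smul_coe, Complex.ofReal_im, zero_smul]

theorem exists_smul_chartIx_eq {w : V} (hw : w ≠ 0) :
    ∃ a : ℂ, a ≠ 0 ∧ a • (projCharts.chartIx (Projectivization.mk ℂ w hw) : V) = w := by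
  have h := ip_smul_eq_of_mem_submodule (sphereProj_chartIx _) (mem_submodule_mk hw)
  refine ⟨_, fun h0 => hw ?_, h⟩
  rw [← h, h0, zero_smul]

theorem ipNorm_smul_unitVec {w : V} (hw : w ≠ 0) : (ipNorm w : ℂ) • (unitVec w hw : V) = w :=
  smul_inv_smul₀ (ofReal_ipNorm_ne_zero hw) w

theorem ofReal_ipNorm_sq {w : V} (hw : w ≠ 0) : (ipNorm w : ℂ) ^ 2 = ip w w := by
  rw [ip_self_eq, ipNorm, ← Complex.ofReal_pow, Real.sq_sqrt (ip_self_pos hw).le]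

section Slice

variable {F : Type*} [AddCommGroup F] [Module ℝ F] [TopologicalSpace F] {f : V → F} {w : F}
  {ψ : UnitSphere V}

theorem HasDirDeriv.comp_add_hyperplane {x v : hyperplane ψ}
    (h : HasDirDeriv ℝ f ((ψ : V) + x) v w) :
    HasDirDeriv ℝ (fun y : hyperplane ψ => f ((ψ : V) + y)) x v w :=
  h.comp_add_linearMap ((hyperplane ψ).subtype.restrictScalars ℝ)

theorem HasDirDeriv.comp_add_realHyperplane {x v : realHyperplane ψ}
    (h : HasDirDeriv ℝ f ((ψ : V) + x) v w) :
    HasDirDeriv ℝ (fun y : realHyperplane ψ => f ((ψ : V) + y)) x v w :=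
  h.comp_add_linearMap (realHyperplane ψ).subtype

end Slice

end TangentAlgebra

section Tangent

variable {V : Type*} [AddCommGroup V] [Module ℂ V] [TopologicalSpace V]
  [InnerProductSpace.Core ℂ V] [ContinuousIp V] [IsTopologicalAddGroup V] [ContinuousSMul ℂ V]

theorem toHyperplane_smul (φ : UnitSphere V) (a : ℂ) (v : V) :
    toHyperplane φ (a • v) = a • toHyperplane φ v :=
  (toHyperplaneCLM φ).map_smul a v

theorem hasDirDeriv_projCoord {φ : UnitSphere V} {a : ℂ} (ha : a ≠ 0) (v : V) :
    HasDirDeriv ℝ (projCoord φ) (a • (φ : V)) v (a⁻¹ • toHyperplane φ v) := by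
  have hip : ipCLM (φ : V) (a • (φ : V)) = a :=
    (ip_smul_right _ _ _).trans (by rw [φ.ip_self, mul_one])
  have h := (((hasDirDeriv_clm (ipCLM (φ : V)) (a • (φ : V)) v).inv (by rwa [hip])).smul
    (hasDirDeriv_clm (ContinuousLinearMap.id ℂ V) (a • (φ : V)) v)).clm_comp (toHyperplaneCLM φ)
  have h0 : toHyperplaneCLM φ (ContinuousLinearMap.id ℂ V (a • (φ : V))) = 0 :=
    toHyperplane_smul_coe φ a
  rw [hip, map_add, map_smul (toHyperplaneCLM φ), h0, smul_zero, zero_add,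
    map_smul (toHyperplaneCLM φ)] at h
  exact h.restrictScalars

theorem hasDirDeriv_sphereCoord {s : UnitSphere V} {r : ℝ} (hr : r ≠ 0) (v : V) :
    HasDirDeriv ℝ (sphereCoord s) ((r : ℂ) • (s : V)) v (r⁻¹ • toRealHyperplane s v) := by
  set L : V →L[ℝ] ℝ := Complex.reCLM ∘L (ipCLM (s : V)).restrictScalars ℝ
  have hre : L ((r : ℂ) • (s : V)) = r :=
    (congrArg Complex.re (ip_smul_right _ _ _)).trans
      (by rw [s.ip_self, mul_one, Complex.ofReal_re])
  have h := (((hasDirDeriv_clm L ((r : ℂ) • (s : V)) v).inv (by rwa [hre])).smul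
    (hasDirDeriv_clm (ContinuousLinearMap.id ℝ V) ((r : ℂ) • (s : V)) v)).clm_comp
    (toRealHyperplaneCLM s)
  have h0 : toRealHyperplaneCLM s (ContinuousLinearMap.id ℝ V ((r : ℂ) • (s : V))) = 0 :=
    toRealHyperplane_ofReal_smul_coe s r
  rw [hre, map_add, map_smul (toRealHyperplaneCLM s), h0, smul_zero, zero_add,
    map_smul (toRealHyperplaneCLM s)] at h
  have hfun : sphereCoord s = fun w => toRealHyperplaneCLM s ((L w)⁻¹ • w) :=
    funext fun w => by
      rw [sphereCoord, ← Complex.ofReal_inv]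
      rfl
  rw [hfun]
  exact h

theorem toTan_projCharts (ψ : UnitSphere V) (x v : hyperplane ψ) {a : ℂ} (ha : a ≠ 0)
    (h : a • (projCharts.chartIx (projCharts.invFun ψ x) : V) = (ψ : V) + x) :
    projCharts.toTan ψ x v =
      a⁻¹ • toHyperplane (projCharts.chartIx (projCharts.invFun ψ x)) (v : V) := by
  have hd := hasDirDeriv_projCoord (φ := projCharts.chartIx (projCharts.invFun ψ x)) ha (v : V)
  rw [h] at hd
  rw [← hd.comp_add_hyperplane.dirDeriv_eq, ChartFamily.toTan]
  simp only [projCharts_toFun_invFun]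

theorem toTan_sphereCharts (ψ : UnitSphere V) (x v : realHyperplane ψ) :
    sphereCharts.toTan ψ x v =
      (ipNorm ((ψ : V) + x))⁻¹ • toRealHyperplane (sphereCharts.invFun ψ x) (v : V) := by
  have hw := add_ne_zero_of_re ψ x.2
  have hd := hasDirDeriv_sphereCoord (s := sphereCharts.invFun ψ x) (ipNorm_pos hw).ne' (v : V)
  have h : (ipNorm ((ψ : V) + x) : ℂ) • (sphereCharts.invFun ψ x : V) = (ψ : V) + x :=
    ipNorm_smul_unitVec hw
  rw [h] at hd
  rw [← hd.comp_add_realHyperplane.dirDeriv_eq, ChartFamily.toTan]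
  exact congrArg (fun f => dirDeriv ℝ f x v) <| funext fun y =>
    sphereCharts_toFun_unitVec _ (add_ne_zero_of_re ψ y.2)

theorem tangentMap_sphereProj (s : UnitSphere V) (v : realHyperplane s) {b : ℂ} (hb : b ≠ 0)
    (h : b • (projCharts.chartIx (sphereProj s) : V) = s) :
    ChartFamily.tangentMap sphereCharts projCharts sphereProj s v =
      b⁻¹ • toHyperplane (projCharts.chartIx (sphereProj s)) (v : V) := by
  have hd := hasDirDeriv_projCoord (φ := projCharts.chartIx (sphereProj s)) hb (v : V)
  rw [h] at hd
  have h0 : (s : V) + (0 : realHyperplane s) = s := add_zero _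
  have hd' := (HasDirDeriv.comp_add_realHyperplane (x := 0) (by rwa [h0])).dirDeriv_eq
  rw [← sphereCoord_self s] at hd'
  refine Eq.trans (congrArg (fun f => dirDeriv ℝ f (sphereCoord s s) v) <| funext fun y => ?_) hd'
  exact (congrArg _ (sphereProj_unitVec (add_ne_zero_of_re s y.2))).trans (projCharts_toFun_mk _ _)

theorem tangentMap_sphereProj_toTan (ψ : UnitSphere V) (x v : realHyperplane ψ) {a : ℂ}
    (ha : a ≠ 0) (h : a • (projCharts.chartIx (sphereProj (sphereCharts.invFun ψ x)) : V) =
      (ψ : V) + x) :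
    ChartFamily.tangentMap sphereCharts projCharts sphereProj (sphereCharts.invFun ψ x)
        (sphereCharts.toTan ψ x v) =
      a⁻¹ • toHyperplane (projCharts.chartIx (sphereProj (sphereCharts.invFun ψ x))) (v : V) := by
  have hN := ofReal_ipNorm_ne_zero (add_ne_zero_of_re ψ x.2)
  set N := ipNorm ((ψ : V) + x)
  set s := sphereCharts.invFun ψ x
  have hs : ((N : ℂ)⁻¹ * a) • (projCharts.chartIx (sphereProj s) : V) = s := by
    rw [mul_smul, h]
    rfl
  have hv : (sphereCharts.toTan ψ x v : V) = (N : ℂ)⁻¹ • (toRealHyperplane s (v : V) : V) := by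
    rw [toTan_sphereCharts, ← Complex.ofReal_inv]
    rfl
  refine (tangentMap_sphereProj s _ (mul_ne_zero (inv_ne_zero hN) ha) hs).trans ?_
  rw [hv, toHyperplane_smul, toHyperplane_toRealHyperplane hs, smul_smul, mul_inv, inv_inv,
    mul_right_comm, mul_inv_cancel₀ hN, one_mul]

end Tangent

/-! ### The Fubini–Study form -/

section LiftedForms

variable {V : Type*} [AddCommGroup V] [Module ℂ V] [InnerProductSpace.Core ℂ V]

/-- The pullback of the Hermitian form of `ℙ(V)` along `V \ {0} → ℙ(V)`, at the point `w` on the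
vectors `u` and `v`. -/
def fubiniStudyLift (w u v : V) : ℂ :=
  2 * (ip u v * ip w w - ip u w * ip w v) / ip w w ^ 2

/-- The connection form `⟨w, dw⟩ / ⟨w, w⟩` on `V \ {0}`, at the point `w` on the vector `v`. -/
def radialForm (w v : V) : ℂ :=
  ip w v / ip w w

theorem fubiniStudyLift_smul (φ : UnitSphere V) {a : ℂ} (ha : a ≠ 0) (u v : V) :
    fubiniStudyLift (a • (φ : V)) u v =
      2 * ip ((a⁻¹ • toHyperplane φ u : hyperplane φ) : V) (a⁻¹ • toHyperplane φ v : hyperplane φ)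
    := by
  have ha' : star a ≠ 0 := star_ne_zero.2 ha
  simp only [fubiniStudyLift, Submodule.coe_smul, ip_smul_left, ip_smul_right, ip_toHyperplane,
    φ.ip_self, star_inv₀]
  field_simp

theorem star_fubiniStudyLift (w u v : V) :
    star (fubiniStudyLift w u v) = fubiniStudyLift w v u := by
  simp only [fubiniStudyLift, star_div₀, star_mul', star_sub, star_pow, star_ip, star_ofNat]
  ring

theorem sub_star_eq_I_mul (z : ℂ) : z - star z = 2 * (Complex.I * (z.im : ℂ)) := by
  rw [Complex.star_def, Complex.sub_conj, Complex.ofReal_mul, Complex.ofReal_ofNat]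
  ring

/-- The derivative at `w` in the direction `z` of `fubiniStudyLift` on fixed vectors `u`, `v`. -/
def fubiniStudyLiftDeriv (w z u v : V) : ℂ :=
  2 * ((ip u v * (ip z w + ip w z) - ip u z * ip w v - ip u w * ip z v) * ip w w -
    2 * (ip u v * ip w w - ip u w * ip w v) * (ip z w + ip w z)) / ip w w ^ 3

theorem star_fubiniStudyLiftDeriv (w z u v : V) :
    star (fubiniStudyLiftDeriv w z u v) = fubiniStudyLiftDeriv w z v u := by
  simp only [fubiniStudyLiftDeriv, star_div₀, star_mul', star_sub, star_add, star_pow, star_ip,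
    star_ofNat]
  ring

/- The cyclic sum is invariant under exchanging the last two arguments, that is, real. -/
theorem im_fubiniStudyLiftDeriv_cyclic (w u v z : V) :
    (fubiniStudyLiftDeriv w u v z).im + (fubiniStudyLiftDeriv w v z u).im +
      (fubiniStudyLiftDeriv w z u v).im = 0 := by
  rw [← Complex.add_im, ← Complex.add_im, ← Complex.conj_eq_iff_im, ← Complex.star_def, star_add,
    star_add, star_fubiniStudyLiftDeriv, star_fubiniStudyLiftDeriv, star_fubiniStudyLiftDeriv]
  simp only [fubiniStudyLiftDeriv]
  ring

end LiftedForms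

section LiftedFormsCalculus

variable {V : Type*} [AddCommGroup V] [Module ℂ V] [TopologicalSpace V]
  [InnerProductSpace.Core ℂ V] [ContinuousIp V] [IsTopologicalAddGroup V] [ContinuousSMul ℂ V]

theorem HasDirDeriv.scalarProd {E : Type*} [AddCommGroup E] [Module ℝ E] {f g : E → V} {x v : E}
    {a b : V} (hf : HasDirDeriv ℝ f x v a) (hg : HasDirDeriv ℝ g x v b) :
    HasDirDeriv ℝ (fun y => ip (f y) (g y)) x v (ip a (g x) + ip (f x) b) :=
  hf.bilin (ipBilin V) ContinuousIp.continuous_ip hg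

theorem MBSmoothOn.scalarProd {E : Type u} [AddCommGroup E] [Module ℝ E] [TopologicalSpace E]
    {f g : E → V} {U : Set E} (hf : MBSmoothOn ℝ f U) (hg : MBSmoothOn ℝ g U) :
    MBSmoothOn ℝ (fun x => ip (f x) (g x)) U :=
  hf.bilin (ipBilin V) ContinuousIp.continuous_ip hg

theorem hasDirDeriv_ip_self (w u : V) :
    HasDirDeriv ℝ (fun y : V => ip y y) w u (ip u w + ip w u) :=
  have h := hasDirDeriv_clm (ContinuousLinearMap.id ℝ V) w u
  h.scalarProd h

theorem hasDirDeriv_ip_left (w u v : V) : HasDirDeriv ℝ (fun y : V => ip y v) w u (ip u v) := by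
  have h := (hasDirDeriv_clm (ContinuousLinearMap.id ℝ V) w u).scalarProd (hasDirDeriv_const w u v)
  rwa [ip_zero_right, add_zero] at h

theorem hasDirDeriv_fubiniStudyLift {w : V} (hw : w ≠ 0) (z u v : V) :
    HasDirDeriv ℝ (fun y => fubiniStudyLift y u v) w z (fubiniStudyLiftDeriv w z u v) := by
  have hN := ip_self_ne_zero hw
  have hself := hasDirDeriv_ip_self w z
  have hu : HasDirDeriv ℝ (ip u) w z (ip u z) :=
    hasDirDeriv_clm ((ipCLM u).restrictScalars ℝ) w z
  have hnum := ((hasDirDeriv_const w z (ip u v)).mul hself).sub (hu.mul (hasDirDeriv_ip_left w z v))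
  have hden := hself.mul hself
  have h := ((hasDirDeriv_const w z (2 : ℂ)).mul hnum).div hden (mul_ne_zero hN hN)
  simp only [← sq] at h
  refine Eq.subst (motive := HasDirDeriv ℝ _ w z) ?_ h
  rw [fubiniStudyLiftDeriv]
  field_simp
  ring

theorem hasDirDeriv_radialForm {w : V} (hw : w ≠ 0) (u v : V) :
    HasDirDeriv ℝ (fun y => radialForm y v) w u
      ((ip u v * ip w w - ip w v * (ip u w + ip w u)) / ip w w ^ 2) :=
  (hasDirDeriv_ip_left w u v).div (hasDirDeriv_ip_self w u) (ip_self_ne_zero hw)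

theorem extDeriv₂_im_fubiniStudyLift {w : V} (hw : w ≠ 0) (u v z : V) :
    extDeriv₂ (fun y a b => (fubiniStudyLift y a b).im) w u v z = 0 := by
  have hd : ∀ u v z : V, dirDeriv ℝ (fun y => (fubiniStudyLift y v z).im) w u =
      (fubiniStudyLiftDeriv w u v z).im :=
    fun u v z => ((hasDirDeriv_fubiniStudyLift hw u v z).clm_comp Complex.imCLM).dirDeriv_eq
  rw [extDeriv₂, hd, hd, hd, im_fubiniStudyLiftDeriv_cyclic]

theorem extDeriv₁_radialForm {w : V} (hw : w ≠ 0) (u v : V) :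
    extDeriv₁ (radialForm : V → V → ℂ) w u v = Complex.I * ((fubiniStudyLift w u v).im : ℂ) := by
  refine mul_left_cancel₀ two_ne_zero ?_
  rw [← sub_star_eq_I_mul, star_fubiniStudyLift, extDeriv₁,
    (hasDirDeriv_radialForm hw u v).dirDeriv_eq, (hasDirDeriv_radialForm hw v u).dirDeriv_eq,
    fubiniStudyLift, fubiniStudyLift]
  ring

theorem extDeriv₁_im_radialForm {w : V} (hw : w ≠ 0) (u v : V) :
    extDeriv₁ (fun y a : V => (radialForm y a).im) w u v = (fubiniStudyLift w u v).im := by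
  have hd : ∀ u v : V, dirDeriv ℝ (fun y => (radialForm y v).im) w u =
      (dirDeriv ℝ (fun y => radialForm y v) w u).im := fun u v => by
    have h := hasDirDeriv_radialForm hw u v
    rw [h.dirDeriv_eq]
    exact (h.clm_comp Complex.imCLM).dirDeriv_eq
  rw [extDeriv₁, hd, hd, ← Complex.sub_im, ← extDeriv₁.eq_def, extDeriv₁_radialForm hw,
    Complex.I_mul_im, Complex.ofReal_re]

section Smooth

variable {E : Type u} [AddCommGroup E] [Module ℝ E] [TopologicalSpace E]
  {f g h : E → V} {U : Set E}

theorem MBSmoothOn.radialForm (hf : MBSmoothOn ℝ f U) (hg : MBSmoothOn ℝ g U)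
    (h0 : ∀ x ∈ U, f x ≠ 0) : MBSmoothOn ℝ (fun x => radialForm (f x) (g x)) U :=
  (hf.scalarProd hg).div (hf.scalarProd hf) fun x hx => ip_self_ne_zero (h0 x hx)

theorem MBSmoothOn.fubiniStudyLift (hf : MBSmoothOn ℝ f U) (hg : MBSmoothOn ℝ g U)
    (hh : MBSmoothOn ℝ h U) (h0 : ∀ x ∈ U, f x ≠ 0) :
    MBSmoothOn ℝ (fun x => fubiniStudyLift (f x) (g x) (h x)) U := by
  have hN := hf.scalarProd hf
  have hnum := (mbSmoothOn_const (2 : ℂ) U).mul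
    (((hg.scalarProd hh).mul hN).sub ((hg.scalarProd hf).mul (hf.scalarProd hh)))
  have hquot := hnum.div (hN.mul hN) fun x hx =>
    mul_ne_zero (ip_self_ne_zero (h0 x hx)) (ip_self_ne_zero (h0 x hx))
  simp only [← sq] at hquot
  exact hquot

end Smooth

end LiftedFormsCalculus

section Kaehler

variable {V : Type*} [AddCommGroup V] [Module ℂ V] [InnerProductSpace.Core ℂ V]

theorem imForm_fubiniStudyH : (projCharts (V := V)).imForm fubiniStudyH = fubiniStudyΩ := by
  funext p v w
  exact Complex.im_ofReal_mul 2 _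

variable [TopologicalSpace V] [ContinuousIp V] [IsTopologicalAddGroup V] [ContinuousSMul ℂ V]

theorem rep₂_fubiniStudyH (ψ : UnitSphere V) (x u v : hyperplane ψ) :
    projCharts.rep₂ fubiniStudyH ψ x u v = fubiniStudyLift ((ψ : V) + x) u v := by
  obtain ⟨a, ha, h⟩ := exists_smul_chartIx_eq (add_ne_zero_of_mem ψ x)
  rw [ChartFamily.rep₂, toTan_projCharts ψ x u ha h, toTan_projCharts ψ x v ha h, ← h,
    fubiniStudyLift_smul _ ha]
  rfl

theorem rep₂_fubiniStudyΩ (ψ : UnitSphere V) (x u v : hyperplane ψ) :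
    projCharts.rep₂ fubiniStudyΩ ψ x u v = (fubiniStudyLift ((ψ : V) + x) u v).im := by
  rw [← imForm_fubiniStudyH, ← rep₂_fubiniStudyH]
  rfl

theorem rep₂_pullback₂_fubiniStudyΩ (ψ : UnitSphere V) (x u v : realHyperplane ψ) :
    sphereCharts.rep₂ (ChartFamily.pullback₂ sphereCharts projCharts sphereProj fubiniStudyΩ)
      ψ x u v = (fubiniStudyLift ((ψ : V) + x) u v).im := by
  have hw := add_ne_zero_of_re ψ x.2
  obtain ⟨a, ha, h⟩ := exists_smul_chartIx_eq hw
  rw [← sphereProj_unitVec hw] at h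
  rw [ChartFamily.rep₂, ChartFamily.pullback₂, tangentMap_sphereProj_toTan ψ x u ha h,
    tangentMap_sphereProj_toTan ψ x v ha h, ← h, fubiniStudyLift_smul _ ha,
    ← imForm_fubiniStudyH]
  rfl

theorem rep₂_fubiniStudyH_zero (ψ : UnitSphere V) (v w : hyperplane ψ) :
    projCharts.rep₂ fubiniStudyH ψ 0 v w = 2 * ip (v : V) (w : V) := by
  have h := fubiniStudyLift_smul ψ one_ne_zero (v : V) w
  rw [one_smul, inv_one, one_smul, one_smul, toHyperplane_coe, toHyperplane_coe] at h
  rw [rep₂_fubiniStudyH, Submodule.coe_zero, add_zero, h]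

theorem rep₂_fubiniStudyΩ_zero (ψ : UnitSphere V) (v w : hyperplane ψ) :
    projCharts.rep₂ fubiniStudyΩ ψ 0 v w = 2 * (ip (v : V) (w : V)).im := by
  rw [rep₂_fubiniStudyΩ, ← rep₂_fubiniStudyH, rep₂_fubiniStudyH_zero]
  exact Complex.im_ofReal_mul 2 _

theorem isSmoothTwoTensor_fubiniStudyH :
    (projCharts (V := V)).IsSmoothTwoTensor fubiniStudyH where
  linear_left p w :=
    { map_add := fun v v' =>
        (congrArg (2 * ·) (ip_add_left (v : V) v' w)).trans (mul_add _ _ _)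
      map_smul := fun r v =>
        (congrArg (2 * ·) (ip_real_smul_left (v : V) w r)).trans (mul_left_comm _ _ _) }
  linear_right p v :=
    { map_add := fun w w' =>
        (congrArg (2 * ·) (ip_add_right (v : V) w w')).trans (mul_add _ _ _)
      map_smul := fun r w =>
        (congrArg (2 * ·) (ip_real_smul_right (v : V) w r)).trans (mul_left_comm _ _ _) }
  smooth ψ := by
    simp only [rep₂_fubiniStudyH]
    have hcoe : ∀ L : hyperplane ψ × hyperplane ψ × hyperplane ψ →L[ℝ] hyperplane ψ,
        MBSmoothOn ℝ (fun x => (L x : V)) (univ ×ˢ univ) := fun L =>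
      mbSmoothOn_clm (((hyperplane ψ).subtypeL.restrictScalars ℝ).comp L) _
    exact MBSmoothOn.fubiniStudyLift
      ((mbSmoothOn_const (ψ : V) _).add (hcoe (ContinuousLinearMap.fst ℝ _ _)))
      (hcoe ((ContinuousLinearMap.fst ℝ _ _).comp (ContinuousLinearMap.snd ℝ _ _)))
      (hcoe ((ContinuousLinearMap.snd ℝ _ _).comp (ContinuousLinearMap.snd ℝ _ _)))
      fun x _ => add_ne_zero_of_mem ψ x.1

theorem ChartFamily.IsSmoothTwoTensor.imForm {M ι : Type*} {E : ι → Type*}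
    [∀ i, AddCommGroup (E i)] [∀ i, Module ℝ (E i)] [∀ i, TopologicalSpace (E i)]
    {A : ChartFamily M E} {H : ∀ p, A.Tan p → A.Tan p → ℂ} (h : A.IsSmoothTwoTensor H) :
    A.IsSmoothTwoTensor (A.imForm H) where
  linear_left p w := (Complex.imLm.comp (h.linear_left p w).mk').isLinear
  linear_right p v := (Complex.imLm.comp (h.linear_right p v).mk').isLinear
  smooth i := (h.smooth i).clm_comp Complex.imCLM

variable [LocallyConvexSpace ℝ V]

theorem isHermitian_fubiniStudyH : (projCharts (V := V)).IsHermitian fubiniStudyH where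
  manifold := isLCManifold_projCharts
  tensor := isSmoothTwoTensor_fubiniStudyH
  linear p v :=
    { map_add := (isSmoothTwoTensor_fubiniStudyH.linear_right p v).map_add
      map_smul := fun r w =>
        (congrArg (2 * ·) (ip_smul_right (v : V) w r)).trans (mul_left_comm _ _ _) }
  conj_symm p v w := by
    rw [fubiniStudyH, fubiniStudyH, star_mul', star_ip, star_ofNat]
  posDef p v hv := by
    have hpos := ip_self_pos (Subtype.coe_ne_coe.2 hv)
    exact (mul_pos two_pos hpos).trans_eq (Complex.re_ofReal_mul 2 _).symm

theorem isSymplectic_fubiniStudyΩ : (projCharts (V := V)).IsSymplectic fubiniStudyΩ where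
  manifold := isLCManifold_projCharts.restrictScalars
  tensor := imForm_fubiniStudyH (V := V) ▸ isSmoothTwoTensor_fubiniStudyH.imForm
  alternating p v := by rw [fubiniStudyΩ, ip_self_eq, Complex.ofReal_im, mul_zero]
  closed ψ x _ u v z := by
    have hrep : projCharts.rep₂ fubiniStudyΩ ψ = fun y a b : hyperplane ψ =>
        (fubiniStudyLift ((ψ : V) + y) (a : V) (b : V)).im :=
      funext fun y => funext fun a => funext fun b => rep₂_fubiniStudyΩ ψ y a b
    rw [hrep]
    exact (extDeriv₂_comp_add_linearMap (fun y a b : V => (fubiniStudyLift y a b).im)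
      ((hyperplane ψ).subtype.restrictScalars ℝ) ψ x u v z).trans
      (extDeriv₂_im_fubiniStudyLift (add_ne_zero_of_mem ψ x) _ _ _)
  nondegenerate p v h := by
    by_contra hv
    have hpos := ip_self_pos (Subtype.coe_ne_coe.2 hv)
    have h0 := h (Complex.I • v)
    rw [fubiniStudyΩ, Submodule.coe_smul, ip_smul_right, Complex.I_mul_im] at h0
    linarith

theorem isKaehler_fubiniStudyH : (projCharts (V := V)).IsKaehler fubiniStudyH where
  hermitian := isHermitian_fubiniStudyH
  symplectic := imForm_fubiniStudyH (V := V) ▸ isSymplectic_fubiniStudyΩ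

end Kaehler

/-! ### The principal connection on the sphere -/

section SphereConnectionAlgebra

variable {V : Type*} [AddCommGroup V] [Module ℂ V] [InnerProductSpace.Core ℂ V]

theorem sphereα_eq_im (s : UnitSphere V) (v : realHyperplane s) :
    sphereα s v = (ip (s : V) (v : V)).im := by
  simp [sphereα]

theorem isLinearMap_sphereα (s : UnitSphere V) : IsLinearMap ℝ (sphereα s) where
  map_add v w := by
    refine (sphereα_eq_im s _).trans (Eq.trans ?_
      (congrArg₂ (· + ·) (sphereα_eq_im s v) (sphereα_eq_im s w)).symm)
    exact (congrArg Complex.im (ip_add_right (s : V) v w)).trans (Complex.add_im _ _)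
  map_smul r v := by
    refine (sphereα_eq_im s _).trans (Eq.trans ?_ (congrArg (r * ·) (sphereα_eq_im s v)).symm)
    exact (congrArg Complex.im (ip_real_smul_right (s : V) v r)).trans (Complex.im_ofReal_mul _ _)

theorem sphereα_toRealHyperplane (s : UnitSphere V) (v : V) :
    sphereα s (toRealHyperplane s v) = (ip (s : V) v).im := by
  rw [sphereα_eq_im, coe_toRealHyperplane, ip_sub_right, ip_smul_right, s.ip_self, mul_one,
    Complex.sub_im, Complex.ofReal_im, sub_zero]

theorem ip_circle_smul (z : Circle) (x y : V) : ip ((z : ℂ) • x) ((z : ℂ) • y) = ip x y := by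
  rw [ip_smul_left, ip_smul_right, ← mul_assoc, Complex.star_def, Complex.conj_mul',
    Circle.norm_coe, Complex.ofReal_one, one_pow, one_mul]

theorem sphereCoord_smul_coe (s : UnitSphere V) (a : ℂ) :
    sphereCoord s (a • (s : V)) = (a.im / a.re) • toRealHyperplane s (Complex.I • (s : V)) := by
  rw [sphereCoord, ip_smul_right, s.ip_self, mul_one, smul_smul, toRealHyperplane_smul_coe,
    ← Complex.ofReal_inv, Complex.im_ofReal_mul, div_eq_inv_mul]

end SphereConnectionAlgebra

section SphereConnection

variable {V : Type*} [AddCommGroup V] [Module ℂ V] [TopologicalSpace V]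
  [InnerProductSpace.Core ℂ V] [ContinuousIp V] [IsTopologicalAddGroup V] [ContinuousSMul ℂ V]

theorem rep₁_sphereα (ψ : UnitSphere V) (x v : realHyperplane ψ) :
    sphereCharts.rep₁ sphereα ψ x v = (radialForm ((ψ : V) + x) (v : V)).im := by
  have hw := add_ne_zero_of_re ψ x.2
  have hs : (sphereCharts.invFun ψ x : V) = ((ipNorm ((ψ : V) + x))⁻¹ : ℂ) • ((ψ : V) + x) := rfl
  calc sphereα _ (sphereCharts.toTan ψ x v)
      = (ipNorm ((ψ : V) + x))⁻¹ * (ip (sphereCharts.invFun ψ x : V) (v : V)).im := by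
        refine (congrArg (sphereα _) (toTan_sphereCharts ψ x v)).trans ?_
        rw [← sphereα_toRealHyperplane]
        exact (isLinearMap_sphereα _).map_smul _ _
    _ = (ip ((ψ : V) + x) (v : V)).im / ipNorm ((ψ : V) + x) ^ 2 := by
        rw [hs, ← Complex.ofReal_inv, ip_smul_left, Complex.star_def, Complex.conj_ofReal,
          Complex.im_ofReal_mul]
        ring
    _ = (radialForm ((ψ : V) + x) (v : V)).im := by
        rw [radialForm, ← ofReal_ipNorm_sq hw, ← Complex.ofReal_pow, Complex.div_ofReal_im]

theorem isSmoothOneForm_sphereα : (sphereCharts (V := V)).IsSmoothOneForm sphereα where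
  linear := isLinearMap_sphereα
  smooth ψ := by
    simp only [rep₁_sphereα]
    have hcoe : ∀ L : realHyperplane ψ × realHyperplane ψ →L[ℝ] realHyperplane ψ,
        MBSmoothOn ℝ (fun x => (L x : V)) (univ ×ˢ univ) := fun L =>
      mbSmoothOn_clm ((realHyperplane ψ).subtypeL.comp L) _
    exact (((mbSmoothOn_const (ψ : V) _).add (hcoe (ContinuousLinearMap.fst ℝ _ _))).radialForm
      (hcoe (ContinuousLinearMap.snd ℝ _ _)) fun x _ => add_ne_zero_of_re ψ x.1.2).clm_comp
      Complex.imCLM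

theorem tangentMap_circle_smul (z : Circle) (s : UnitSphere V) (v : realHyperplane s) :
    ChartFamily.tangentMap sphereCharts sphereCharts (z • ·) s v =
      toRealHyperplane (z • s) ((z : ℂ) • (v : V)) := by
  have hd := hasDirDeriv_sphereCoord (s := z • s) one_ne_zero ((z : ℂ) • (v : V))
  rw [Complex.ofReal_one, one_smul, inv_one, one_smul, coe_circle_smul] at hd
  have hslice := HasDirDeriv.comp_add_linearMap
    ((LinearMap.lsmul ℂ V (z : ℂ)).restrictScalars ℝ ∘ₗ (realHyperplane s).subtype)
    (a := (z : ℂ) • (s : V)) (x := 0) (v := v) (by simpa using hd)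
  have hd' := hslice.dirDeriv_eq
  rw [← sphereCoord_self s] at hd'
  refine Eq.trans (congrArg (fun f => dirDeriv ℝ f (sphereCoord s s) v) <| funext fun y => ?_) hd'
  have hy := add_ne_zero_of_re s y.2
  have hzy : (z : ℂ) • ((s : V) + y) ≠ 0 := smul_ne_zero (Circle.coe_ne_zero z) hy
  have hcoord := sphereCharts_toFun_unitVec (z • s) hzy
  rw [unitVec_smul hy hzy, phase_coe_circle, smul_add] at hcoord
  exact hcoord

theorem circleField_sphereCharts (s : UnitSphere V) :
    circleField sphereCharts s = toRealHyperplane s (Complex.I • (s : V)) := by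
  have hcoord : ∀ t : ℝ, sphereCharts.toFun (sphereCharts.chartIx s) (Circle.exp t • s) =
      Real.tan t • toRealHyperplane s (Complex.I • (s : V)) := fun t => by
    refine (sphereCoord_smul_coe s _).trans ?_
    rw [Circle.coe_exp, Complex.exp_ofReal_mul_I_im, Complex.exp_ofReal_mul_I_re,
      Real.tan_eq_sin_div_cos]
  have htan : HasDirDeriv ℝ Real.tan 0 1 1 := by
    rw [hasDirDeriv_iff_hasDerivAt]
    simpa using Real.hasDerivAt_tan (x := 0) (by simp)
  rw [circleField]
  simp only [hcoord]
  have h := (htan.smul (hasDirDeriv_const 0 1 (toRealHyperplane s (Complex.I • (s : V)))))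
  rw [one_smul, smul_zero, add_zero] at h
  exact h.dirDeriv_eq

theorem isPrincipalConnection_sphereα : IsPrincipalConnection (sphereCharts (V := V)) sphereα where
  form := isSmoothOneForm_sphereα
  invariant z s v := by
    refine (congrArg (sphereα _) (tangentMap_circle_smul z s v)).trans ?_
    rw [sphereα_toRealHyperplane, coe_circle_smul, ip_circle_smul]
    exact (sphereα_eq_im s v).symm
  generator s := by
    rw [circleField_sphereCharts, sphereα_toRealHyperplane, ip_smul_right, s.ip_self, mul_one,
      Complex.I_im]

theorem principalCurvature_sphereα :
    PrincipalCurvature (sphereCharts (V := V)) projCharts sphereProj sphereα fubiniStudyΩ := by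
  intro ψ x _ u v
  have hrep : sphereCharts.rep₁ sphereα ψ = fun y a : realHyperplane ψ =>
      (radialForm ((ψ : V) + y) (a : V)).im :=
    funext fun y => funext fun a => rep₁_sphereα ψ y a
  rw [hrep, rep₂_pullback₂_fubiniStudyΩ]
  exact (extDeriv₁_comp_add_linearMap (fun y a : V => (radialForm y a).im)
    (realHyperplane ψ).subtype ψ x u v).trans
    (extDeriv₁_im_radialForm (add_ne_zero_of_re ψ x.2) _ _)

end SphereConnection

/-! ### The principal bundle -/

section Phase

theorem phase_ofReal_mul {r : ℝ} (hr : 0 < r) (a : ℂ) : phase (r * a) = phase a := by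
  rw [phase, phase, Complex.arg_real_mul a hr]

theorem coe_phase {a : ℂ} (ha : a ≠ 0) : (phase a : ℂ) = (‖a‖ : ℂ)⁻¹ * a := by
  rw [eq_inv_mul_iff_mul_eq₀ (Complex.ofReal_ne_zero.2 (norm_ne_zero_iff.2 ha)), norm_mul_phase]

theorem continuousOn_phase : ContinuousOn phase {0}ᶜ := by
  refine Topology.IsInducing.subtypeVal.continuousOn_iff.2 ?_
  have h : ContinuousOn (fun a : ℂ => (‖a‖ : ℂ)⁻¹ * a) {0}ᶜ :=
    ((Complex.continuous_ofReal.comp continuous_norm).continuousOn.inv₀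
      fun a ha => Complex.ofReal_ne_zero.2 (norm_ne_zero_iff.2 ha)).mul continuousOn_id
  exact h.congr fun a ha => coe_phase ha

theorem div_eq_norm_mul_phase_div (a : ℂ) (z : Circle) :
    a / z = ‖a‖ * ((phase a / z : Circle) : ℂ) := by
  rw [Circle.coe_div, ← mul_div_assoc, norm_mul_phase]

theorem div_mem_slitPlane_iff {a : ℂ} (ha : a ≠ 0) (z : Circle) :
    a / z ∈ Complex.slitPlane ↔ phase a ∈ circleCharts.source z := by
  change _ ↔ ((phase a / z : Circle) : ℂ) ∈ Complex.slitPlane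
  rw [div_eq_norm_mul_phase_div, Complex.mem_slitPlane_iff_arg, Complex.mem_slitPlane_iff_arg,
    Complex.arg_real_mul _ (norm_pos_iff.2 ha)]
  simp [ha]

theorem mbSmoothOn_arg : MBSmoothOn ℝ Complex.arg Complex.slitPlane := by
  refine mbSmoothOn_of_contDiffOn (fun a ha => ?_) Complex.isOpen_slitPlane
  have h := Complex.imCLM.contDiff.contDiffAt.comp a
    ((Complex.contDiffAt_log (n := (⊤ : ℕ∞)) ha).restrict_scalars ℝ)
  exact h.contDiffWithinAt.congr (fun b _ => (Complex.log_im b).symm) (Complex.log_im a).symm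

theorem mbSmoothOn_circleCharts_phase (z : Circle) :
    MBSmoothOn ℝ (fun a => circleCharts.toFun z (phase a)) {a : ℂ | a / z ∈ Complex.slitPlane} := by
  have hdiv : Continuous fun a : ℂ => a / z := continuous_id.div_const _
  have hO : IsOpen {a : ℂ | a / z ∈ Complex.slitPlane} := Complex.isOpen_slitPlane.preimage hdiv
  have hsmooth : MBSmoothOn ℝ (fun a : ℂ => a / z) {a : ℂ | a / z ∈ Complex.slitPlane} :=
    mbSmoothOn_of_contDiffOn (contDiff_id.div_const _).contDiffOn hO
  refine (mbSmoothOn_arg.comp Complex.isOpen_slitPlane hsmooth fun _ ha => ha).congr hO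
    fun a ha => ?_
  have ha0 : a ≠ 0 := (div_ne_zero_iff.1 (Complex.slitPlane_ne_zero ha)).1
  simp only [div_eq_norm_mul_phase_div, Complex.arg_real_mul _ (norm_pos_iff.2 ha0)]
  rfl

theorem MBSmoothOn.coe_mul_circle_exp {D : Type u} [AddCommGroup D] [Module ℝ D]
    [TopologicalSpace D] {f : D → ℝ} {U : Set D} (hf : MBSmoothOn ℝ f U) (z : Circle) :
    MBSmoothOn ℝ (fun x => ((z * Circle.exp (f x) : Circle) : ℂ)) U := by
  have h : ContDiff ℝ (⊤ : ℕ∞) fun t : ℝ => (Circle.exp t : ℂ) :=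
    (Complex.ofRealCLM.contDiff.mul contDiff_const).cexp
  simp only [Circle.coe_mul]
  exact (mbSmoothOn_const (z : ℂ) U).mul
    ((mbSmoothOn_of_contDiffOn h.contDiffOn isOpen_univ).comp isOpen_univ hf (mapsTo_univ _ _))

end Phase

section SphereSection

variable {V : Type*} [AddCommGroup V] [Module ℂ V] [InnerProductSpace.Core ℂ V]

theorem circle_smul_unitVec (z : Circle) {w : V} (hw : w ≠ 0) :
    z • unitVec w hw = unitVec ((z : ℂ) • w) (smul_ne_zero z.coe_ne_zero hw) := by
  rw [unitVec_smul hw, phase_coe_circle]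

theorem phase_ip_unitVec (y : V) {w : V} (hw : w ≠ 0) :
    phase (ip y (unitVec w hw : V)) = phase (ip y w) := by
  rw [coe_unitVec, ip_smul_right, ← Complex.ofReal_inv,
    phase_ofReal_mul (inv_pos.2 (ipNorm_pos hw))]

theorem sphereProj_sphereCharts_invFun (ψ : UnitSphere V) (x : realHyperplane ψ) :
    sphereProj (sphereCharts.invFun ψ x) =
      Projectivization.mk ℂ ((ψ : V) + x) (add_ne_zero_of_re ψ x.2) :=
  sphereProj_unitVec _

/-- The section `[χ] ↦ ⟨ψ, χ⟩⁻¹ χ / ‖⟨ψ, χ⟩⁻¹ χ‖` of `S(V) → P(V)` over the domain of `κ_ψ`, which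
trivializes the bundle there. -/
def sphereSection (ψ : UnitSphere V) (p : ℙ ℂ V) : UnitSphere V :=
  sphereCharts.invFun ψ (hyperplaneIncl ψ (projCharts.toFun ψ p))

theorem sphereSection_mk (ψ : UnitSphere V) {w : V} (hw : w ≠ 0) :
    sphereSection ψ (Projectivization.mk ℂ w hw) =
      unitVec ((ψ : V) + projCoord ψ w) (add_ne_zero_of_mem ψ (projCoord ψ w)) := by
  rw [sphereSection, projCharts_toFun_mk]
  rfl

theorem sphereProj_sphereSection {ψ : UnitSphere V} {p : ℙ ℂ V} (hp : p ∈ projCharts.source ψ) :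
    sphereProj (sphereSection ψ p) = p :=
  (sphereProj_unitVec (add_ne_zero_of_mem ψ (projCharts.toFun ψ p))).trans (projCharts_left_inv hp)

theorem phase_ip_smul_sphereSection (ψ : UnitSphere V) (z : Circle) (p : ℙ ℂ V) :
    phase (ip (ψ : V) (z • sphereSection ψ p : UnitSphere V)) = z := by
  have hw := add_ne_zero_of_mem ψ (projCharts.toFun ψ p)
  change phase (ip (ψ : V) (z • unitVec _ hw : UnitSphere V)) = z
  rw [circle_smul_unitVec, phase_ip_unitVec, ip_smul_right, ip_add_coe, mul_one, phase_coe_circle]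

theorem phase_ip_smul_sphereSection_sphereProj {ψ s : UnitSphere V} (h : ip (ψ : V) s ≠ 0) :
    phase (ip (ψ : V) s) • sphereSection ψ (sphereProj s) = s := by
  have hw := smul_ne_zero (inv_ne_zero h) s.ne_zero
  have hs : sphereSection ψ (sphereProj s) = unitVec ((ip (ψ : V) s)⁻¹ • (s : V)) hw := by
    rw [sphereProj, sphereSection_mk]
    simp only [add_projCoord h]
  rw [hs, unitVec_smul s.ne_zero, unitVec_coe, smul_smul, ← phase_mul h (inv_ne_zero h),
    mul_inv_cancel₀ h, ← Complex.ofReal_one, phase_ofReal one_pos, one_smul]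

end SphereSection

section PrincipalBundle

variable {V : Type*} [AddCommGroup V] [Module ℂ V] [TopologicalSpace V]
  [InnerProductSpace.Core ℂ V]

theorem smoothMapOn_phase_ip [ContinuousIp V] [IsTopologicalAddGroup V] (ψ : UnitSphere V) :
    (sphereCharts (V := V)).SmoothMapOn circleCharts (fun s => phase (ip (ψ : V) s))
      (sphereProj ⁻¹' projCharts.source ψ) := by
  have hmem (s : UnitSphere V) (hs : sphereProj s ∈ projCharts.source ψ) : ip (ψ : V) s ≠ 0 :=
    (mk_mem_projCharts_source s.ne_zero).1 hs
  refine ⟨continuousOn_phase.comp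
    (continuous_ip continuous_const continuous_subtype_val).continuousOn hmem, fun φ z => ?_⟩
  have hinv (x : realHyperplane φ) : phase (ip (ψ : V) (sphereCharts.invFun φ x : V)) =
      phase (ip (ψ : V) ((φ : V) + x)) := phase_ip_unitVec _ (add_ne_zero_of_re φ x.2)
  have hopen : IsOpen {a : ℂ | a / z ∈ Complex.slitPlane} :=
    Complex.isOpen_slitPlane.preimage (continuous_id.div_const _)
  simp only [hinv]
  refine (mbSmoothOn_circleCharts_phase z).comp hopen ((mbSmoothOn_add_realHyperplane φ _).clm_comp
    ((ipCLM (ψ : V)).restrictScalars ℝ)) fun x hx => ?_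
  have hx0 : ip (ψ : V) ((φ : V) + x) ≠ 0 := by
    have h := hx.2.1
    rwa [mem_preimage, sphereProj_sphereCharts_invFun, mk_mem_projCharts_source] at h
  exact (div_mem_slitPlane_iff hx0 z).2 hx.2.2

variable [ContinuousSMul ℂ V]

theorem continuous_circle_smul : Continuous fun q : Circle × UnitSphere V => q.1 • q.2 :=
  ((continuous_subtype_val.comp continuous_fst).smul
    (continuous_subtype_val.comp continuous_snd)).subtype_mk _

variable [ContinuousIp V] [IsTopologicalAddGroup V]

theorem continuousOn_sphereSection (ψ : UnitSphere V) :
    ContinuousOn (sphereSection ψ) (projCharts.source ψ) :=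
  ((continuous_sphereCharts_invFun ψ).comp (continuous_subtype_val.subtype_mk _ :
    Continuous (hyperplaneIncl ψ))).comp_continuousOn (continuousOn_projCharts_toFun ψ)

variable [LocallyConvexSpace ℝ V]

theorem MBSmoothOn.sphereCharts_toFun {D : Type u} [AddCommGroup D] [Module ℝ D]
    [TopologicalSpace D] {f : D → V} {U : Set D} (hf : MBSmoothOn ℝ f U) {h0 : ∀ x, f x ≠ 0}
    {g : D → UnitSphere V} (hg : ∀ x, g x = unitVec (f x) (h0 x)) {ψ : UnitSphere V}
    (hU : ∀ x ∈ U, g x ∈ sphereCharts.source ψ) :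
    MBSmoothOn ℝ (fun x => sphereCharts.toFun ψ (g x)) U := by
  simp only [hg] at hU
  simp only [hg, sphereCharts_toFun_unitVec]
  exact (mbSmoothOn_sphereCoord ψ).comp (isOpen_re_ip_pos _) hf
    fun x hx => (unitVec_mem_sphereCharts_source (h0 x)).1 (hU x hx)

theorem smoothMapOn_circle_smul :
    (circleCharts.prod (sphereCharts (V := V))).SmoothMapOn sphereCharts
      (fun q => q.1 • q.2) univ := by
  refine ⟨continuous_circle_smul.continuousOn, fun i φ => ?_⟩
  obtain ⟨z, ψ⟩ := i
  have hsmooth (U : Set (ℝ × realHyperplane ψ)) : MBSmoothOn ℝ (fun x : ℝ × realHyperplane ψ =>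
      ((z * Circle.exp x.1 : Circle) : ℂ) • ((ψ : V) + x.2)) U := by
    have hcircle := (mbSmoothOn_clm (ContinuousLinearMap.fst ℝ ℝ (realHyperplane ψ)) U)
      |>.coe_mul_circle_exp z
    have hpoint := (mbSmoothOn_add_realHyperplane ψ univ).comp_clm
      (ContinuousLinearMap.snd ℝ ℝ _) (mapsTo_univ _ U)
    exact hcircle.smul hpoint
  have hinv (x : ℝ × realHyperplane ψ) := circle_smul_unitVec (z * Circle.exp x.1)
    (add_ne_zero_of_re ψ x.2.2)
  exact (hsmooth _).sphereCharts_toFun hinv fun x hx => hx.2.2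

theorem smoothMapOn_sphereProj :
    (sphereCharts (V := V)).SmoothMapOn projCharts sphereProj univ := by
  refine ⟨continuous_sphereProj.continuousOn, fun ψ φ => ?_⟩
  simp only [sphereProj_sphereCharts_invFun, projCharts_toFun_mk, mk_mem_projCharts_source]
  exact (mbSmoothOn_projCoord φ).restrictScalars.comp (isOpen_ip_ne_zero _)
    (mbSmoothOn_add_realHyperplane ψ _) fun x hx => hx.2.2

theorem smoothMapOn_smul_sphereSection (ψ : UnitSphere V) :
    (projCharts.prod circleCharts).SmoothMapOn sphereCharts
      (fun q => q.2 • sphereSection ψ q.1) (projCharts.source ψ ×ˢ univ) := by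
  refine ⟨continuous_circle_smul.comp_continuousOn (continuousOn_snd.prodMk
    ((continuousOn_sphereSection ψ).comp continuousOn_fst fun x hx => hx.1)), fun i χ => ?_⟩
  obtain ⟨φ, z⟩ := i
  have hinv (x : hyperplane φ × ℝ) : (z * Circle.exp x.2) • sphereSection ψ
      (projCharts.invFun φ x.1) = _ :=
    (congrArg _ (sphereSection_mk ψ (add_ne_zero_of_mem φ x.1))).trans
      (circle_smul_unitVec (z * Circle.exp x.2) (add_ne_zero_of_mem ψ _))
  have hsmooth {U : Set (hyperplane φ × ℝ)} (hU : ∀ x ∈ U, ip (ψ : V) ((φ : V) + x.1) ≠ 0) :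
      MBSmoothOn ℝ (fun x : hyperplane φ × ℝ => ((z * Circle.exp x.2 : Circle) : ℂ) •
        ((ψ : V) + projCoord ψ ((φ : V) + x.1))) U := by
    have hcircle := (mbSmoothOn_clm (ContinuousLinearMap.snd ℝ (hyperplane φ) ℝ) U)
      |>.coe_mul_circle_exp z
    have hpoint := (mbSmoothOn_add_hyperplane φ univ).restrictScalars.comp_clm
      (ContinuousLinearMap.fst ℝ _ ℝ) (mapsTo_univ _ U)
    have hcoord := ((mbSmoothOn_projCoord ψ).restrictScalars.comp (isOpen_ip_ne_zero _) hpoint hU)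
      |>.clm_comp ((hyperplane ψ).subtypeL.restrictScalars ℝ)
    exact hcircle.smul ((mbSmoothOn_const (ψ : V) U).add hcoord)
  exact (hsmooth fun x hx => projCharts_invFun_mem_source.1 hx.2.1.1).sphereCharts_toFun hinv
    fun x hx => hx.2.2

theorem isPrincipalCircleBundle_sphereProj :
    IsPrincipalCircleBundle sphereCharts projCharts (sphereProj (V := V)) where
  total := isLCManifold_sphereCharts
  base := isLCManifold_projCharts.restrictScalars
  smooth_action := smoothMapOn_circle_smul
  smooth_proj := smoothMapOn_sphereProj
  locally_trivial p := by
    have hp := mem_projCharts_source_chartIx p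
    generalize projCharts.chartIx p = ψ at hp
    exact ⟨projCharts.source ψ, isOpen_projCharts_source ψ, hp,
      fun q => q.2 • sphereSection ψ q.1, fun s => phase (ip (ψ : V) s),
      fun q hq z => (sphereProj_smul z _).trans (sphereProj_sphereSection hq),
      fun q _ z w => mul_smul z w _, fun q _ z => phase_ip_smul_sphereSection ψ z q,
      fun s hs =>
        phase_ip_smul_sphereSection_sphereProj ((mk_mem_projCharts_source s.ne_zero).1 hs),
      smoothMapOn_smul_sphereSection ψ, smoothMapOn_phase_ip ψ⟩

end PrincipalBundle

/-! ### The tautological connection -/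

section Differential

variable {M : Type*} [TopologicalSpace M] {ι : Type*} {E : ι → Type*} [∀ i, AddCommGroup (E i)]
  [∀ i, Module ℝ (E i)] [∀ i, TopologicalSpace (E i)] {A : ChartFamily M E}
  {R : Type*} [AddCommGroup R] [Module ℝ R] [TopologicalSpace R] [T2Space R]
  {g g' : M → R} {U : Set M} {p : M}

theorem ChartFamily.SmoothFunOn.dFun_congr (hA : IsLCManifold ℝ A) (hU : IsOpen U)
    (hg : A.SmoothFunOn g U) (h : EqOn g g' U) (hp : p ∈ U) (v : A.Tan p) :
    A.dFun g p v = A.dFun g' p v :=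
  have := (hA.model (A.chartIx p)).addGroup
  have := (hA.model (A.chartIx p)).smul
  ((hg.hasDirDeriv hA hp v).congr_of_eqOn (hA.isOpen_inter_preimage _ hU)
    (hA.toFun_chartIx_mem hp) fun _ hx => h hx.2).dirDeriv_eq.symm

theorem ChartFamily.SmoothFunOn.dFun_add [ContinuousAdd R] (hA : IsLCManifold ℝ A)
    (hg : A.SmoothFunOn g U) (hg' : A.SmoothFunOn g' U) (hp : p ∈ U) (v : A.Tan p) :
    A.dFun (fun q => g q + g' q) p v = A.dFun g p v + A.dFun g' p v :=
  ((hg.hasDirDeriv hA hp v).add (hg'.hasDirDeriv hA hp v)).dirDeriv_eq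

theorem ChartFamily.SmoothFunOn.dFun_smul [ContinuousAdd R] [ContinuousSMul ℝ R] [Module ℂ R]
    [IsScalarTower ℝ ℂ R] [ContinuousSMul ℂ R] {a : M → ℂ} (hA : IsLCManifold ℝ A)
    (ha : A.SmoothFunOn a U) (hg : A.SmoothFunOn g U) (hp : p ∈ U) (v : A.Tan p) :
    A.dFun (fun q => a q • g q) p v = A.dFun a p v • g p + a p • A.dFun g p v := by
  have h := ((ha.hasDirDeriv hA hp v).smul (hg.hasDirDeriv hA hp v)).dirDeriv_eq
  rwa [hA.invFun_toFun_chartIx] at h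

end Differential

section TautSections

variable {V : Type*} [AddCommGroup V] [Module ℂ V] [InnerProductSpace.Core ℂ V]

theorem ip_coe_smul_add_hyperplane (ψ : UnitSphere V) (x : hyperplane ψ)
    (l : TautFib V (projCharts.invFun ψ x)) : ip (ψ : V) l • ((ψ : V) + x) = l := by
  rw [← coe_tautFrames_frame_invFun_self]
  exact congrArg Subtype.val (tautFrames_coord_smul_frame (projCharts_invFun_mem_source_self ψ x) l)

theorem ip_chartIx_smul {p : ℙ ℂ V} (l : TautFib V p) :
    ip (projCharts.chartIx p : V) l • (projCharts.chartIx p : V) = l :=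
  ip_smul_eq_of_mem_submodule (sphereProj_chartIx p) l.2

theorem ip_coe_smul_tautVec (s : UnitSphere V) (c : ℂ) :
    ip (s : V) (c • tautVec s : TautFib V (sphereProj s)) = c :=
  (ip_smul_right (s : V) s c).trans (by rw [s.ip_self, mul_one])

theorem ip_ip_smul_chartIx {p : ℙ ℂ V} (l : TautFib V p) (v : V) :
    ip (l : V) (ip (projCharts.chartIx p : V) v • (projCharts.chartIx p : V)) = ip (l : V) v := by
  rw [← ip_chartIx_smul l, ip_smul_left, ip_smul_left, ip_smul_right, UnitSphere.ip_self, mul_one]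

theorem ip_smul_eq_radialForm_smul {φ : UnitSphere V} {w : V} {a : ℂ} (ha : a ≠ 0)
    (h : a • (φ : V) = w) (v : V) : ip (φ : V) v • (φ : V) = radialForm w v • w := by
  have ha' : star a ≠ 0 := star_ne_zero.2 ha
  subst h
  rw [radialForm, ip_smul_left, ip_smul_left, ip_smul_right, φ.ip_self, smul_smul]
  congr 1
  field_simp

variable [TopologicalSpace V] [ContinuousIp V] [IsTopologicalAddGroup V] [ContinuousSMul ℂ V]

theorem smoothSectionOn_tautFrames_iff {s : ∀ q, TautFib V q} {U : Set (ℙ ℂ V)} :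
    SmoothSectionOn projCharts tautFrames s U ↔
      projCharts.SmoothFunOn (fun q => (s q : V)) U := by
  refine forall_congr' fun ψ => ⟨fun h => ?_, fun h => h.clm_comp ((ipCLM _).restrictScalars ℝ)⟩
  have hs : (fun x => (s (projCharts.invFun ψ x) : V)) =
      fun x => ip (ψ : V) (s (projCharts.invFun ψ x) : V) • ((ψ : V) + x) :=
    funext fun x => (ip_coe_smul_add_hyperplane ψ x _).symm
  rw [hs]
  exact MBSmoothOn.smul h (mbSmoothOn_add_hyperplane ψ _).restrictScalars

theorem smoothSectionOn_tautFrames_frame (ψ : UnitSphere V) :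
    SmoothSectionOn projCharts tautFrames (tautFrames.frame ψ) (projCharts.source ψ) := by
  refine smoothSectionOn_tautFrames_iff.2 fun φ => ?_
  simp only [coe_tautFrames_frame_invFun]
  have hadd := (mbSmoothOn_add_hyperplane φ
    (projCharts.target φ ∩ projCharts.invFun φ ⁻¹' projCharts.source ψ)).restrictScalars (𝕜 := ℂ)
  exact ((hadd.clm_comp ((ipCLM (ψ : V)).restrictScalars ℝ)).inv
    fun x hx => projCharts_invFun_mem_source.1 hx.2).smul hadd

end TautSections

section SphereEmbedding

variable {V : Type*} [AddCommGroup V] [Module ℂ V] [TopologicalSpace V]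
  [InnerProductSpace.Core ℂ V] [ContinuousIp V] [IsTopologicalAddGroup V] [ContinuousSMul ℂ V]

theorem hasDirDeriv_ipNorm {w : V} (hw : w ≠ 0) (u : V) :
    HasDirDeriv ℝ ipNorm w u ((ip w u).re / ipNorm w) := by
  have h := (hasDirDeriv_ip_self w u).clm_comp Complex.reCLM
  rw [hasDirDeriv_iff_hasDerivAt] at h ⊢
  have hw' : (ip (w + (0 : ℝ) • u) (w + (0 : ℝ) • u)).re ≠ 0 := by
    simpa using (ip_self_pos hw).ne'
  refine (h.sqrt hw').congr_deriv ?_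
  have hre : (ip u w).re = (ip w u).re := by rw [← star_ip]; rfl
  simp only [zero_smul, add_zero, Complex.reCLM_apply, Complex.add_re, hre, ipNorm]
  ring

theorem hasDirDeriv_coe_sphereCharts_invFun (s : UnitSphere V) (Y : realHyperplane s) :
    HasDirDeriv ℝ (fun y => (sphereCharts.invFun s y : V)) 0 Y (Y : V) := by
  have hN := hasDirDeriv_ipNorm s.ne_zero (Y : V)
  rw [re_ip_realHyperplane, zero_div] at hN
  have h := ((hN.inv (ipNorm_pos s.ne_zero).ne').clm_comp Complex.ofRealCLM).smul
    (hasDirDeriv_clm (ContinuousLinearMap.id ℝ V) (s : V) (Y : V))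
  simp only [neg_zero, zero_div, map_zero, zero_smul, zero_add, s.ipNorm, inv_one,
    Complex.ofRealCLM_apply, Complex.ofReal_one, Complex.ofReal_inv, one_smul,
    ContinuousLinearMap.id_apply] at h
  have h0 : (s : V) + (0 : realHyperplane s) = s := add_zero _
  rw [← h0] at h
  exact h.comp_add_realHyperplane

theorem mbSmoothOn_coe_sphereCharts_invFun (ψ : UnitSphere V) (U : Set (realHyperplane ψ)) :
    MBSmoothOn ℝ (fun y => (sphereCharts.invFun ψ y : V)) U := by
  have hadd := mbSmoothOn_add_realHyperplane ψ U
  have hsqrt : MBSmoothOn ℝ Real.sqrt {0}ᶜ :=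
    mbSmoothOn_of_contDiffOn (fun r hr => (Real.contDiffAt_sqrt hr).contDiffWithinAt)
      isOpen_compl_singleton
  have hnorm : MBSmoothOn ℝ (fun y : realHyperplane ψ => (ipNorm ((ψ : V) + y) : ℂ)) U :=
    (hsqrt.comp isOpen_compl_singleton ((hadd.scalarProd hadd).clm_comp Complex.reCLM)
      fun y _ => (ip_self_pos (add_ne_zero_of_re ψ y.2)).ne').clm_comp Complex.ofRealCLM
  exact (hnorm.inv fun y _ => ofReal_ipNorm_ne_zero (add_ne_zero_of_re ψ y.2)).smul hadd

end SphereEmbedding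

section HorizontalLift

variable {V : Type*} [AddCommGroup V] [Module ℂ V] [InnerProductSpace.Core ℂ V]

theorem sphereCharts_invFun_zero (s : UnitSphere V) : sphereCharts.invFun s 0 = s :=
  (congrArg _ (sphereCoord_self s).symm).trans
    (sphereCharts_left_inv (mem_sphereCharts_source_self s))

theorem sphereProj_sphereCharts_invFun_hyperplaneIncl (φ : UnitSphere V) (x : hyperplane φ) :
    sphereProj (sphereCharts.invFun φ (hyperplaneIncl φ x)) = projCharts.invFun φ x :=
  sphereProj_sphereCharts_invFun φ _

variable [TopologicalSpace V] [ContinuousIp V] [IsTopologicalAddGroup V] [ContinuousSMul ℂ V]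

theorem dFun_ip_section {σ : ∀ q, TautFib V q} {s : UnitSphere V} {Y : realHyperplane s}
    (hY : ip (s : V) (Y : V) = 0) {d : V}
    (h : HasDirDeriv ℝ (fun y => (σ (sphereProj (sphereCharts.invFun s y)) : V)) 0 Y d) :
    sphereCharts.dFun (fun χ => ip (χ : V) (σ (sphereProj χ) : V)) s Y = ip (s : V) d := by
  have hline : ip (Y : V) (σ (sphereProj s) : V) = 0 := by
    rw [← ip_smul_eq_of_mem_submodule rfl (σ (sphereProj s)).2, ip_smul_right,
      ← star_ip (s : V) (Y : V), hY,
      star_zero, mul_zero]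
  have hd := (hasDirDeriv_coe_sphereCharts_invFun s Y).scalarProd h
  rw [sphereCharts_invFun_zero, hline, zero_add, ← sphereCoord_self s] at hd
  exact hd.dirDeriv_eq

variable [LocallyConvexSpace ℝ V] {s s' : ∀ q, TautFib V q} {U : Set (ℙ ℂ V)}

theorem coe_tautConnection (hs : projCharts.SmoothFunOn (fun q => (s q : V)) U) {p : ℙ ℂ V}
    (hp : p ∈ U) (X : (projCharts (V := V)).Tan p) :
    (tautConnection p X s : V) =
      ip (projCharts.chartIx p : V) (projCharts.dFun (fun q => (s q : V)) p X) •
        (projCharts.chartIx p : V) := by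
  have h := hs.hasDirDeriv isLCManifold_projCharts.restrictScalars hp X
  rw [projCharts_toFun_chartIx] at h
  refine congrArg (· • (projCharts.chartIx p : V)) (dFun_ip_section (ip_hyperplane X) ?_)
  refine h.congr_line ?_ (Eventually.of_forall fun t => ?_)
  · rw [← sphereProj_sphereCharts_invFun_hyperplaneIncl]
    rfl
  · rw [← sphereProj_sphereCharts_invFun_hyperplaneIncl]
    rfl

theorem tautFrames_coord_tautConnection (hs : projCharts.SmoothFunOn (fun q => (s q : V)) U)
    (hU : IsOpen U) {ψ : UnitSphere V} {x : hyperplane ψ} (hx : projCharts.invFun ψ x ∈ U)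
    (v : hyperplane ψ) :
    tautFrames.coord ψ (projCharts.invFun ψ x)
        (tautConnection (projCharts.invFun ψ x) (projCharts.toTan ψ x v) s) =
      radialForm ((ψ : V) + x) (dirDeriv ℝ (fun y => (s (projCharts.invFun ψ y) : V)) x v) := by
  obtain ⟨a, ha, h⟩ := exists_smul_chartIx_eq (add_ne_zero_of_mem ψ x)
  replace h : a • (projCharts.chartIx (projCharts.invFun ψ x) : V) = (ψ : V) + x := h
  change ip (ψ : V) (tautConnection _ _ s : V) = _
  rw [coe_tautConnection hs hx, ip_smul_eq_radialForm_smul ha h,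
    hs.dFun_toTan isLCManifold_projCharts.restrictScalars hU (mem_univ _) hx, ip_smul_right,
    ip_add_coe, mul_one]

theorem tautConnection_add (hs : projCharts.SmoothFunOn (fun q => (s q : V)) U)
    (hs' : projCharts.SmoothFunOn (fun q => (s' q : V)) U) {p : ℙ ℂ V} (hp : p ∈ U)
    (X : (projCharts (V := V)).Tan p) :
    tautConnection p X (fun q => s q + s' q) = tautConnection p X s + tautConnection p X s' := by
  have hadd : projCharts.SmoothFunOn (fun q => ((s q + s' q : TautFib V q) : V)) U :=
    fun ψ => (hs ψ).add (hs' ψ)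
  refine Subtype.ext ?_
  rw [Submodule.coe_add, coe_tautConnection hadd hp, coe_tautConnection hs hp,
    coe_tautConnection hs' hp, ← add_smul, ← ip_add_right]
  exact congrArg (ip _ · • _) (hs.dFun_add isLCManifold_projCharts.restrictScalars hs' hp X)

theorem tautConnection_smul {g : ℙ ℂ V → ℂ} (hg : projCharts.SmoothFunOn g U)
    (hs : projCharts.SmoothFunOn (fun q => (s q : V)) U) {p : ℙ ℂ V} (hp : p ∈ U)
    (X : (projCharts (V := V)).Tan p) :
    tautConnection p X (fun q => g q • s q) =
      projCharts.dFun g p X • s p + g p • tautConnection p X s := by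
  have hsmul : projCharts.SmoothFunOn (fun q => ((g q • s q : TautFib V q) : V)) U :=
    fun ψ => (hg ψ).smul (hs ψ)
  have hd := hg.dFun_smul isLCManifold_projCharts.restrictScalars hs hp X
  refine Subtype.ext ?_
  rw [Submodule.coe_add, Submodule.coe_smul, Submodule.coe_smul, coe_tautConnection hsmul hp,
    coe_tautConnection hs hp]
  refine (congrArg (ip _ · • _) hd).trans ?_
  rw [ip_add_right, ip_smul_right, ip_smul_right, add_smul, mul_smul, mul_smul, ip_chartIx_smul]

theorem isConnection_tautConnection :
    IsConnection (projCharts (V := V)) tautFrames tautConnection where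
  linear U s hU hs p hp := by
    have hs := smoothSectionOn_tautFrames_iff.1 hs
    have hlin := hs.isLinearMap_dFun isLCManifold_projCharts.restrictScalars hU hp
    refine ⟨fun X Y => Subtype.ext ?_, fun a X => Subtype.ext ?_⟩
    · rw [Submodule.coe_add, coe_tautConnection hs hp, coe_tautConnection hs hp,
        coe_tautConnection hs hp, hlin.map_add, ip_add_right, add_smul]
    · rw [coe_tautConnection hs hp, hlin.map_smul, ip_real_smul_right, mul_smul]
      exact congrArg ((a : ℂ) • ·) (coe_tautConnection hs hp X).symm
  local_eq U s s' hU hs h p hp X := Subtype.ext <| by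
    have hA := (isLCManifold_projCharts (V := V)).restrictScalars
    have hs := smoothSectionOn_tautFrames_iff.1 hs
    have h : EqOn (fun q => (s q : V)) (fun q => (s' q : V)) U :=
      fun q hq => congrArg Subtype.val (h q hq)
    rw [coe_tautConnection hs hp, coe_tautConnection (hs.congr hA hU h) hp,
      hs.dFun_congr hA hU h hp]
  add U s s' _ hs hs' p hp X :=
    tautConnection_add (smoothSectionOn_tautFrames_iff.1 hs)
      (smoothSectionOn_tautFrames_iff.1 hs') hp X
  leibniz U g s _ hg hs p hp X :=
    tautConnection_smul hg (smoothSectionOn_tautFrames_iff.1 hs) hp X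
  smooth U s hU hs ψ := by
    have hA := (isLCManifold_projCharts (V := V)).restrictScalars
    have hs := smoothSectionOn_tautFrames_iff.1 hs
    have hpoint := ((mbSmoothOn_add_hyperplane ψ univ).restrictScalars (𝕜 := ℂ)).comp_clm
      (ContinuousLinearMap.fst ℝ _ (hyperplane ψ))
      (mapsTo_univ _ ((projCharts.target ψ ∩ projCharts.invFun ψ ⁻¹' U) ×ˢ univ))
    refine (hpoint.radialForm ((hs ψ).dirDeriv_prod (hA.isOpen_inter_preimage ψ hU))
      fun x _ => add_ne_zero_of_mem ψ x.1).congr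
      ((hA.isOpen_inter_preimage ψ hU).prod isOpen_univ) fun x hx => ?_
    exact (tautFrames_coord_tautConnection hs hU hx.1.2 x.2).symm

theorem connectionForm_tautConnection (ψ : UnitSphere V) (x v : hyperplane ψ) :
    connectionForm projCharts tautFrames tautConnection ψ x v =
      radialForm ((ψ : V) + x) (v : V) := by
  have hs := smoothSectionOn_tautFrames_iff.1 (smoothSectionOn_tautFrames_frame ψ)
  have hd := (hasDirDeriv_clm (ContinuousLinearMap.id ℝ V) ((ψ : V) + x) (v : V))
    |>.comp_add_hyperplane.dirDeriv_eq
  refine (tautFrames_coord_tautConnection hs (isOpen_projCharts_source ψ)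
    (projCharts_invFun_mem_source_self ψ x) v).trans ?_
  simp only [coe_tautFrames_frame_invFun_self]
  exact congrArg (radialForm _) hd

theorem lineBundleCurvature_tautConnection :
    LineBundleCurvature (projCharts (V := V)) tautFrames tautConnection fubiniStudyΩ := by
  intro ψ x _ u v
  have hform : connectionForm projCharts tautFrames tautConnection ψ = fun y a : hyperplane ψ =>
      radialForm ((ψ : V) + y) (a : V) :=
    funext fun y => funext fun a => connectionForm_tautConnection ψ y a
  rw [hform, rep₂_fubiniStudyΩ, ← extDeriv₁_radialForm (add_ne_zero_of_mem ψ x)]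
  exact extDeriv₁_comp_add_linearMap radialForm ((hyperplane ψ).subtype.restrictScalars ℝ) ψ x u v

end HorizontalLift

section Prequantum

variable {V : Type*} [AddCommGroup V] [Module ℂ V] [TopologicalSpace V]
  [InnerProductSpace.Core ℂ V] [ContinuousIp V] [IsTopologicalAddGroup V] [ContinuousSMul ℂ V]

theorem isHermitianMetric_tautMetric :
    IsHermitianMetric (projCharts (V := V)) tautFrames tautMetric where
  linear _ _ := ⟨fun _ _ => ip_add_right _ _ _, fun _ _ => ip_smul_right _ _ _⟩
  conj_symm _ _ _ := (star_ip _ _).symm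
  posDef _ _ hl := ip_self_pos fun h => hl (Subtype.ext h)
  smooth ψ φ :=
    have h := smoothSectionOn_tautFrames_iff.1 (smoothSectionOn_tautFrames_frame ψ) φ
    h.scalarProd h

variable [LocallyConvexSpace ℝ V]

theorem isMetricConnection_tautConnection :
    IsMetricConnection (projCharts (V := V)) tautFrames tautMetric tautConnection := by
  intro U s s' _ hs hs' p hp X
  have hA := (isLCManifold_projCharts (V := V)).restrictScalars
  rw [smoothSectionOn_tautFrames_iff] at hs hs'
  have h := ((hs.hasDirDeriv hA hp X).scalarProd (hs'.hasDirDeriv hA hp X)).dirDeriv_eq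
  rw [hA.invFun_toFun_chartIx] at h
  refine h.trans ?_
  rw [tautMetric, tautMetric, coe_tautConnection hs hp, coe_tautConnection hs' hp,
    ip_ip_smul_chartIx, ← star_ip (s' p : V), ← star_ip (s' p : V), ip_ip_smul_chartIx]

theorem isPrequantum_tautConnection :
    IsPrequantum (projCharts (V := V)) tautFrames tautMetric tautConnection fubiniStudyΩ where
  symplectic := isSymplectic_fubiniStudyΩ
  bundle :=
    { base := isLCManifold_projCharts.restrictScalars
      total := isLCManifold_tautCharts.restrictScalars
      linear := isLineBundle_tautFrames.linear }
  metric := isHermitianMetric_tautMetric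
  connection := isConnection_tautConnection
  metric_connection := isMetricConnection_tautConnection
  curvature := lineBundleCurvature_tautConnection

theorem isAssociatedBundle_tautVec :
    IsAssociatedBundle (sphereCharts (V := V)) projCharts tautFrames sphereProj tautVec where
  smooth := by
    refine ⟨(continuous_induced_rng.2
      (continuous_sphereProj.prodMk continuous_subtype_val)).continuousOn, fun ψ φ => ?_⟩
    have hip := (mbSmoothOn_coe_sphereCharts_invFun ψ (sphereCharts.target ψ ∩
      {x | sphereCharts.invFun ψ x ∈ univ ∧ (⟨sphereProj (sphereCharts.invFun ψ x),
        tautVec (sphereCharts.invFun ψ x)⟩ : Bundle.TotalSpace ℂ (TautFib V)) ∈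
          (tautFrames.charts projCharts).source φ})).clm_comp ((ipCLM (φ : V)).restrictScalars ℝ)
    exact (smoothMapOn_sphereProj.2 ψ φ).prodMk hip
  equivariant z s := tautTotalSpace_ext (sphereProj_smul z s) rfl
  basis s l := by
    refine ⟨ip (s : V) l, Subtype.ext (ip_smul_eq_of_mem_submodule rfl l.2).symm, fun c hc => ?_⟩
    rw [hc]
    exact (ip_coe_smul_tautVec s c).symm

theorem isAssociatedConnection_tautConnection :
    IsAssociatedConnection (sphereCharts (V := V)) projCharts tautFrames sphereProj tautVec
      sphereα tautConnection := by
  intro U σ f hU hσ hf s hs Y hY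
  rw [smoothSectionOn_tautFrames_iff] at hσ
  have hhor : ip (s : V) (Y : V) = 0 :=
    Complex.ext (re_ip_realHyperplane Y) ((sphereα_eq_im s Y).symm.trans hY)
  obtain rfl : (fun χ : UnitSphere V => ip (χ : V) (σ (sphereProj χ) : V)) = f := by
    funext χ
    rw [hf]
    exact ip_coe_smul_tautVec χ (f χ)
  have hd := hσ.hasDirDeriv_tangentMap isLCManifold_projCharts.restrictScalars
    isLCManifold_sphereCharts hU smoothMapOn_sphereProj hs Y
  obtain ⟨a, ha, h⟩ := exists_smul_chartIx_eq s.ne_zero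
  have hbase : sphereCharts.toFun (sphereCharts.chartIx s) s = 0 :=
    (sphereCharts_toFun s s).trans (sphereCoord_self s)
  rw [hbase] at hd
  refine Subtype.ext ((coe_tautConnection hσ hs _).trans ?_)
  refine (ip_smul_eq_radialForm_smul ha h _).trans ?_
  rw [radialForm, s.ip_self, div_one]
  exact congrArg (· • (s : V)) (dFun_ip_section hhor hd).symm

end Prequantum

end

/-- Let `V` be a complex locally convex space with a continuous Hermitian scalar product. -/
theorem mainTheorem3 {V : Type*} [AddCommGroup V] [Module ℂ V] [TopologicalSpace V]
    [IsTopologicalAddGroup V] [ContinuousSMul ℂ V] [LocallyConvexSpace ℝ V]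
    [InnerProductSpace.Core ℂ V] (hip : Continuous fun x : V × V => ip x.1 x.2) :
    -- `P(V)` with the Hermitian form `H` is a locally convex Kähler manifold
    (projCharts (V := V)).IsKaehler fubiniStudyH ∧
    -- with symplectic form `Ω`
    (projCharts (V := V)).imForm fubiniStudyH = fubiniStudyΩ ∧
    -- `H` and `Ω` are given by `2 ⟨v, w⟩` and `2 Im ⟨v, w⟩` in the chart `κ_ψ` at `[ψ]`, for every
    -- unit vector `ψ`
    (∀ (ψ : UnitSphere V) (v w : hyperplane ψ),
      projCharts.rep₂ fubiniStudyH ψ 0 v w = 2 * ip (v : V) (w : V) ∧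
      projCharts.rep₂ fubiniStudyΩ ψ 0 v w = 2 * (ip (v : V) (w : V)).im) ∧
    -- `S(V) → P(V)` is a principal `U(1)`-bundle with connection `α` and curvature `Ω`
    IsPrincipalCircleBundle sphereCharts projCharts (sphereProj (V := V)) ∧
    IsPrincipalConnection (sphereCharts (V := V)) sphereα ∧
    PrincipalCurvature (sphereCharts (V := V)) projCharts sphereProj sphereα fubiniStudyΩ ∧
    -- `L(V)` is a holomorphic line bundle over `P(V)` that is associated to `S(V)`, and `∇` is the
    -- connection inherited from `α`
    IsLineBundle ℂ (projCharts (V := V)) tautFrames ∧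
    IsAssociatedBundle (sphereCharts (V := V)) projCharts tautFrames sphereProj tautVec ∧
    IsAssociatedConnection (sphereCharts (V := V)) projCharts tautFrames sphereProj tautVec
      sphereα tautConnection ∧
    -- `L(V)` with `∇` is a prequantum line bundle for `Ω`
    IsPrequantum (projCharts (V := V)) tautFrames tautMetric tautConnection fubiniStudyΩ := by
  have : ContinuousIp V := ⟨hip⟩
  exact ⟨isKaehler_fubiniStudyH, imForm_fubiniStudyH,
    fun ψ v w => ⟨rep₂_fubiniStudyH_zero ψ v w, rep₂_fubiniStudyΩ_zero ψ v w⟩,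
    isPrincipalCircleBundle_sphereProj, isPrincipalConnection_sphereα, principalCurvature_sphereα,
    isLineBundle_tautFrames, isAssociatedBundle_tautVec, isAssociatedConnection_tautConnection,
    isPrequantum_tautConnection⟩
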